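/- **Setting.** Let $\lambda$ be the security parameter, $d,k,B\ge 1$ with $k\le 2^d$, and $\mathbb G$ a finite abelian group whose elements are written with $\lceil\log_2|\mathbb G|\rceil$ bits. A $k$-block-sparse function $f_{\alpha,\beta}:\{0,1\}^d\times[B]\to\mathbb G$ is given by $k$ distinct positions $\alpha^0,\dots,\alpha^{k-1}\in\{0,1\}^d$ and blocks $\beta^\ell\in\mathbb G^B$: $f(\alpha^\ell,j)=\beta^\ell_j$, and $f=0$ elsewhere. Work is the number of gates of Boolean circuits, and efficient adversaries are polynomial-size circuits. Let $G:\{0,1\}^\lambda\to\{0,1\}^{2(\lambda+2)}$ and $G':\{0,1\}^\lambda\to\mathbb G^B$ be efficiently computable pseudorandom generators (the output bits of $G'$ being converted to group elements). For the asymptotic notions, $2^d$, $B$ and $\log|\mathbb G|$ are polynomially bounded in $\lambda$ and subtraction in $\mathbb G$ has polynomial-size circuits. **Base scheme.** The following two-server scheme $(\mathrm{Gen},\mathrm{Eval})$ uses $G$ in the $d$ inner layers of a binary tree and a generator $E:\{0,1\}^\lambda\to\mathbb G^B$ (originally $E=G'$) at the leaves. Public uniformly random hash functions assign to each node $x$ of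 layer $i\in\{0,\dots,d\}$ two slots $h_i(x)[0],h_i(x)[1]\in[3k]$. A node at a server carries a $\lambda$-bit seed and two control bits; server $b\in\{0,1\}$ starts at the root with its own random seed, and server $1$ has exactly one control bit set, indicated by a public bit. The two children of a node are obtained by expanding its seed by $G$ into two (seed, two bits) and XORing in, for each control bit $c\in\{0,1\}$ of the node that is set, the public correction word in slot $h_i(x)[c]$ of its layer (one seed correction for both children, two bit corrections for each child). At a leaf the seed is expanded by $E$ into a block and the last-layer correction words (in $\mathbb G^B$) of the slots with set control bits are added; server $1$ negates the result. The client assigns to each node on a path to some $\alpha^\ell$ one of its two slots, without collisions within a layer (cuckoo hashing). It chooses the correction words so that at nodes off these paths the two servers hold equal values, at nodes on these paths the servers' control bits differ exactly in the one belonging to the assigned slot, and the output shares add up to $f$; unconstrained values are uniformly random. If no collision-free assignment exists, it shares the zero function instead, with $\alpha^0$ as the only active leaf. The correction words are the same for both servers (broadcast). **Theorem.** There is an absolute constant $C$, and for each $G$ a constant $c$, such that the scheme can be augmented, for all parameters as above and every $G'$, to a verifiable DPF for $k$-block-sparse functions with one additional round of interaction, of the following form. (1) The client sends its keys except the last-layer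 correction words, and an extra message to each server. (2) The servers reveal a random string $h$. (3) The client sends the last-layer correction words of the scheme with leaf generator $E=E_h$, and another extra message to each server. (4) The servers sample a joint random string, exchange messages and accept or reject; their output shares are those of $\mathrm{Eval}$ with $E=E_h$. For every $\lambda\ge 1$: * *Completeness.* Honest clients are always accepted, and the output shares of an honest run add up to the client's function except with probability at most $C(d+1)/k$ (that is, $\tilde O(1/k)$, where $\tilde O$ hides the logarithm $d$ of the number of blocks). * *Soundness.* For all hash functions and every computationally unbounded malicious client, with both servers following the protocol, the probability that both servers accept and the output shares do not add up to a $k$-block-sparse function is at most $(k+1)^C/2^\lambda$. * *Cost.* On top of the base scheme, the total communication (client–server and server–server) is at most $C\,k\,d\,\lambda$ bits, the client's work is at most $k(d+\lambda)^c$, and the work of each server is at most $k\,2^d(d+\lambda)^c$. The work includes the additional cost of evaluating $E_h$ instead of $G'$, at most $2k$ times by the client and $2^d$ times by each server. Moreover the augmented scheme is *zero knowledge* against each semi-honest server: there is a polynomial-size simulator, which is not given the client's function, whose output is computationally indistinguishable, for every sequence of client functions, from the whole view of that server (hash functions, key, extra messages, random strings, and messages from the other server). -/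

import Mathlib

namespace VDPF

open Classical in
/-- Probability of an event under the uniform distribution on a finite type. -/
noncomputable def prob {Ω : Type} [Fintype Ω] (p : Ω → Prop) : ℝ :=
  ((Finset.univ.filter p).card : ℝ) / (Fintype.card Ω : ℝ)

/-- Bit strings of length `n`. -/
abbrev Bits (n : ℕ) : Type := Fin n → Bool

/-! ### Boolean circuits: the cost model and the model of efficient adversaries -/

/-- A wire carries an input bit, or the value of the `n`-th gate (`false` if there is no such gate
before the point where the wire is read). -/
inductive Wire (ι : Type) : Type
  | input (i : ι)
  | gate (n : ℕ)

def Wire.val {ι : Type} (x : ι → Bool) (vals : List Bool) : Wire ι → Bool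
  | .input i => x i
  | .gate n => vals.getD n false

/-- A Boolean circuit with input bits indexed by `ι` and output bits indexed by `ο`: a sequence of
NAND gates with fan-in two, each reading inputs or earlier gates, and a choice of output wires. -/
structure Circuit (ι ο : Type) : Type where
  gates : List (Wire ι × Wire ι)
  out : ο → Wire ι

/-- The number of gates. -/
def Circuit.size {ι ο : Type} (C : Circuit ι ο) : ℕ := C.gates.length

/-- The values of all gates, in order. -/
def Circuit.gateVals {ι ο : Type} (C : Circuit ι ο) (x : ι → Bool) : List Bool :=
  C.gates.foldl (fun vs g => vs ++ [!(g.1.val x vs && g.2.val x vs)]) []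

def Circuit.eval {ι ο : Type} (C : Circuit ι ο) (x : ι → Bool) : ο → Bool :=
  fun o => (C.out o).val x (C.gateVals x)

/-- Growth at most polynomial in the security parameter. -/
def PolyBounded (f : ℕ → ℕ) : Prop := ∃ c : ℕ, ∀ n, f n ≤ n ^ c + c

/-- Computational indistinguishability of two ensembles of bit strings (the uniform distributions on
`Ω n`, `Ω' n` pushed forward by `X n`, `Y n`): polynomial-size circuits have advantage smaller than
every inverse polynomial. -/
def CompIndist (ι Ω Ω' : ℕ → Type) [∀ n, Fintype (Ω n)] [∀ n, Fintype (Ω' n)]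
    (X : ∀ n, Ω n → ι n → Bool) (Y : ∀ n, Ω' n → ι n → Bool) : Prop :=
  ∀ a b : ℕ, ∃ N : ℕ, ∀ n, N ≤ n → 1 ≤ n → ∀ D : Circuit (ι n) Unit, D.size ≤ n ^ a →
    |prob (fun ω => D.eval (X n ω) () = true) - prob (fun ω => D.eval (Y n ω) () = true)|
      ≤ 1 / (n : ℝ) ^ b

/-- The pseudorandom generator `G : {0,1}^n → {0,1}^{2(n+2)}` used in the inner layers. -/
structure IsPRG (G : ∀ n, Bits n → Bits (2 * (n + 2))) : Prop where
  efficient : ∃ c : ℕ, ∀ n, ∃ C : Circuit (Fin n) (Fin (2 * (n + 2))),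
    C.size ≤ n ^ c + c ∧ ∀ s, C.eval s = G n s
  pseudorandom : CompIndist (fun n => Fin (2 * (n + 2))) (fun n => Bits n)
    (fun n => Bits (2 * (n + 2))) (fun n s => G n s) (fun _ r => r)

/-! ### Parameters -/

/-- Parameters of a block-sparse DPF: `2 ^ d` blocks of size `B`, at most `k` of them non-zero,
values in a finite abelian group `𝔾` whose elements are written with `⌈log₂ |𝔾|⌉` bits. -/
structure Params : Type 1 where
  d : ℕ
  k : ℕ
  B : ℕ
  𝔾 : Type
  grp : AddCommGroup 𝔾
  fin : Fintype 𝔾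
  enc : 𝔾 → Bits (Nat.clog 2 (Fintype.card 𝔾))
  enc_inj : Function.Injective enc
  d_pos : 1 ≤ d
  k_pos : 1 ≤ k
  k_le : k ≤ 2 ^ d
  B_pos : 1 ≤ B

instance (P : Params) : AddCommGroup P.𝔾 := P.grp
instance (P : Params) : Fintype P.𝔾 := P.fin

/-- The number of bits of a group element. -/
def Params.bitLen (P : Params) : ℕ := Nat.clog 2 (Fintype.card P.𝔾)

/-- A block of group elements, written in bits. -/
def Params.encBlock (P : Params) (y : Fin P.B → P.𝔾) : Fin P.B × Fin P.bitLen → Bool :=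
  fun t => P.enc (y t.1) t.2

/-- The parameters, as functions of the security parameter, are such that the servers (who expand
`2 ^ d` blocks) are polynomial-time, and the group operation is efficient. -/
structure Admissible (P : ℕ → Params) : Prop where
  blocks : PolyBounded fun n => 2 ^ (P n).d
  blockSize : PolyBounded fun n => (P n).B
  bitLen : PolyBounded fun n => (P n).bitLen
  sub : ∃ c : ℕ, ∀ n, ∃ C : Circuit (Bool × Fin (P n).bitLen) (Fin (P n).bitLen),
    C.size ≤ n ^ c + c ∧
      ∀ a b : (P n).𝔾, C.eval (fun t => (P n).enc (if t.1 then b else a) t.2) = (P n).enc (a - b)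

/-- The generator `G'` of the last layer, with its output bits converted to `B` group elements, is
pseudorandom. -/
structure IsBlockPRG (P : ℕ → Params) (G' : ∀ n, Bits n → Fin (P n).B → (P n).𝔾) : Prop where
  efficient : ∃ c : ℕ, ∀ n, ∃ C : Circuit (Fin n) (Fin (P n).B × Fin (P n).bitLen),
    C.size ≤ n ^ c + c ∧ ∀ s, C.eval s = (P n).encBlock (G' n s)
  pseudorandom : CompIndist (fun n => Fin (P n).B × Fin (P n).bitLen) (fun n => Bits n)
    (fun n => Fin (P n).B → (P n).𝔾) (fun n s => (P n).encBlock (G' n s))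
    (fun n y => (P n).encBlock y)

/-- A description of a `k`-block-sparse function: `k` distinct block positions `α` and the
contents `β` of these blocks. -/
structure Input (P : Params) : Type where
  α : Fin P.k → Bits P.d
  α_inj : Function.Injective α
  β : Fin P.k → Fin P.B → P.𝔾

open Classical in
/-- The block-sparse function `f_{α,β} : {0,1}^d × [B] → 𝔾`. -/
noncomputable def Input.fn {P : Params} (inp : Input P) : Bits P.d → Fin P.B → P.𝔾 :=
  fun x j => ∑ l, if inp.α l = x then inp.β l j else 0

/-- The class of `k`-block-sparse functions. -/
def IsBlockSparse (P : Params) (F : Bits P.d → Fin P.B → P.𝔾) : Prop :=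
  ∃ inp : Input P, F = inp.fn

/-! ### The tree-based scheme with cuckoo hashing (two hash functions, `3k` correction words) -/

/-- The value of a tree node at one server: a seed and two control bits. The first server's values
are `(s, u, q)`, the second server's are `(t, v, r)`. -/
structure NodeVal (n : ℕ) : Type where
  seed : Bits n
  u : Bool
  q : Bool

/-- A correction word `(c, m, p)`: seed correction and, for each child, two bit corrections. -/
abbrev CorrWord (n : ℕ) : Type := Bits n × (Bool → Bool) × (Bool → Bool)

/-- Public hash functions: for each layer `0, …, d`, two slots in `[3k]` for each node. -/
abbrev HashFam (P : Params) : Type := (i : Fin (P.d + 1)) → Bits (i : ℕ) → Bool → Fin (3 * P.k)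

instance (P : Params) : Fintype (HashFam P) := inferInstanceAs (Fintype (∀ _, _))

/-- Parse `G(seed)` as `seed₀ ‖ u₀ ‖ q₀ ‖ seed₁ ‖ u₁ ‖ q₁` and take the child `b`. -/
def child {n : ℕ} (w : Bits (2 * (n + 2))) (b : Bool) : NodeVal n where
  seed := fun j => w ⟨(if b then n + 2 else 0) + j, by have := j.isLt; split <;> omega⟩
  u := w ⟨(if b then n + 2 else 0) + n, by split <;> omega⟩
  q := w ⟨(if b then n + 2 else 0) + (n + 1), by split <;> omega⟩

/-- Correct the child `b` with control bits `u, q` of the parent and its two correction words. -/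
def applyCW {n : ℕ} (u q : Bool) (w₀ w₁ : CorrWord n) (b : Bool) (v : NodeVal n) : NodeVal n where
  seed := fun j => xor (v.seed j) (xor (u && w₀.1 j) (q && w₁.1 j))
  u := xor v.u (xor (u && w₀.2.1 b) (q && w₁.2.1 b))
  q := xor v.q (xor (u && w₀.2.2 b) (q && w₁.2.2 b))

/-- One server's values in layer `i + 1` from its values in layer `i`. -/
def nextLayer {n N i : ℕ} (G : Bits n → Bits (2 * (n + 2))) (f : Bits i → Bool → Fin N)
    (cw : Fin N → CorrWord n) (V : Bits i → NodeVal n) : Bits (i + 1) → NodeVal n :=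
  fun y =>
    let x : Bits i := Fin.init y
    let b : Bool := y (Fin.last i)
    applyCW (V x).u (V x).q (cw (f x false)) (cw (f x true)) b (child (G (V x).seed) b)

/-- The public part of the keys for the inner layers: correction words, and the bit `g` telling
which of its two correction words the root uses. -/
abbrev Pub (n : ℕ) (P : Params) : Type := (Fin P.d → Fin (3 * P.k) → CorrWord n) × Bool

/-- The public correction words of the last layer. -/
abbrev Final (P : Params) : Type := Fin (3 * P.k) → Fin P.B → P.𝔾

/-- The root at server `b`. -/
def rootVal {n : ℕ} (b : Bool) (seed : Bits n) (g : Bool) : NodeVal n := ⟨seed, b && !g, b && g⟩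

/-- Server `b` expands its key down to layer `i`. -/
def layer {n : ℕ} {P : Params} (G : Bits n → Bits (2 * (n + 2))) (f : HashFam P) (b : Bool)
    (seed : Bits n) (pub : Pub n P) : (i : ℕ) → i ≤ P.d → Bits i → NodeVal n
  | 0, _ => fun _ => rootVal b seed pub.2
  | i + 1, h => nextLayer G (f ⟨i, by omega⟩) (pub.1 ⟨i, h⟩)
      (layer G f b seed pub i (Nat.le_of_succ_le h))

/-- `Eval`: the output share of server `b` at position `j` of block `x`, where the last layer uses
the generator `E`. -/
def evalShare {n : ℕ} {P : Params} (G : Bits n → Bits (2 * (n + 2)))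
    (E : Bits n → Fin P.B → P.𝔾) (f : HashFam P) (b : Bool) (seed : Bits n) (pub : Pub n P)
    (fw : Final P) (x : Bits P.d) (j : Fin P.B) : P.𝔾 :=
  let v := layer G f b seed pub P.d le_rfl x
  let y := E v.seed j + (if v.u then fw (f (Fin.last P.d) x false) j else 0)
    + (if v.q then fw (f (Fin.last P.d) x true) j else 0)
  if b then -y else y

/-- `x` is the length-`i` prefix of some element of `A`. -/
def OnPath {d : ℕ} (A : Set (Bits d)) (i : ℕ) (hi : i ≤ d) (x : Bits i) : Prop :=
  ∃ a ∈ A, (fun j => a (Fin.castLE hi j)) = x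

/-- The assignment `g` of one of their two slots to the active nodes of layer `i` has no
collisions. -/
def ValidAssign {P : Params} (f : HashFam P) (A : Set (Bits P.d)) (i : Fin (P.d + 1))
    (g : Bits (i : ℕ) → Bool) : Prop :=
  Set.InjOn (fun x => f i x (g x)) {x | OnPath A i (Nat.lt_succ_iff.mp i.isLt) x}

/-- Cuckoo hashing succeeds in all layers. -/
def CuckooOK {P : Params} (f : HashFam P) (A : Set (Bits P.d)) : Prop :=
  ∀ i, ∃ g, ValidAssign f A i g

open Classical in
/-- The assignment used by the client in layer `i`. -/
noncomputable def assign {P : Params} (f : HashFam P) (A : Set (Bits P.d)) (i : Fin (P.d + 1)) :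
    Bits (i : ℕ) → Bool :=
  if h : ∃ g, ValidAssign f A i g then h.choose else fun _ => false

open Classical in
/-- The active leaves: those of the input, or the single leaf `α 0` if cuckoo hashing fails. -/
noncomputable def Input.active {P : Params} (inp : Input P) (f : HashFam P) : Set (Bits P.d) :=
  if CuckooOK f (Set.range inp.α) then Set.range inp.α else {inp.α ⟨0, P.k_pos⟩}

open Classical in
/-- The function that is shared: the input, or the zero function if cuckoo hashing fails. -/
noncomputable def Input.shared {P : Params} (inp : Input P) (f : HashFam P) :
    Bits P.d → Fin P.B → P.𝔾 :=
  if CuckooOK f (Set.range inp.α) then inp.fn else fun _ _ => 0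

open Classical in
/-- `GenNext`: the correction words applied to the nodes of layer `i < d`, given the values `S`, `T`
of the two servers in that layer; `rnd` supplies the random values. -/
noncomputable def genCW {n : ℕ} {P : Params} (G : Bits n → Bits (2 * (n + 2))) (f : HashFam P)
    (A : Set (Bits P.d)) (i : ℕ) (hi : i < P.d) (S T : Bits i → NodeVal n)
    (rnd : Fin (3 * P.k) → CorrWord n) : Fin (3 * P.k) → CorrWord n :=
  let i₀ : Fin (P.d + 1) := ⟨i, by omega⟩
  let i₁ : Fin (P.d + 1) := ⟨i + 1, by omega⟩
  fun m =>
    if h : ∃ x : Bits i, OnPath A i hi.le x ∧ f i₀ x (assign f A i₀ x) = m then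
      let x : Bits i := h.choose
      let s' := child (G (S x).seed)
      let t' := child (G (T x).seed)
      let y : Bool → Bits (i + 1) := fun b => Fin.snoc (α := fun _ => Bool) x b
      let on : Bool → Bool := fun b => decide (OnPath A (i + 1) hi (y b))
      let g : Bool → Bool := fun b => assign f A i₁ (y b)
      (if on false && on true then (rnd m).1
        else if on false then fun j => xor ((s' true).seed j) ((t' true).seed j)
        else fun j => xor ((s' false).seed j) ((t' false).seed j),
       fun b => xor (xor (s' b).u (t' b).u) (on b && !(g b)),
       fun b => xor (xor (s' b).q (t' b).q) (on b && g b))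
    else rnd m

/-- The coins of `Gen`: two root seeds and the random values for correction words. -/
abbrev BaseCoins (n : ℕ) (P : Params) : Type :=
  Bits n × Bits n × (Fin P.d → Fin (3 * P.k) → CorrWord n) × Final P

instance (n : ℕ) (P : Params) : Fintype (BaseCoins n P) := inferInstanceAs (Fintype (_ × _))

/-- The values of both servers in layer `i`, as computed in `Gen`. -/
noncomputable def genLayers {n : ℕ} {P : Params} (G : Bits n → Bits (2 * (n + 2)))
    (f : HashFam P) (A : Set (Bits P.d)) (co : BaseCoins n P) :
    (i : ℕ) → i ≤ P.d → (Bits i → NodeVal n) × (Bits i → NodeVal n)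
  | 0, _ =>
      let g := assign f A 0 Fin.elim0
      (fun _ => rootVal false co.1 g, fun _ => rootVal true co.2.1 g)
  | i + 1, h =>
      let V := genLayers G f A co i (Nat.le_of_succ_le h)
      let cw := genCW G f A i h V.1 V.2 (co.2.2.1 ⟨i, h⟩)
      (nextLayer G (f ⟨i, by omega⟩) cw V.1, nextLayer G (f ⟨i, by omega⟩) cw V.2)

/-- The public part of the keys for the inner layers. -/
noncomputable def genPub {n : ℕ} {P : Params} (G : Bits n → Bits (2 * (n + 2)))
    (f : HashFam P) (A : Set (Bits P.d)) (co : BaseCoins n P) : Pub n P :=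
  (fun i =>
    let V := genLayers G f A co i i.isLt.le
    genCW G f A i i.isLt V.1 V.2 (co.2.2.1 i),
   assign f A 0 Fin.elim0)

open Classical in
/-- The correction words of the last layer, for the generator `E` and the shared function `F`. -/
noncomputable def genFinal {n : ℕ} {P : Params} (G : Bits n → Bits (2 * (n + 2)))
    (E : Bits n → Fin P.B → P.𝔾) (f : HashFam P) (A : Set (Bits P.d))
    (F : Bits P.d → Fin P.B → P.𝔾) (co : BaseCoins n P) : Final P :=
  let V := genLayers G f A co P.d le_rfl
  let g := assign f A (Fin.last P.d)
  fun m =>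
    if h : ∃ x : Bits P.d, x ∈ A ∧ f (Fin.last P.d) x (g x) = m then
      let x : Bits P.d := h.choose
      let sgn : Bool := if g x then (V.2 x).q else (V.2 x).u
      fun j =>
        let γ := F x j - E (V.1 x).seed j + E (V.2 x).seed j
        if sgn then -γ else γ
    else co.2.2.2 m

/-! ### Augmented protocols

First the client sends the DPF keys without the last correction words, together with an extra
message to each server. Then the servers reveal a random string `h`. Then the client sends the last
correction words, computed for the generator `E h`, and another extra message to each server.
Finally the servers sample a joint random string `ρ`, exchange messages and decide.
Correction words are public: they are broadcast to both servers. -/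

/-- Bit lengths: the client's coins for the proof, `h`, `ρ`, the extra messages of the client to each
server, the number of message exchanges between the servers and the length of their messages. -/
structure Lens : Type where
  coin : ℕ
  chal : ℕ
  rho : ℕ
  ext1 : ℕ
  ext2 : ℕ
  rounds : ℕ
  msg : ℕ

/-- Input bits of the client's proof circuits: its coins, `h` (if known), the block positions
`α`, and the values of both servers at these leaves. -/
inductive ClientIx (n : ℕ) (P : Params) (coinLen chalLen : ℕ) : Type
  | coin (j : Fin coinLen)
  | chal (j : Fin chalLen)
  | path (l : Fin P.k) (j : Fin P.d)
  | leafSeed (b : Bool) (l : Fin P.k) (j : Fin n)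
  | leafU (b : Bool) (l : Fin P.k)
  | leafQ (b : Bool) (l : Fin P.k)

/-- The bits of a server's view: public hash functions, its key, the extra messages of the client,
`h`, `ρ`, and the messages received from the other server. -/
inductive ViewIx (n : ℕ) (P : Params) (L : Lens) : Type
  | hash (i : Fin (P.d + 1)) (x : Bits (i : ℕ)) (b : Bool) (t : Fin (Nat.clog 2 (3 * P.k)))
  | seed (j : Fin n)
  | seedCorr (i : Fin P.d) (m : Fin (3 * P.k)) (j : Fin n)
  | bitCorrU (i : Fin P.d) (m : Fin (3 * P.k)) (b : Bool)
  | bitCorrQ (i : Fin P.d) (m : Fin (3 * P.k)) (b : Bool)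
  | rootBit
  | ext1 (j : Fin L.ext1)
  | chal (j : Fin L.chal)
  | final (m : Fin (3 * P.k)) (j : Fin P.B) (t : Fin P.bitLen)
  | ext2 (j : Fin L.ext2)
  | rho (j : Fin L.rho)
  | recv (r : Fin L.rounds) (j : Fin L.msg)

/-- An augmentation of the scheme, at security parameter `n`. -/
structure Augmentation (n : ℕ) (P : Params) : Type where
  L : Lens
  /-- the generator used in the last layer, given `h` -/
  E : Bits L.chal → Bits n → Fin P.B → P.𝔾
  /-- the cost of evaluating `E h` on top of the cost of evaluating `G'` -/
  overhead : ℕ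
  /-- the extra messages of the client to the two servers in its first turn -/
  client1 : Circuit (ClientIx n P L.coin 0) (Bool × Fin L.ext1)
  /-- the extra messages of the client to the two servers in its second turn -/
  client2 : Circuit (ClientIx n P L.coin L.chal) (Bool × Fin L.ext2)
  /-- the message of server `b` to the other server in exchange `r` -/
  msg : Bool → Fin L.rounds → Circuit (ViewIx n P L) (Fin L.msg)
  /-- the decision of server `b` -/
  accept : Bool → Circuit (ViewIx n P L) Unit

/-- Everything that an honest or malicious client sends: seeds and extra messages are private to
server `b`, the rest is public. -/
structure Msgs (n : ℕ) (P : Params) (L : Lens) : Type where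
  seed : Bool → Bits n
  pub : Pub n P
  ext1 : Bool → Bits L.ext1
  final : Final P
  ext2 : Bool → Bits L.ext2

section Run

variable {n : ℕ} {P : Params}

/-- The view of server `b` when it has received the messages `recv` from the other server. -/
def view {L : Lens} (f : HashFam P) (M : Msgs n P L) (h : Bits L.chal) (ρ : Bits L.rho) (b : Bool)
    (recv : Fin L.rounds → Bits L.msg) : ViewIx n P L → Bool
  | .hash i x c t => (f i x c : ℕ).testBit t
  | .seed j => M.seed b j
  | .seedCorr i m j => (M.pub.1 i m).1 j
  | .bitCorrU i m c => (M.pub.1 i m).2.1 c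
  | .bitCorrQ i m c => (M.pub.1 i m).2.2 c
  | .rootBit => M.pub.2
  | .ext1 j => M.ext1 b j
  | .chal j => h j
  | .final m j t => P.enc (M.final m j) t
  | .ext2 j => M.ext2 b j
  | .rho j => ρ j
  | .recv r j => recv r j

/-- The messages sent by the servers in the first `τ` exchanges (later ones are blank). -/
def transcript (A : Augmentation n P) (f : HashFam P) (M : Msgs n P A.L) (h : Bits A.L.chal)
    (ρ : Bits A.L.rho) : ℕ → Bool → Fin A.L.rounds → Bits A.L.msg
  | 0 => fun _ _ _ => false
  | τ + 1 => fun b r =>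
      if (r : ℕ) = τ then (A.msg b r).eval (view f M h ρ b (transcript A f M h ρ τ (!b)))
      else transcript A f M h ρ τ b r

/-- The view of server `b` at the end of the protocol. -/
def finalView (A : Augmentation n P) (f : HashFam P) (M : Msgs n P A.L) (h : Bits A.L.chal)
    (ρ : Bits A.L.rho) (b : Bool) : ViewIx n P A.L → Bool :=
  view f M h ρ b (transcript A f M h ρ A.L.rounds (!b))

/-- Both servers accept. -/
def Accepts (A : Augmentation n P) (f : HashFam P) (M : Msgs n P A.L) (h : Bits A.L.chal)
    (ρ : Bits A.L.rho) : Prop :=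
  ∀ b, (A.accept b).eval (finalView A f M h ρ b) () = true

/-- The function reconstructed from the output shares of the two servers. -/
def output (G : Bits n → Bits (2 * (n + 2))) (A : Augmentation n P) (f : HashFam P)
    (M : Msgs n P A.L) (h : Bits A.L.chal) : Bits P.d → Fin P.B → P.𝔾 :=
  fun x j => evalShare G (A.E h) f false (M.seed false) M.pub M.final x j
    + evalShare G (A.E h) f true (M.seed true) M.pub M.final x j

open Classical in
/-- The input of the client's proof circuits in an honest run (leaves that are not active, which
occur only if cuckoo hashing fails, are blank). -/
noncomputable def clientIn (G : Bits n → Bits (2 * (n + 2))) (f : HashFam P) (inp : Input P)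
    (co : BaseCoins n P) {coinLen chalLen : ℕ} (e : Bits coinLen) (h : Bits chalLen) :
    ClientIx n P coinLen chalLen → Bool :=
  let V := genLayers G f (inp.active f) co P.d le_rfl
  let leaf : Bool → Fin P.k → NodeVal n := fun b l =>
    if inp.α l ∈ inp.active f then (if b then V.2 else V.1) (inp.α l)
    else ⟨fun _ => false, false, false⟩
  fun
  | .coin j => e j
  | .chal j => h j
  | .path l j => inp.α l j
  | .leafSeed b l j => (leaf b l).seed j
  | .leafU b l => (leaf b l).u
  | .leafQ b l => (leaf b l).q

/-- The messages of the honest client: the keys of the scheme with generators `G` and `E h`, and the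
extra messages. -/
noncomputable def honest (G : Bits n → Bits (2 * (n + 2))) (A : Augmentation n P) (f : HashFam P)
    (inp : Input P) (co : BaseCoins n P) (e : Bits A.L.coin) (h : Bits A.L.chal) :
    Msgs n P A.L where
  seed b := if b then co.2.1 else co.1
  pub := genPub G f (inp.active f) co
  ext1 b j := A.client1.eval (clientIn G f inp co e Fin.elim0) (b, j)
  final := genFinal G (A.E h) f (inp.active f) (inp.shared f) co
  ext2 b j := A.client2.eval (clientIn G f inp co e h) (b, j)

end Run

/-- All the randomness of an honest run: hash functions, the coins of the client for the keys and for
the proof, `h` and `ρ`. -/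
abbrev RunCoins {n : ℕ} {P : Params} (A : Augmentation n P) : Type :=
  HashFam P × BaseCoins n P × Bits A.L.coin × Bits A.L.chal × Bits A.L.rho

/-! ### Properties of augmented protocols -/

section Properties

variable {n : ℕ} {P : Params}

/-- Honest clients are always accepted. -/
def Complete (G : Bits n → Bits (2 * (n + 2))) (A : Augmentation n P) : Prop :=
  ∀ (inp : Input P) (ω : RunCoins A),
    Accepts A ω.1 (honest G A ω.1 inp ω.2.1 ω.2.2.1 ω.2.2.2.1) ω.2.2.2.1 ω.2.2.2.2

/-- The output shares of an honest run sum up to the client's function, except with probability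
`γ`. -/
def Correct (G : Bits n → Bits (2 * (n + 2))) (A : Augmentation n P) (γ : ℝ) : Prop :=
  ∀ inp : Input P, 1 - γ ≤ prob (fun ω : RunCoins A =>
    output G A ω.1 (honest G A ω.1 inp ω.2.1 ω.2.2.1 ω.2.2.2.1) ω.2.2.2.1 = inp.fn)

/-- Soundness error `ε` against (unbounded) malicious clients, for all hash functions. The
client commits to its first messages, sees `h`, and answers; `ρ` is sampled afterwards. The
probability that the servers accept although the shared function is not `k`-block-sparse is at most
`ε`. -/
def Sound (G : Bits n → Bits (2 * (n + 2))) (A : Augmentation n P) (ε : ℝ) : Prop :=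
  ∀ (f : HashFam P) (seed : Bool → Bits n) (pub : Pub n P) (ext1 : Bool → Bits A.L.ext1)
    (final : Bits A.L.chal → Final P) (ext2 : Bits A.L.chal → Bool → Bits A.L.ext2),
    prob (fun ω : Bits A.L.chal × Bits A.L.rho =>
      Accepts A f ⟨seed, pub, ext1, final ω.1, ext2 ω.1⟩ ω.1 ω.2 ∧
        ¬ IsBlockSparse P (output G A f ⟨seed, pub, ext1, final ω.1, ext2 ω.1⟩ ω.1)) ≤ ε

/-- `A.overhead` bounds the additional cost of the generators `E h`: each circuit for `G'` yields a
circuit for `(h, s) ↦ E h s` with at most that many more gates. -/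
def OverheadBound (G' : Bits n → Fin P.B → P.𝔾) (A : Augmentation n P) : Prop :=
  ∀ C' : Circuit (Fin n) (Fin P.B × Fin P.bitLen), (∀ s, C'.eval s = P.encBlock (G' s)) →
    ∃ C : Circuit (Fin A.L.chal ⊕ Fin n) (Fin P.B × Fin P.bitLen),
      C.size ≤ C'.size + A.overhead ∧ ∀ h s, C.eval (Sum.elim h s) = P.encBlock (A.E h s)

/-- Bits communicated on top of the DPF keys: the extra messages to two servers, `h` (to the client
and the other server), `ρ`, and the messages between the servers. -/
def extraComm (A : Augmentation n P) : ℕ :=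
  2 * A.L.ext1 + 2 * A.L.ext2 + 2 * A.L.chal + A.L.rho + 2 * (A.L.rounds * A.L.msg)

/-- Work of the client on top of the DPF key generation, which evaluates the generator of the last
layer at most `2k` times. -/
def extraClientWork (A : Augmentation n P) : ℕ :=
  A.client1.size + A.client2.size + 2 * P.k * A.overhead

/-- Work of server `b` on top of the DPF evaluation, which evaluates the generator of the last layer
`2 ^ d` times. -/
def extraServerWork (A : Augmentation n P) (b : Bool) : ℕ :=
  (∑ r, (A.msg b r).size) + (A.accept b).size + 2 ^ P.d * A.overhead

end Properties

/-! ### Zero knowledge -/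

/-- Input bits of a simulator: public hash functions, uniform bits, uniform group elements. -/
inductive SimIx (P : Params) (coinLen : ℕ) : Type
  | hash (i : Fin (P.d + 1)) (x : Bits (i : ℕ)) (b : Bool) (t : Fin (Nat.clog 2 (3 * P.k)))
  | coin (j : Fin coinLen)
  | grp (m : Fin (3 * P.k)) (j : Fin P.B) (t : Fin P.bitLen)

abbrev SimCoins (P : Params) (coinLen : ℕ) : Type := HashFam P × Bits coinLen × Final P

def simIn {P : Params} {coinLen : ℕ} (ω : SimCoins P coinLen) : SimIx P coinLen → Bool
  | .hash i x c t => (ω.1 i x c : ℕ).testBit t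
  | .coin j => ω.2.1 j
  | .grp m j t => P.enc (ω.2.2 m j) t

/-- Zero knowledge: for each server there is a polynomial-size simulator, which does not know the
client's function, whose output is indistinguishable from the complete view of that server in an
honest run, for all inputs of the client. -/
def ZeroKnowledge (G : ∀ n, Bits n → Bits (2 * (n + 2))) (P : ℕ → Params)
    (A : ∀ n, Augmentation n (P n)) : Prop :=
  ∀ b : Bool, ∃ (len : ℕ → ℕ) (Sim : ∀ n, Circuit (SimIx (P n) (len n)) (ViewIx n (P n) (A n).L)),
    PolyBounded len ∧ PolyBounded (fun n => (Sim n).size) ∧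
    ∀ inp : ∀ n, Input (P n),
      CompIndist (fun n => ViewIx n (P n) (A n).L) (fun n => RunCoins (A n))
        (fun n => SimCoins (P n) (len n))
        (fun n ω => finalView (A n) ω.1
          (honest (G n) (A n) ω.1 (inp n) ω.2.1 ω.2.2.1 ω.2.2.2.1) ω.2.2.2.1 ω.2.2.2.2 b)
        (fun n ω => (Sim n).eval (simIn ω))

end VDPF

open VDPF

/-! The sparsity proof concerns the tree only, not the contents of the blocks. Let Δ(x) be the sum
of the two servers' values at the leaf x (seed and control bits), coded in the field with 2^(n+d+4)
elements. Where Δ(x) = 0 both servers hold the same leaf, so their output shares cancel whatever the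
leaf generator and the last correction words are. Hence it suffices to certify that Δ has at most k
non-zero entries. The generator can stay `G'` with overhead zero, and h serves only as the
challenge.

Sparsity is tested by the identity Σ_x Δ(x)/(h − p(x)) = Σ_l δ_l/(h − q_l) at the random point h,
where p(x) codes the position x. The client shares the q_l and δ_l before h is known, and the
quotients y_l afterwards; each server computes its part of the left side alone. The k equations
y_l(h − q_l) = δ_l and the equation for Σ y_l are combined with random coefficients ρ, and the
products of shared values are computed with masks dealt by the client. A false inner product of the
masks only adds a constant chosen before ρ. Clearing denominators gives a polynomial of degree at
most 2^d + k, fixed before h (`exists_locator_polynomial`). If it is zero, each leaf with Δ(x) ≠ 0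
lies at some q_l; otherwise h is rarely a root. This is `sound_augmentation`, with error 2^(-n).
Challenges are never block positions, so no division by zero spoils completeness.

Honest outputs are right unless cuckoo hashing fails. By Hall's theorem a failure yields a set of
keys confined to one slot too few, each slot being hit twice; counting these obstructions gives
O(1/k) per layer (`exists_cuckoo_bound`).

For zero knowledge, the proof messages seen by one server are a bijective image of the client's
proof coins, hence uniform (`proofMsgs_injective`), and the other server's check value equals its
own. The keys are treated by a hybrid over the layers (`abs_prob_run_sub_le`): the other server's
seeds are expanded into pseudorandom children, and once these are uniform they act as one-time pads
for the correction words, while the seeds of the next layer are again uniform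
(`swapLayer_injective`).

Costs are bounded in a calculus of sets of Boolean functions (`Derives`, `Cost`), which is
translated to and from circuits by `Cost.circuit` and `Cost.exists_circuit`. -/

namespace VDPF

/-! ### Gate counts of families of Boolean functions -/

section Cost

variable {Ω : Type}

/-- `Derives S s U`: starting from the functions in `S` and the constant `false`, a sequence of at
most `s` NAND operations yields the functions in `U`. -/
inductive Derives (S : Set (Ω → Bool)) : ℕ → Set (Ω → Bool) → Prop
  | base : Derives S 0 (insert (fun _ => false) S)
  | nand {s : ℕ} {U : Set (Ω → Bool)} {φ ψ : Ω → Bool} (h : Derives S s U) (hφ : φ ∈ U)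
      (hψ : ψ ∈ U) : Derives S (s + 1) (insert (fun ω => !(φ ω && ψ ω)) U)
  | pad {s : ℕ} {U : Set (Ω → Bool)} (h : Derives S s U) : Derives S (s + 1) U

/-- All functions in `T` can be computed from those in `S` with `s` NAND gates altogether. -/
def Cost (S T : Set (Ω → Bool)) (s : ℕ) : Prop := ∃ U, Derives S s U ∧ T ⊆ U

theorem Derives.subset {S U : Set (Ω → Bool)} {s : ℕ} (h : Derives S s U) : S ⊆ U := by
  induction h with
  | base => exact Set.subset_insert _ _
  | nand _ _ _ ih => exact ih.trans (Set.subset_insert _ _)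
  | pad _ ih => exact ih

theorem Derives.false_mem {S U : Set (Ω → Bool)} {s : ℕ} (h : Derives S s U) :
    (fun _ => false) ∈ U := by
  induction h with
  | base => exact Set.mem_insert _ _
  | nand _ _ _ ih => exact Set.mem_insert_of_mem _ ih
  | pad _ ih => exact ih

theorem Derives.le {S U : Set (Ω → Bool)} {s t : ℕ} (h : Derives S s U) (hst : s ≤ t) :
    Derives S t U := by
  induction hst with
  | refl => exact h
  | step _ ih => exact ih.pad

theorem Derives.trans {S T U V : Set (Ω → Bool)} {s t : ℕ} (h : Derives S s U)
    (h' : Derives T t V) (hT : T ⊆ U) : ∃ W, Derives S (s + t) W ∧ V ⊆ W ∧ U ⊆ W := by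
  induction h' with
  | base => exact ⟨U, h, Set.insert_subset h.false_mem hT, le_rfl⟩
  | nand _ hφ hψ ih =>
    obtain ⟨W, hW, hV, hU⟩ := ih
    exact ⟨_, hW.nand (hV hφ) (hV hψ), Set.insert_subset_insert hV,
      hU.trans (Set.subset_insert _ _)⟩
  | pad _ ih =>
    obtain ⟨W, hW, hV, hU⟩ := ih
    exact ⟨W, hW.pad, hV, hU⟩

variable {S S' T T' U : Set (Ω → Bool)} {s t : ℕ}

theorem Cost.mono (h : Cost S T s) (hS : S ⊆ S') (hT : T' ⊆ T) (hs : s ≤ t) : Cost S' T' t := by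
  obtain ⟨U, hU, hTU⟩ := h
  -- A derivation is tied to its start set, so it is replayed on top of the trivial one from `S'`.
  obtain ⟨W, hW, hUW, -⟩ := (Derives.base (S := S')).trans hU (hS.trans (Set.subset_insert _ _))
  exact ⟨W, hW.le (by omega), hT.trans (hTU.trans hUW)⟩

theorem Cost.le (h : Cost S T s) (hs : s ≤ t) : Cost S T t := h.mono le_rfl le_rfl hs

theorem Cost.of_subset (h : T ⊆ S) : Cost S T s :=
  ⟨_, Derives.base.le (Nat.zero_le _), h.trans (Set.subset_insert _ _)⟩

theorem Cost.of_mem {φ : Ω → Bool} (h : φ ∈ S) : Cost S {φ} s :=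
  .of_subset (Set.singleton_subset_iff.mpr h)

/-- Sequential composition; the inputs stay available. -/
theorem Cost.trans (h : Cost S T s) (h' : Cost (S ∪ T) U t) : Cost S (T ∪ U) (s + t) := by
  obtain ⟨V, hV, hTV⟩ := h
  obtain ⟨W, hW, hUW⟩ := h'
  obtain ⟨X, hX, hWX, hVX⟩ := hV.trans hW (Set.union_subset hV.subset hTV)
  exact ⟨X, hX, Set.union_subset (hTV.trans hVX) (hUW.trans hWX)⟩

theorem Cost.then (h : Cost S T s) (h' : Cost (S ∪ T) U t) : Cost S U (s + t) :=
  (h.trans h').mono le_rfl Set.subset_union_right le_rfl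

theorem Cost.union (h : Cost S T s) (h' : Cost S U t) : Cost S (T ∪ U) (s + t) :=
  h.trans (h'.mono Set.subset_union_left le_rfl le_rfl)

theorem Cost.const_false : Cost S {fun _ => false} s :=
  ⟨_, Derives.base.le (Nat.zero_le _), by simp⟩

theorem Cost.nand {φ ψ : Ω → Bool} (h : Cost S {φ} s) (h' : Cost S {ψ} t) :
    Cost S {fun ω => !(φ ω && ψ ω)} (s + t + 1) := by
  obtain ⟨V, hV, hT⟩ := h.union h'
  exact ⟨_, hV.nand (φ := φ) (ψ := ψ) (hT (by simp)) (hT (by simp)), by simp⟩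

theorem Cost.not {φ : Ω → Bool} (h : Cost S {φ} s) : Cost S {fun ω => !φ ω} (s + 1) := by
  have h2 : Cost (S ∪ {φ}) {fun ω => !(φ ω && φ ω)} 1 :=
    Cost.nand (s := 0) (t := 0) (.of_mem (by simp)) (.of_mem (by simp))
  simpa using h.then h2

theorem Cost.const (b : Bool) : Cost S {fun _ => b} 1 := by
  cases b
  · exact .const_false
  · exact (Cost.const_false (S := S) (s := 0)).not

theorem Cost.and {φ ψ : Ω → Bool} (h : Cost S {φ} s) (h' : Cost S {ψ} t) :
    Cost S {fun ω => φ ω && ψ ω} (s + t + 2) := by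
  simpa using (h.nand h').not

theorem Cost.or {φ ψ : Ω → Bool} (h : Cost S {φ} s) (h' : Cost S {ψ} t) :
    Cost S {fun ω => φ ω || ψ ω} (s + t + 3) := by
  have := h.not.nand h'.not
  simp only [Bool.not_and, Bool.not_not] at this
  exact this.le (by omega)

/-- Exclusive or is (φ ∨ ψ) ∧ ¬(φ ∧ ψ), which reads each argument twice. Both arguments are
therefore derived once and then used as free members of the start set. -/
theorem Cost.xor {φ ψ : Ω → Bool} (h : Cost S {φ} s) (h' : Cost S {ψ} t) :
    Cost S {fun ω => Bool.xor (φ ω) (ψ ω)} (s + t + 8) := by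
  have key : Cost (S ∪ ({φ} ∪ {ψ})) {fun ω => Bool.xor (φ ω) (ψ ω)} 8 := by
    have hφ : Cost (S ∪ ({φ} ∪ {ψ})) {φ} 0 := .of_mem (by simp)
    have hψ : Cost (S ∪ ({φ} ∪ {ψ})) {ψ} 0 := .of_mem (by simp)
    have := ((hφ.or hψ).and (hφ.nand hψ))
    refine (this.le (by norm_num)).mono le_rfl ?_ le_rfl
    simp only [Set.singleton_subset_iff, Set.mem_singleton_iff]
    funext ω
    cases φ ω <;> cases ψ ω <;> rfl
  exact (h.union h').then key

theorem Cost.biUnion {I : Type} (A : Finset I) {T : I → Set (Ω → Bool)} {s : I → ℕ}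
    (h : ∀ i ∈ A, Cost S (T i) (s i)) : Cost S (⋃ i ∈ A, T i) (∑ i ∈ A, s i) := by
  classical
  induction A using Finset.induction_on with
  | empty => exact .of_subset (by simp)
  | insert a A ha ih =>
    rw [Finset.sum_insert ha, Finset.set_biUnion_insert]
    exact (h a (by simp)).union (ih fun i hi => h i (by simp [hi]))

theorem Cost.iUnion {I : Type} [Fintype I] {T : I → Set (Ω → Bool)}
    (h : ∀ i, Cost S (T i) s) : Cost S (⋃ i, T i) (Fintype.card I * s) := by
  have := Cost.biUnion Finset.univ (T := T) (s := fun _ => s) fun i _ => h i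
  simpa using this

/-- The coordinates of a function with values in bit strings. -/
def fam {κ : Type} (X : Ω → κ → Bool) : Set (Ω → Bool) := Set.range fun k ω => X ω k

theorem mem_fam {κ : Type} (X : Ω → κ → Bool) (k : κ) : (fun ω => X ω k) ∈ fam X := ⟨k, rfl⟩

theorem Cost.pi {κ : Type} [Fintype κ] {X : Ω → κ → Bool}
    (h : ∀ k, Cost S {fun ω => X ω k} s) : Cost S (fam X) (Fintype.card κ * s) := by
  refine (Cost.iUnion h).mono le_rfl ?_ le_rfl
  rintro _ ⟨k, rfl⟩
  exact Set.mem_iUnion.mpr ⟨k, rfl⟩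

/-- Iteration of a computation step. -/
theorem Cost.iterate {T : ℕ → Set (Ω → Bool)} {s₀ : ℕ} {s : ℕ} (h0 : Cost S (T 0) s₀) (N : ℕ)
    (h : ∀ i < N, Cost (S ∪ T i) (T (i + 1)) s) : Cost S (T N) (s₀ + N * s) := by
  induction N with
  | zero => simpa using h0
  | succ N ih =>
    exact ((ih fun i hi => h i (by omega)).then (h N (by omega))).le (by ring_nf; omega)

theorem Cost.all {I : Type} (A : Finset I) {φ : I → Ω → Bool}
    (h : ∀ i ∈ A, Cost S {φ i} s) :
    Cost S {fun ω => decide (∀ i ∈ A, φ i ω = true)} (A.card * (s + 2) + 1) := by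
  classical
  induction A using Finset.induction_on with
  | empty => simpa using Cost.const true
  | insert a A ha ih =>
    have := (h a (by simp)).and (ih fun i hi => h i (by simp [hi]))
    rw [Finset.card_insert_of_notMem ha]
    refine (this.le (by ring_nf; omega)).mono le_rfl ?_ le_rfl
    simp only [Set.singleton_subset_iff, Set.mem_singleton_iff]
    funext ω
    simp

theorem Cost.any {I : Type} (A : Finset I) {φ : I → Ω → Bool}
    (h : ∀ i ∈ A, Cost S {φ i} s) :
    Cost S {fun ω => decide (∃ i ∈ A, φ i ω = true)} (A.card * (s + 3)) := by
  classical
  induction A using Finset.induction_on with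
  | empty => simpa using Cost.const_false
  | insert a A ha ih =>
    have := (h a (by simp)).or (ih fun i hi => h i (by simp [hi]))
    rw [Finset.card_insert_of_notMem ha]
    refine (this.le (by ring_nf; omega)).mono le_rfl ?_ le_rfl
    simp only [Set.singleton_subset_iff, Set.mem_singleton_iff]
    funext ω
    simp

/-! ### Gate counts and circuits -/

theorem gateVals_append {ι ο : Type} (L : List (Wire ι × Wire ι)) (g : Wire ι × Wire ι)
    (o : ο → Wire ι) (x : ι → Bool) :
    (Circuit.mk (L ++ [g]) o).gateVals x = (Circuit.mk L o).gateVals x ++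
      [!(g.1.val x ((Circuit.mk L o).gateVals x) && g.2.val x ((Circuit.mk L o).gateVals x))] := by
  simp [Circuit.gateVals, List.foldl_append]

theorem length_gateVals {ι ο : Type} (L : List (Wire ι × Wire ι)) (o : ο → Wire ι) (x : ι → Bool) :
    ((Circuit.mk L o).gateVals x).length = L.length := by
  induction L using List.reverseRecOn with
  | nil => rfl
  | append_singleton L g ih => rw [gateVals_append]; simp [ih]

/-- A circuit can be evaluated on computed inputs. -/
theorem Cost.circuit {κ ο : Type} (C : Circuit κ ο) {X : Ω → κ → Bool} (h : Cost S (fam X) s) :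
    Cost S (fam fun ω => C.eval (X ω)) (s + C.size) := by
  obtain ⟨L, o⟩ := C
  -- All indices t are covered, also those past the end of the list: a wire to a missing gate reads
  -- `false`, which every derivation contains.
  suffices H : ∃ U, Derives (fam X) L.length U ∧
      ∀ t, (fun ω => ((Circuit.mk L o).gateVals (X ω)).getD t false) ∈ U by
    obtain ⟨U, hU, ht⟩ := H
    have h2 : Cost (S ∪ fam X) (fam fun ω => (Circuit.mk L o).eval (X ω)) L.length := by
      refine Cost.mono ⟨U, hU, ?_⟩ Set.subset_union_right le_rfl le_rfl
      rintro _ ⟨k, rfl⟩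
      cases hk : o k with
      | input i => simpa [Circuit.eval, Wire.val, hk] using hU.subset (mem_fam X i)
      | gate t => simpa [Circuit.eval, Wire.val, hk] using ht t
    exact h.then h2
  clear h
  induction L using List.reverseRecOn with
  | nil => exact ⟨_, .base, fun t => by simp [Circuit.gateVals]⟩
  | append_singleton L g ih =>
    obtain ⟨U, hU, ht⟩ := ih
    have hw : ∀ w : Wire κ, (fun ω => w.val (X ω) ((Circuit.mk L o).gateVals (X ω))) ∈ U := by
      rintro (i | t)
      · exact hU.subset (mem_fam X i)
      · exact ht t
    refine ⟨_, by rw [List.length_append]; exact hU.nand (hw g.1) (hw g.2), fun t => ?_⟩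
    simp only [gateVals_append]
    rcases lt_trichotomy t L.length with hlt | heq | hgt
    · refine Set.mem_insert_of_mem _ ?_
      convert ht t using 2 with ω
      rw [List.getD_append _ _ _ _ (by rw [length_gateVals]; exact hlt)]
    · refine Set.mem_insert_iff.mpr (Or.inl ?_)
      funext ω
      rw [List.getD_append_right _ _ _ _ (by rw [length_gateVals]; omega), length_gateVals]
      simp [heq]
    · refine Set.mem_insert_of_mem _ ?_
      convert hU.false_mem using 2 with ω
      rw [List.getD_eq_default _ _ (by simp [length_gateVals]; omega)]

theorem Derives.exists_circuit {ι : Type} {inp : Ω → ι → Bool} {s : ℕ} {U : Set (Ω → Bool)}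
    (h : Derives (fam inp) s U) : ∃ L : List (Wire ι × Wire ι), L.length ≤ s ∧
      ∀ φ ∈ U, φ = (fun _ => false) ∨ (∃ i, φ = fun ω => inp ω i) ∨
        ∃ t < L.length, φ = fun ω =>
          ((Circuit.mk L (fun u : Empty => u.elim)).gateVals (inp ω)).getD t false := by
  induction h with
  | base =>
    refine ⟨[], le_rfl, ?_⟩
    rintro φ (rfl | ⟨i, rfl⟩)
    · exact Or.inl rfl
    · exact Or.inr (Or.inl ⟨i, rfl⟩)
  | pad _ ih =>
    obtain ⟨L, hL, hU⟩ := ih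
    exact ⟨L, by omega, hU⟩
  | @nand s U φ ψ _ hφ hψ ih =>
    obtain ⟨L, hL, hU⟩ := ih
    have hw : ∀ χ ∈ U, ∃ w : Wire ι, ∀ ω,
        w.val (inp ω) ((Circuit.mk L (fun u : Empty => u.elim)).gateVals (inp ω)) = χ ω := by
      intro χ hχ
      rcases hU χ hχ with rfl | ⟨i, rfl⟩ | ⟨t, -, rfl⟩
      -- No gate with index `L.length` exists when this wire is read, so it carries `false`. This is
      -- why the constant `false` is free.
      · refine ⟨.gate L.length, fun ω => ?_⟩
        simp [Wire.val, length_gateVals]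
      · exact ⟨.input i, fun ω => rfl⟩
      · exact ⟨.gate t, fun ω => rfl⟩
    obtain ⟨w₁, h₁⟩ := hw φ hφ
    obtain ⟨w₂, h₂⟩ := hw ψ hψ
    refine ⟨L ++ [(w₁, w₂)], by simp; omega, ?_⟩
    rintro χ (rfl | hχ)
    · refine Or.inr (Or.inr ⟨L.length, by simp, ?_⟩)
      funext ω
      rw [gateVals_append, List.getD_append_right _ _ _ _ (by rw [length_gateVals]), length_gateVals]
      simp [h₁, h₂]
    · rcases hU χ hχ with rfl | ⟨i, rfl⟩ | ⟨t, ht, rfl⟩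
      · exact Or.inl rfl
      · exact Or.inr (Or.inl ⟨i, rfl⟩)
      · refine Or.inr (Or.inr ⟨t, by simp; omega, ?_⟩)
        funext ω
        rw [gateVals_append, List.getD_append _ _ _ _ (by rw [length_gateVals]; exact ht)]

/-- Functions with a small gate count are computed by a small circuit. -/
theorem Cost.exists_circuit {ι ο : Type} {inp : Ω → ι → Bool} {X : Ω → ο → Bool}
    (h : Cost (fam inp) (fam X) s) :
    ∃ C : Circuit ι ο, C.size ≤ s ∧ ∀ ω, C.eval (inp ω) = X ω := by
  obtain ⟨U, hU, hX⟩ := h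
  obtain ⟨L, hL, hw⟩ := hU.exists_circuit
  have : ∀ k : ο, ∃ w : Wire ι, ∀ ω,
      w.val (inp ω) ((Circuit.mk L (fun u : Empty => u.elim)).gateVals (inp ω)) = X ω k := by
    intro k
    rcases hw _ (hX (mem_fam X k)) with h | ⟨i, h⟩ | ⟨t, -, h⟩
    · refine ⟨.gate L.length, fun ω => ?_⟩
      rw [congrFun h ω]
      simp [Wire.val, length_gateVals]
    · exact ⟨.input i, fun ω => (congrFun h ω).symm⟩
    · exact ⟨.gate t, fun ω => (congrFun h ω).symm⟩
  choose o ho using this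
  exact ⟨⟨L, o⟩, hL, fun ω => funext fun k => ho k ω⟩

end Cost


/-! ### Binary fields, with elements coded by bit strings -/

section Field

/-- Bits as elements of the field with two elements. -/
def boolZ : Bool ≃ ZMod 2 := finTwoEquiv.symm

theorem boolZ_xor (a b : Bool) : boolZ (xor a b) = boolZ a + boolZ b := by
  revert a b; decide

variable (m : ℕ) [NeZero m]

/-- A basis of the field with `2 ^ m` elements. -/
noncomputable def fieldBasis : Module.Basis (Fin m) (ZMod 2) (GaloisField 2 m) :=
  Module.finBasisOfFinrankEq _ _ (GaloisField.finrank 2 (NeZero.ne m))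

/-- Bit strings of length `m` as elements of the field with `2 ^ m` elements. -/
noncomputable def ofBits : Bits m ≃ GaloisField 2 m :=
  (Equiv.piCongrRight fun _ => boolZ).trans (fieldBasis m).equivFun.symm.toEquiv

/-- The coordinates of a field element. -/
noncomputable def toBits : GaloisField 2 m → Bits m := (ofBits m).symm

variable {m}

@[simp] theorem ofBits_toBits (a : GaloisField 2 m) : ofBits m (toBits m a) = a :=
  (ofBits m).apply_symm_apply a

@[simp] theorem toBits_ofBits (v : Bits m) : toBits m (ofBits m v) = v :=
  (ofBits m).symm_apply_apply v

theorem ofBits_xor (v w : Bits m) :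
    ofBits m (fun j => xor (v j) (w j)) = ofBits m v + ofBits m w := by
  simp only [ofBits, Equiv.trans_apply, LinearEquiv.coe_toEquiv, ← map_add]
  congr 1
  funext j
  exact boolZ_xor _ _

theorem ofBits_false : ofBits m (fun _ => false) = 0 := by
  have := ofBits_xor (m := m) (fun _ => false) (fun _ => false)
  simpa using this

theorem toBits_zero : toBits m 0 = fun _ => false := by
  rw [← ofBits_false, toBits_ofBits]

theorem toBits_add (a b : GaloisField 2 m) :
    toBits m (a + b) = fun j => xor (toBits m a j) (toBits m b j) := by
  apply (ofBits m).injective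
  rw [ofBits_xor]; simp

/-- Each coordinate bit switches a fixed vector on or off. Additive maps and products become sums of
terms selected by single bits, on which the gate counts of field arithmetic rest. -/
theorem eq_sum_basis (a : GaloisField 2 m) :
    a = ∑ j, if toBits m a j then fieldBasis m j else 0 := by
  conv_lhs => rw [← ofBits_toBits a]
  simp only [ofBits, Equiv.trans_apply, LinearEquiv.coe_toEquiv, Module.Basis.equivFun_symm_apply]
  refine Finset.sum_congr rfl fun j _ => ?_
  have : (Equiv.piCongrRight fun _ : Fin m => boolZ) (toBits m a) j = boolZ (toBits m a j) := rfl
  rw [this]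
  cases toBits m a j
  · simp [show boolZ false = 0 from rfl]
  · simp [show boolZ true = 1 from rfl]

/-- Fermat's theorem in the multiplicative group; `2 ≤ m` makes the exponent positive, so that zero
is sent to zero. Inversion thus becomes a chain of multiplications. -/
theorem pow_inverse (hm : 2 ≤ m) (a : GaloisField 2 m) : a⁻¹ = a ^ (2 ^ m - 2) := by
  have : Fintype (GaloisField 2 m) := Fintype.ofFinite _
  have hc : Fintype.card (GaloisField 2 m) = 2 ^ m := by
    rw [Fintype.card_eq_nat_card, GaloisField.card 2 m (NeZero.ne m)]
  have h4 : 2 ^ 2 ≤ 2 ^ m := Nat.pow_le_pow_right (by norm_num) hm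
  rcases eq_or_ne a 0 with rfl | ha
  · rw [inv_zero, zero_pow (by omega)]
  · have := FiniteField.pow_card_sub_one_eq_one a ha
    rw [hc, show 2 ^ m - 1 = (2 ^ m - 2) + 1 by omega, pow_succ] at this
    exact inv_eq_of_mul_eq_one_left this

end Field

section FieldCost

variable {Ω : Type} {m : ℕ} [NeZero m] {S : Set (Ω → Bool)} {s t : ℕ}

/-- The coordinates of a function with values in a binary field. -/
noncomputable def famF (X : Ω → GaloisField 2 m) : Set (Ω → Bool) := fam fun ω => toBits m (X ω)

theorem Cost.mapBits {X Y : Ω → GaloisField 2 m} {r : ℕ} (hX : Cost S (famF X) s)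
    (hY : Cost S (famF Y) t) {Z : Ω → GaloisField 2 m}
    (h : ∀ j, Cost (S ∪ (famF X ∪ famF Y)) {fun ω => toBits m (Z ω) j} r) :
    Cost S (famF Z) (s + t + m * r) := by
  have := Cost.pi (X := fun ω => toBits m (Z ω)) h
  rw [Fintype.card_fin] at this
  exact (hX.union hY).then this

theorem Cost.add {X Y : Ω → GaloisField 2 m} (hX : Cost S (famF X) s) (hY : Cost S (famF Y) t) :
    Cost S (famF fun ω => X ω + Y ω) (s + t + m * 8) := by
  refine hX.mapBits hY fun j => ?_
  simp only [toBits_add]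
  have h1 : Cost (S ∪ (famF X ∪ famF Y)) {fun ω => toBits m (X ω) j} 0 :=
    .of_mem (Or.inr (Or.inl (mem_fam _ j)))
  have h2 : Cost (S ∪ (famF X ∪ famF Y)) {fun ω => toBits m (Y ω) j} 0 :=
    .of_mem (Or.inr (Or.inr (mem_fam _ j)))
  exact h1.xor h2

theorem Cost.constF (a : GaloisField 2 m) : Cost S (famF fun _ : Ω => a) m := by
  have := Cost.pi (X := fun _ : Ω => toBits m a) (S := S) (s := 1) fun j => .const _
  rw [Fintype.card_fin, mul_one] at this
  exact this

theorem Cost.ite {φ : Ω → Bool} {X : Ω → GaloisField 2 m} (hφ : Cost S {φ} s)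
    (hX : Cost S (famF X) t) :
    Cost S (famF fun ω => if φ ω then X ω else 0) (s + t + m * 2) := by
  have h : Cost (S ∪ ({φ} ∪ famF X)) (famF fun ω => if φ ω then X ω else 0) (m * 2) := by
    have := Cost.pi (S := S ∪ ({φ} ∪ famF X)) (s := 2)
      (X := fun ω => toBits m (if φ ω then X ω else 0)) fun j => by
        have h1 : Cost (S ∪ ({φ} ∪ famF X)) {φ} 0 := .of_mem (by simp)
        have h2 : Cost (S ∪ ({φ} ∪ famF X)) {fun ω => toBits m (X ω) j} 0 :=
          .of_mem (Or.inr (Or.inr (mem_fam _ j)))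
        refine (h1.and h2).mono le_rfl ?_ le_rfl
        simp only [Set.singleton_subset_iff, Set.mem_singleton_iff]
        funext ω
        cases φ ω <;> simp [toBits_zero]
    rw [Fintype.card_fin] at this
    exact this
  exact (hφ.union hX).then h

theorem Cost.sum {I : Type} (A : Finset I) {X : I → Ω → GaloisField 2 m}
    (h : ∀ i ∈ A, Cost S (famF (X i)) s) :
    Cost S (famF fun ω => ∑ i ∈ A, X i ω) (A.card * (s + m * 8)) := by
  classical
  induction A using Finset.induction_on with
  | empty =>
    refine Cost.mono (T := {fun _ => false}) Cost.const_false le_rfl ?_ le_rfl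
    rintro _ ⟨j, rfl⟩
    simp [toBits_zero]
  | insert a A ha ih =>
    have := (h a (by simp)).add (ih fun i hi => h i (by simp [hi]))
    simp only [Finset.sum_insert ha, Finset.card_insert_of_notMem ha]
    exact this.le (by ring_nf; omega)

/-- The images of the basis vectors are constants, and the input bits select which of them are
added. Each of the m terms takes m + 2m + 8m gates. -/
theorem Cost.linear (f : GaloisField 2 m →+ GaloisField 2 m) {X : Ω → GaloisField 2 m}
    (h : Cost S (famF X) s) : Cost S (famF fun ω => f (X ω)) (s + 11 * m ^ 2) := by
  have key : ∀ ω, f (X ω) = ∑ j, if toBits m (X ω) j then f (fieldBasis m j) else 0 := fun ω => by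
    conv_lhs => rw [eq_sum_basis (X ω), map_sum]
    refine Finset.sum_congr rfl fun j _ => ?_
    split <;> simp
  simp only [key]
  have := Cost.sum (S := S ∪ famF X) (s := 0 + m + m * 2) Finset.univ
    (X := fun j ω => if toBits m (X ω) j then f (fieldBasis m j) else 0)
    fun j _ => (Cost.of_mem (Or.inr (mem_fam _ j))).ite (Cost.constF (f (fieldBasis m j)))
  rw [Finset.card_univ, Fintype.card_fin] at this
  exact (h.then this).le (by ring_nf; omega)

/-- Schoolbook multiplication: multiplying by a fixed basis vector is additive, so every bit of `X`
switches on one linear image of `Y`. -/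
theorem Cost.mul {X Y : Ω → GaloisField 2 m} (hX : Cost S (famF X) s) (hY : Cost S (famF Y) t) :
    Cost S (famF fun ω => X ω * Y ω) (s + t + 21 * m ^ 3) := by
  have key : ∀ ω, X ω * Y ω = ∑ j, if toBits m (X ω) j then fieldBasis m j * Y ω else 0 := by
    intro ω
    conv_lhs => rw [eq_sum_basis (X ω), Finset.sum_mul]
    refine Finset.sum_congr rfl fun j _ => ?_
    split <;> simp
  simp only [key]
  have := Cost.sum (S := S ∪ (famF X ∪ famF Y)) (s := 0 + (0 + 11 * m ^ 2) + m * 2) Finset.univ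
    (X := fun j ω => if toBits m (X ω) j then fieldBasis m j * Y ω else 0)
    fun j _ => (Cost.of_mem (Or.inr (Or.inl (mem_fam _ j)))).ite
      ((Cost.of_subset (T := famF Y) (by intro φ h; exact Or.inr (Or.inr h))).linear
        (AddMonoidHom.mulLeft (fieldBasis m j)))
  rw [Finset.card_univ, Fintype.card_fin] at this
  refine ((hX.union hY).then this).le ?_
  have hm : 1 ≤ m := NeZero.one_le
  have h2 : m ^ 2 ≤ m ^ 3 := Nat.pow_le_pow_right hm (by norm_num)
  calc s + t + m * (0 + (0 + 11 * m ^ 2) + m * 2 + m * 8) = s + t + (11 * m ^ 3 + 10 * m ^ 2) := by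
        ring
    _ ≤ _ := by omega

theorem Cost.inv (hm : 2 ≤ m) {X : Ω → GaloisField 2 m} (hX : Cost S (famF X) s) :
    Cost S (famF fun ω => (X ω)⁻¹) (s + 64 * m ^ 4) := by
  have h0 : Cost (S ∪ famF X) (famF fun ω => X ω ^ (2 ^ 0 - 1)) m := by
    simpa using Cost.constF (S := S ∪ famF X) (1 : GaloisField 2 m)
  -- Exponents 2^j − 1: squaring and multiplying by X leads from j to j + 1 with two
  -- multiplications. After m − 1 steps a last squaring gives 2^m − 2.
  have h1 := Cost.iterate (T := fun j => famF fun ω => X ω ^ (2 ^ j - 1)) (s := 42 * m ^ 3) h0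
    (m - 1) fun i _ => by
      have hp : Cost (S ∪ famF X ∪ famF fun ω => X ω ^ (2 ^ i - 1))
          (famF fun ω => X ω ^ (2 ^ i - 1)) 0 := .of_subset Set.subset_union_right
      have hx : Cost (S ∪ famF X ∪ famF fun ω => X ω ^ (2 ^ i - 1)) (famF X) 0 :=
        .of_subset fun φ h => Or.inl (Or.inr h)
      have := (hp.mul hp).mul hx
      convert this.le (t := 42 * m ^ 3) (by omega) using 3 with ω
      rw [← pow_add, ← pow_succ]
      congr 1
      have := Nat.one_le_two_pow (n := i)
      rw [pow_succ]; omega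
  have h2 : Cost (S ∪ famF X) (famF fun ω => (X ω)⁻¹) (m + (m - 1) * (42 * m ^ 3) + 21 * m ^ 3) := by
    have hp := Cost.of_subset (s := 0) (T := famF fun ω => X ω ^ (2 ^ (m - 1) - 1))
      (S := S ∪ famF X ∪ famF fun ω => X ω ^ (2 ^ (m - 1) - 1)) Set.subset_union_right
    have := h1.then (hp.mul hp)
    convert this.le (t := m + (m - 1) * (42 * m ^ 3) + 21 * m ^ 3) (by omega) using 3 with ω
    rw [pow_inverse hm, ← pow_add]
    congr 1
    have h3 : 2 ^ m = 2 ^ (m - 1) * 2 := by rw [← pow_succ]; congr 1; omega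
    have := Nat.one_le_two_pow (n := m - 1)
    omega
  refine (hX.then h2).le ?_
  obtain ⟨r, rfl⟩ : ∃ r, m = r + 1 := ⟨m - 1, by omega⟩
  have e1 : (r + 1) ≤ (r + 1) ^ 4 := Nat.le_self_pow (by norm_num) _
  have e3 : (r + 1) ^ 3 ≤ (r + 1) ^ 4 := Nat.pow_le_pow_right (by omega) (by norm_num)
  have e4 : r * (42 * (r + 1) ^ 3) ≤ 42 * (r + 1) ^ 4 := by
    rw [pow_succ (r + 1) 3]; nlinarith [Nat.zero_le ((r + 1) ^ 3)]
  simp only [Nat.add_sub_cancel]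
  omega

end FieldCost


/-! ### Uniform probabilities on finite types -/

section Prob

variable {Ω Ω' : Type} [Fintype Ω] [Fintype Ω']

open Classical in
theorem prob_eq_sum (p : Ω → Prop) :
    prob p = (∑ ω, if p ω then (1 : ℝ) else 0) / Fintype.card Ω := by
  simp only [prob, Finset.sum_boole]

theorem prob_mono {p q : Ω → Prop} (h : ∀ ω, p ω → q ω) : prob p ≤ prob q := by
  unfold prob
  gcongr with ω
  exact h ω

theorem prob_congr {p q : Ω → Prop} (h : ∀ ω, p ω ↔ q ω) : prob p = prob q := by
  rw [show p = q from funext fun ω => propext (h ω)]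

theorem prob_eq_zero {p : Ω → Prop} (h : ∀ ω, ¬ p ω) : prob p = 0 := by
  classical
  rw [prob_eq_sum]; simp [h]

theorem prob_exists_le {I : Type} (A : Finset I) (p : I → Ω → Prop) :
    prob (fun ω => ∃ i ∈ A, p i ω) ≤ ∑ i ∈ A, prob (p i) := by
  classical
  simp only [prob_eq_sum, ← Finset.sum_div]
  gcongr
  rw [Finset.sum_comm]
  refine Finset.sum_le_sum fun ω _ => ?_
  split_ifs with h
  · obtain ⟨i, hi, hp⟩ := h
    refine le_trans ?_ (Finset.single_le_sum (f := fun i => if p i ω then (1 : ℝ) else 0)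
      (fun j _ => by split_ifs <;> norm_num) hi)
    simp [hp]
  · exact Finset.sum_nonneg fun j _ => by split_ifs <;> norm_num

theorem prob_or_le (p q : Ω → Prop) : prob (fun ω => p ω ∨ q ω) ≤ prob p + prob q := by
  have := prob_exists_le (Finset.univ : Finset Bool) fun b ω => if b then p ω else q ω
  simpa [or_comm] using this

theorem prob_not [Nonempty Ω] (p : Ω → Prop) : prob (fun ω => ¬ p ω) = 1 - prob p := by
  classical
  have hc : (Fintype.card Ω : ℝ) ≠ 0 := by exact_mod_cast Fintype.card_ne_zero
  rw [prob_eq_sum, prob_eq_sum, eq_sub_iff_add_eq, ← add_div, ← Finset.sum_add_distrib,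
    div_eq_one_iff_eq hc]
  rw [Finset.sum_congr rfl (g := fun _ => (1 : ℝ)) fun ω _ => by split_ifs <;> simp_all]
  simp

theorem prob_equiv (e : Ω ≃ Ω') (p : Ω' → Prop) : prob (fun ω => p (e ω)) = prob p := by
  classical
  rw [prob_eq_sum, prob_eq_sum, Fintype.card_congr e]
  congr 1
  exact Fintype.sum_equiv e _ _ fun _ => rfl

/-- On a finite type injectivity suffices for a change of variables, so the swaps in the security
proof need no explicit inverses. -/
theorem prob_injective {f : Ω → Ω} (hf : Function.Injective f) (p : Ω → Prop) :
    prob (fun ω => p (f ω)) = prob p :=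
  prob_equiv (Equiv.ofBijective f (Finite.injective_iff_bijective.mp hf)) p

theorem prob_prod (p : Ω × Ω' → Prop) :
    prob p = (∑ a, prob fun b => p (a, b)) / Fintype.card Ω := by
  classical
  simp only [prob_eq_sum, Fintype.card_prod, Fintype.sum_prod_type, ← Finset.sum_div, Nat.cast_mul]
  rw [div_div, mul_comm]

theorem prob_prod_le {p : Ω × Ω' → Prop} {ε : ℝ} (hε : 0 ≤ ε)
    (h : ∀ a, prob (fun b => p (a, b)) ≤ ε) : prob p ≤ ε := by
  rw [prob_prod]
  refine div_le_of_le_mul₀ (by positivity) hε ?_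
  calc _ ≤ ∑ _a : Ω, ε := Finset.sum_le_sum fun a _ => h a
    _ = _ := by simp [mul_comm]

theorem prob_fst [Nonempty Ω'] (p : Ω → Prop) : prob (fun ω : Ω × Ω' => p ω.1) = prob p := by
  classical
  rw [prob_prod, prob_eq_sum]
  congr 1
  refine Finset.sum_congr rfl fun a _ => ?_
  rw [prob_eq_sum]
  split_ifs with h <;> simp

theorem prob_snd [Nonempty Ω] (p : Ω' → Prop) : prob (fun ω : Ω × Ω' => p ω.2) = prob p := by
  rw [← prob_fst (Ω' := Ω) p]
  exact prob_equiv (Equiv.prodComm Ω Ω') (fun ω : Ω' × Ω => p ω.1)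

/-- Averaging over common randomness. -/
theorem abs_prob_prod_sub_le {A : Type} [Fintype A] {p : A × Ω → Prop} {q : A × Ω' → Prop} {ε : ℝ}
    (hε : 0 ≤ ε) (h : ∀ a, |prob (fun b => p (a, b)) - prob (fun b => q (a, b))| ≤ ε) :
    |prob p - prob q| ≤ ε := by
  rw [prob_prod, prob_prod, ← sub_div, ← Finset.sum_sub_distrib, abs_div, Nat.abs_cast]
  refine div_le_of_le_mul₀ (by positivity) hε ((Finset.abs_sum_le_sum_abs _ _).trans ?_)
  calc _ ≤ ∑ _a : A, ε := Finset.sum_le_sum fun a _ => h a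
    _ = _ := by simp [mul_comm]

theorem prob_eval {I : Type} [Fintype I] [DecidableEq I] {β : I → Type} [∀ i, Fintype (β i)]
    [∀ i, Nonempty (β i)] (i : I) (p : β i → Prop) :
    prob (fun f : ∀ i, β i => p (f i)) = prob p := by
  rw [← prob_fst (Ω' := ∀ j : {j // j ≠ i}, β j) p]
  exact prob_equiv (Equiv.piSplitAt i β) (fun ω => p ω.1)

theorem prob_pi {J V : Type} [Fintype J] [DecidableEq J] [Fintype V] (Q : J → Finset V) :
    prob (fun f : J → V => ∀ j, f j ∈ Q j) = ∏ j, ((Q j).card : ℝ) / Fintype.card V := by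
  classical
  unfold prob
  rw [Finset.prod_div_distrib, Finset.prod_const, Finset.card_univ, Fintype.card_fun]
  have : (Finset.univ.filter fun f : J → V => ∀ j, f j ∈ Q j) = Fintype.piFinset Q := by
    ext f; simp
  push_cast
  congr 1
  rw [← Nat.cast_prod, ← Fintype.card_piFinset, ← this]
  congr!

end Prob


/-! ### Cuckoo hashing with two hash functions and `3k` slots -/

section Cuckoo

/-- If the keys in `A` cannot be assigned to distinct slots, then some set of keys has one slot less
than its size, each of which occurs twice. -/
theorem exists_obstruction {X V : Type} [DecidableEq V] [DecidableEq X] (f : X × Bool → V)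
    (A : Finset X) (h : ¬ ∃ g : X → Bool, Set.InjOn (fun x => f (x, g x)) A) :
    ∃ S ⊆ A, ∃ W : Finset V, W.card + 1 = S.card ∧ (∀ x ∈ S, ∀ c, f (x, c) ∈ W) ∧
      ∃ p : V × Bool → X × Bool, ∀ w ∈ W, (∀ c, (p (w, c)).1 ∈ S ∧ f (p (w, c)) = w) ∧
        p (w, false) ≠ p (w, true) := by
  let N : X → Finset V := fun x => Finset.univ.image fun c => f (x, c)
  have hN : ∀ x v, v ∈ N x ↔ ∃ c, f (x, c) = v := fun x v => by
    simp only [N, Finset.mem_image, Finset.mem_univ, true_and]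
  -- Hall's theorem: an injective choice of neighbouring slots would give the assignment `g`.
  have hall : ¬ ∀ S : Finset {x // x ∈ A}, S.card ≤ (S.biUnion fun x => N x).card := by
    rw [Finset.all_card_le_biUnion_card_iff_exists_injective]
    rintro ⟨φ, hφ, hmem⟩
    apply h
    have hc : ∀ x : {x // x ∈ A}, ∃ c, f (x, c) = φ x := fun x => (hN _ _).mp (hmem x)
    choose c hc using hc
    refine ⟨fun x => if hx : x ∈ A then c ⟨x, hx⟩ else false, fun x hx y hy hxy => ?_⟩
    have hx' : x ∈ A := hx
    have hy' : y ∈ A := hy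
    simp only [hx', hy', dif_pos] at hxy
    rw [hc ⟨x, hx'⟩, hc ⟨y, hy'⟩] at hxy
    exact congrArg Subtype.val (hφ hxy)
  have hex : ∃ s : ℕ, ∃ S ⊆ A, S.card = s ∧ (S.biUnion N).card < S.card := by
    push Not at hall
    obtain ⟨S, hS⟩ := hall
    refine ⟨_, S.map (Function.Embedding.subtype _), ?_, rfl, ?_⟩
    · intro x; simp only [Finset.mem_map]; rintro ⟨y, -, rfl⟩; exact y.2
    · rw [Finset.card_map]
      refine lt_of_eq_of_lt (congrArg Finset.card ?_) hS
      ext v; simp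
  classical
  -- A violator of Hall's condition of least size, so all smaller sets of keys satisfy the
  -- condition.
  obtain ⟨S, hSA, hs, hlt⟩ := Nat.find_spec hex
  have hmin : ∀ T ⊆ A, T.card < S.card → T.card ≤ (T.biUnion N).card := by
    intro T hT hTS
    by_contra hcon
    exact Nat.find_min hex (m := T.card) (by omega) ⟨T, hT, rfl, by omega⟩
  have herase : ∀ x ∈ S, S.card - 1 ≤ ((S.erase x).biUnion N).card := by
    intro x hx
    have := hmin (S.erase x) ((Finset.erase_subset _ _).trans hSA) (Finset.card_erase_lt_of_mem hx)
    rwa [Finset.card_erase_of_mem hx] at this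
  have hne : S.Nonempty := Finset.card_pos.mp (by omega)
  have hpair : ∀ w ∈ S.biUnion N, ∃ i j : X × Bool, (i.1 ∈ S ∧ f i = w) ∧ (j.1 ∈ S ∧ f j = w) ∧
      i ≠ j := by
    intro w hw
    obtain ⟨x, hx, hxw⟩ := Finset.mem_biUnion.mp hw
    obtain ⟨c, hc⟩ := (hN _ _).mp hxw
    -- If x were the only key using w, removing x would leave at most |S| − 2 slots for |S| − 1
    -- keys, a smaller violator.
    have : w ∈ (S.erase x).biUnion N := by
      by_contra hcon
      have hsub : (S.erase x).biUnion N ⊆ (S.biUnion N).erase w := by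
        intro v hv
        refine Finset.mem_erase.mpr ⟨fun h => hcon (h ▸ hv), ?_⟩
        exact Finset.biUnion_subset_biUnion_of_subset_left _ (Finset.erase_subset _ _) hv
      have h1 := Finset.card_le_card hsub
      rw [Finset.card_erase_of_mem hw] at h1
      have h2 := herase x hx
      have h3 : 0 < (S.biUnion N).card := Finset.card_pos.mpr ⟨w, hw⟩
      omega
    obtain ⟨y, hy, hyw⟩ := Finset.mem_biUnion.mp this
    obtain ⟨c', hc'⟩ := (hN _ _).mp hyw
    refine ⟨(x, c), (y, c'), ⟨hx, hc⟩, ⟨Finset.mem_of_mem_erase hy, hc'⟩, fun he => ?_⟩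
    exact (Finset.ne_of_mem_erase hy) (congrArg Prod.fst he).symm
  obtain ⟨x₀, hx₀⟩ := hne
  have : ∀ w : V, ∃ q : Bool → X × Bool, w ∈ S.biUnion N →
      (∀ c, (q c).1 ∈ S ∧ f (q c) = w) ∧ q false ≠ q true := by
    intro w
    by_cases hw : w ∈ S.biUnion N
    · obtain ⟨i, j, hi, hj, hij⟩ := hpair w hw
      refine ⟨fun c => if c then j else i, fun _ => ⟨fun c => ?_, by simpa using hij⟩⟩
      cases c <;> simpa
    · exact ⟨fun _ => (x₀, false), fun h => absurd h hw⟩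
  choose q hq using this
  refine ⟨S, hSA, S.biUnion N, ?_, fun x hx c => Finset.mem_biUnion.mpr ⟨x, hx, (hN _ _).mpr ⟨c, rfl⟩⟩,
    fun wc => q wc.1 wc.2, fun w hw => hq w hw⟩
  have h1 := herase x₀ hx₀
  have h2 := Finset.card_le_card
    (Finset.biUnion_subset_biUnion_of_subset_left N (Finset.erase_subset x₀ S))
  omega

/-- The probability that the incidences of `S` lie in `W` and every slot in `W` occurs twice. -/
theorem prob_obstruction_le {X V : Type} [DecidableEq V] [Fintype X] [DecidableEq X] [Fintype V]
    (S : Finset X) (W : Finset V) (hSW : W.card + 1 = S.card) :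
    prob (fun f : X × Bool → V => (∀ x ∈ S, ∀ c, f (x, c) ∈ W) ∧
      ∃ p : V × Bool → X × Bool, ∀ w ∈ W, (∀ c, (p (w, c)).1 ∈ S ∧ f (p (w, c)) = w) ∧
        p (w, false) ≠ p (w, true)) ≤
    ((2 * S.card).factorial * (W.card : ℝ) ^ 2) /
      (2 ^ W.card * (Fintype.card V : ℝ) ^ (2 * S.card)) := by
  classical
  set E : (X × Bool → V) → Prop := fun f => (∀ x ∈ S, ∀ c, f (x, c) ∈ W) ∧
      ∃ p : V × Bool → X × Bool, ∀ w ∈ W, (∀ c, (p (w, c)).1 ∈ S ∧ f (p (w, c)) = w) ∧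
        p (w, false) ≠ p (w, true) with hE
  let I := {i : X × Bool // i.1 ∈ S}
  -- Double counting over systems of disjoint pairs of incidences, one pair for each slot. Using
  -- that slots are hit twice is essential: the bound (|W|/|V|)^(2|S|) for mere confinement to `W`
  -- is too weak to be summed over all sizes.
  let Q : (({w // w ∈ W} × Bool) ↪ I) → (X × Bool → V) → Prop := fun p f =>
    (∀ x ∈ S, ∀ c, f (x, c) ∈ W) ∧ ∀ wc, f (p wc).1 = wc.1
  have cardI : Fintype.card I = 2 * S.card := by
    have : Fintype.card I = (S ×ˢ (Finset.univ : Finset Bool)).card := by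
      rw [Fintype.card_subtype]; congr 1; ext i; simp
    rw [this]; simp [mul_comm]
  -- every good function has many systems of pairs
  have hmany : ∀ f, E f → 2 ^ W.card ≤ (Finset.univ.filter fun p => Q p f).card := by
    rintro f ⟨hin, p, hp⟩
    -- The two incidences of every slot can be listed in either order; `c` records the orders, and
    -- different `c` will give different systems.
    have hinj : ∀ c : {w // w ∈ W} → Bool, Function.Injective
        (fun wb : {w // w ∈ W} × Bool => (⟨p (wb.1, xor wb.2 (c wb.1)),
          ((hp wb.1 wb.1.2).1 _).1⟩ : I)) := by
      rintro c ⟨w, b⟩ ⟨w', b'⟩ h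
      have h1 : p (w, xor b (c w)) = p (w', xor b' (c w')) := congrArg Subtype.val h
      have hw : w = w' := by
        have e1 := ((hp w w.2).1 (xor b (c w))).2
        have e2 := ((hp w' w'.2).1 (xor b' (c w'))).2
        rw [h1] at e1
        exact Subtype.ext (e1.symm.trans e2)
      subst hw
      have hne := (hp w w.2).2
      have hb : b = b' := by
        revert h1
        cases b <;> cases b' <;> cases c w <;> simp [hne, hne.symm]
      rw [hb]
    let P : ({w // w ∈ W} → Bool) → ({w // w ∈ W} × Bool ↪ I) := fun c => ⟨_, hinj c⟩
    have hP : Function.Injective P := by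
      intro c c' h
      funext w
      have h1 : p (w, xor false (c w)) = p (w, xor false (c' w)) :=
        congrArg Subtype.val (DFunLike.congr_fun h (w, false))
      have hne := (hp w w.2).2
      revert h1
      cases c w <;> cases c' w <;> simp [hne, hne.symm]
    calc 2 ^ W.card = (Finset.univ.image P).card := by
          rw [Finset.card_image_of_injective _ hP, Finset.card_univ, Fintype.card_fun]; simp
      _ ≤ _ := by
          refine Finset.card_le_card fun e he => ?_
          obtain ⟨c, -, rfl⟩ := Finset.mem_image.mp he
          exact Finset.mem_filter.mpr ⟨Finset.mem_univ _, hin, fun wc => ((hp wc.1 wc.1.2).1 _).2⟩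
  -- the probability of each system of pairs
  have hQ : ∀ p, prob (Q p) = (W.card : ℝ) ^ 2 / (Fintype.card V : ℝ) ^ (2 * S.card) := by
    intro p
    -- The values allowed at an incidence: the prescribed slot if it is paired, `W` if it belongs to
    -- `S` and is unpaired, anything otherwise. As 2|W| = 2|S| − 2, exactly two incidences of `S`
    -- are unpaired, whence the factor |W|².
    let D : X × Bool → Finset V := fun i =>
      if hi : i.1 ∈ S then
        if h : ∃ wc, p wc = ⟨i, hi⟩ then {(h.choose.1 : V)} else W
      else Finset.univ
    have hev : ∀ f, Q p f ↔ ∀ i, f i ∈ D i := by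
      intro f
      constructor
      · rintro ⟨hin, hpq⟩ i
        by_cases hi : i.1 ∈ S
        · by_cases h : ∃ wc, p wc = ⟨i, hi⟩
          · simp only [D, hi, h, dif_pos, Finset.mem_singleton]
            rw [← hpq h.choose, h.choose_spec]
          · simp only [D, hi, h, dif_pos, dif_neg, not_false_eq_true]
            exact hin i.1 hi i.2
        · simp [D, hi]
      · intro h
        have hpq : ∀ wc, f (p wc).1 = wc.1 := by
          intro wc
          have h1 := h (p wc).1
          have hex : ∃ wc', p wc' = ⟨(p wc).1, (p wc).2⟩ := ⟨wc, rfl⟩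
          simp only [D, (p wc).2, hex, dif_pos, Finset.mem_singleton] at h1
          rw [h1, p.injective hex.choose_spec]
        refine ⟨fun x hx c => ?_, hpq⟩
        have h1 := h (x, c)
        by_cases hex : ∃ wc, p wc = ⟨(x, c), hx⟩
        · obtain ⟨wc, hwc⟩ := hex
          have := hpq wc
          rw [hwc] at this
          rw [this]; exact wc.1.2
        · simpa only [D, hx, hex, dif_pos, dif_neg, not_false_eq_true] using h1
    rw [prob_congr hev, prob_pi]
    by_cases hV : Fintype.card V = 0
    · have hW : W.card = 0 := by
        have := Finset.card_le_univ W; omega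
      obtain ⟨x, hx⟩ : S.Nonempty := Finset.card_pos.mp (by omega)
      rw [hW, hV]
      simp only [Nat.cast_zero, div_zero]
      rw [Finset.prod_eq_zero (Finset.mem_univ (x, false)) rfl]
      simp
    have hV' : (Fintype.card V : ℝ) ≠ 0 := by exact_mod_cast hV
    have hprodI : ∏ j : X × Bool, ((D j).card : ℝ) / Fintype.card V =
        ∏ i : I, ((D i.1).card : ℝ) / Fintype.card V := by
      rw [← Fintype.prod_subtype_mul_prod_subtype (fun i : X × Bool => i.1 ∈ S),
        Finset.prod_eq_one (s := Finset.univ (α := {i : X × Bool // i.1 ∉ S})), mul_one]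
      rintro ⟨i, hi⟩ -
      simp [D, hi, hV']
    rw [hprodI, Finset.prod_div_distrib, Finset.prod_const, Finset.card_univ, cardI]
    congr 1
    have : ∀ i : I, ((D i.1).card : ℝ) = if i ∈ Finset.univ.image p then 1 else (W.card : ℝ) := by
      rintro ⟨i, hi⟩
      by_cases h : ∃ wc, p wc = ⟨i, hi⟩
      · rw [if_pos (by simpa [-Prod.exists] using h)]
        simp only [D, hi, dif_pos, h, Finset.card_singleton, Nat.cast_one]
      · rw [if_neg (by simpa [-Prod.exists] using h)]
        simp only [D, hi, dif_pos, h, dif_neg, not_false_eq_true]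
    simp only [this]
    rw [Finset.prod_ite, Finset.prod_const_one, one_mul, Finset.prod_const]
    congr 1
    rw [Finset.filter_not, Finset.card_sdiff_of_subset (Finset.subset_univ _)]
    have : (Finset.univ.filter fun i => i ∈ Finset.univ.image p) = Finset.univ.image p := by
      ext; simp
    rw [this, Finset.card_image_of_injective _ p.injective, Finset.card_univ, Finset.card_univ, cardI]
    simp
    omega
  have hsum : (2 : ℝ) ^ W.card * prob E ≤ ∑ p, prob (Q p) := by
    simp only [prob_eq_sum, ← Finset.sum_div]
    rw [← mul_div_assoc]
    gcongr
    rw [Finset.sum_comm, Finset.mul_sum]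
    refine Finset.sum_le_sum fun f _ => ?_
    split_ifs with hf
    · have := hmany f hf
      rw [Finset.card_filter] at this
      rw [mul_one]
      exact_mod_cast this
    · rw [mul_zero]
      exact Finset.sum_nonneg fun p _ => by split_ifs <;> norm_num
  -- There are (2|S|)!/2! embeddings of 2|S| − 2 points into 2|S| points; the 2 is given away.
  have hcard : (Fintype.card ({w // w ∈ W} × Bool ↪ I) : ℝ) ≤ (2 * S.card).factorial := by
    have hle : Fintype.card ({w // w ∈ W} × Bool) ≤ 2 * S.card := by
      simp; omega
    rw [Fintype.card_embedding_eq, cardI, ← Nat.factorial_mul_descFactorial hle]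
    exact_mod_cast Nat.le_mul_of_pos_left _ (Nat.factorial_pos _)
  simp only [hQ, Finset.sum_const, Finset.card_univ, nsmul_eq_mul] at hsum
  have h2 : (0 : ℝ) < 2 ^ W.card := by positivity
  calc prob E ≤ Fintype.card ({w // w ∈ W} × Bool ↪ I) *
        ((W.card : ℝ) ^ 2 / (Fintype.card V : ℝ) ^ (2 * S.card)) / 2 ^ W.card := by
        rw [le_div_iff₀' h2]; exact hsum
    _ ≤ (2 * S.card).factorial *
        ((W.card : ℝ) ^ 2 / (Fintype.card V : ℝ) ^ (2 * S.card)) / 2 ^ W.card := by gcongr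
    _ = _ := by rw [← mul_div_assoc, div_div, mul_comm (2 ^ W.card : ℝ)]

/-- The estimate (2r+2)! ≤ 4^(r+1)·(r+1)!², from the central binomial coefficient, absorbs the
factorials of the two binomial coefficients. Up to a polynomial in r there remains (4/(2·3))^r, and
the powers of k leave a single 1/k. -/
theorem obstruction_term_le (k r : ℕ) (hk : 1 ≤ k) :
    (k.choose (r + 1) : ℝ) * ((3 * k).choose r) *
      (((2 * (r + 1)).factorial * (r : ℝ) ^ 2) / (2 ^ r * ((3 * k : ℕ) : ℝ) ^ (2 * (r + 1)))) ≤
    (2 * ((r : ℝ) ^ 3 * (2 / 3) ^ r) + 2 * ((r : ℝ) ^ 2 * (2 / 3) ^ r)) / k := by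
  have hk0 : (0 : ℝ) < k := by exact_mod_cast hk
  have h1 : (k.choose (r + 1) : ℝ) ≤ (k : ℝ) ^ (r + 1) / (r + 1).factorial :=
    Nat.choose_le_pow_div _ _
  have h2 : ((3 * k).choose r : ℝ) ≤ ((3 * k : ℕ) : ℝ) ^ r / r.factorial := Nat.choose_le_pow_div _ _
  have h3 : ((2 * (r + 1)).factorial : ℝ) ≤ 4 ^ (r + 1) * (r + 1).factorial * ((r + 1) * r.factorial) := by
    have e1 : (r + 1).centralBinom * (r + 1).factorial * (r + 1).factorial =
        (2 * (r + 1)).factorial := by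
      have := Nat.choose_mul_factorial_mul_factorial (n := 2 * (r + 1)) (k := r + 1) (by omega)
      rwa [show 2 * (r + 1) - (r + 1) = r + 1 by omega] at this
    have e2 : (r + 1).centralBinom ≤ 4 ^ (r + 1) := by
      rw [Nat.centralBinom]
      calc _ ≤ 2 ^ (2 * (r + 1)) := Nat.choose_le_two_pow _ _
        _ = _ := by rw [pow_mul]; norm_num
    rw [← e1]
    have e3 : ((r + 1).factorial : ℝ) = (r + 1) * r.factorial := by
      rw [Nat.factorial_succ]; push_cast; ring
    have e4 : ((r + 1).centralBinom : ℝ) ≤ 4 ^ (r + 1) := by exact_mod_cast e2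
    rw [← e3]
    push_cast
    gcongr
  have hf1 : (0 : ℝ) < (r + 1).factorial := by exact_mod_cast Nat.factorial_pos _
  have hf2 : (0 : ℝ) < r.factorial := by exact_mod_cast Nat.factorial_pos _
  calc _ ≤ (k : ℝ) ^ (r + 1) / (r + 1).factorial * (((3 * k : ℕ) : ℝ) ^ r / r.factorial) *
      ((4 ^ (r + 1) * (r + 1).factorial * ((r + 1) * r.factorial) * (r : ℝ) ^ 2) /
        (2 ^ r * ((3 * k : ℕ) : ℝ) ^ (2 * (r + 1)))) := by gcongr
    _ = (4 / 9) * ((r + 1) * (r : ℝ) ^ 2 * (2 / 3) ^ r) / k := by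
        push_cast
        rw [show 2 * (r + 1) = r + r + 2 by ring, div_pow]
        simp only [pow_add, mul_pow, show (4 : ℝ) ^ r = 2 ^ r * 2 ^ r by rw [← mul_pow]; norm_num]
        field_simp
        norm_num
    _ ≤ _ := by
        rw [div_le_div_iff_of_pos_right hk0]
        have : 0 ≤ (r : ℝ) ^ 3 * (2 / 3) ^ r := by positivity
        have : 0 ≤ (r : ℝ) ^ 2 * (2 / 3) ^ r := by positivity
        nlinarith

/-- Union bound over the obstructions with r + 1 keys and r slots. With 3k slots the terms decay
like (2/3)^r, so their sum converges to a constant that depends on neither k nor the set of keys. -/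
theorem exists_cuckoo_bound : ∃ C : ℕ, ∀ (X : Type) [Fintype X] [DecidableEq X] (k : ℕ) (_ : 1 ≤ k) (A : Finset X),
    A.card ≤ k → prob (fun f : X → Bool → Fin (3 * k) =>
      ¬ ∃ g : X → Bool, Set.InjOn (fun x => f x (g x)) A) ≤ C / k := by
  have hs : Summable fun r : ℕ =>
      2 * ((r : ℝ) ^ 3 * (2 / 3) ^ r) + 2 * ((r : ℝ) ^ 2 * (2 / 3) ^ r) :=
    ((summable_pow_mul_geometric_of_norm_lt_one 3 (r := (2 / 3 : ℝ)) (by norm_num)).mul_left 2).add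
      ((summable_pow_mul_geometric_of_norm_lt_one 2 (r := (2 / 3 : ℝ)) (by norm_num)).mul_left 2)
  obtain ⟨C, hC⟩ := exists_nat_ge (∑' r : ℕ,
      (2 * ((r : ℝ) ^ 3 * (2 / 3) ^ r) + 2 * ((r : ℝ) ^ 2 * (2 / 3) ^ r)))
  refine ⟨C, fun X _ _ k hk A hA => ?_⟩
  classical
  let E : Finset X → Finset (Fin (3 * k)) → (X × Bool → Fin (3 * k)) → Prop := fun S W f =>
    (∀ x ∈ S, ∀ c, f (x, c) ∈ W) ∧
      ∃ p : Fin (3 * k) × Bool → X × Bool, ∀ w ∈ W,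
        (∀ c, (p (w, c)).1 ∈ S ∧ f (p (w, c)) = w) ∧ p (w, false) ≠ p (w, true)
  let B : Finset (Σ _ : ℕ, Finset X × Finset (Fin (3 * k))) := (Finset.range k).sigma fun r =>
    A.powersetCard (r + 1) ×ˢ Finset.univ.powersetCard r
  calc prob (fun f : X → Bool → Fin (3 * k) => ¬ ∃ g : X → Bool, Set.InjOn (fun x => f x (g x)) A)
      = prob (fun f : X × Bool → Fin (3 * k) =>
          ¬ ∃ g : X → Bool, Set.InjOn (fun x => f (x, g x)) A) :=
        prob_equiv (Equiv.curry X Bool (Fin (3 * k))).symm (fun f : X × Bool → Fin (3 * k) =>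
          ¬ ∃ g : X → Bool, Set.InjOn (fun x => f (x, g x)) A)
    _ ≤ prob (fun f : X × Bool → Fin (3 * k) => ∃ b ∈ B, E b.2.1 b.2.2 f) := by
        refine prob_mono fun f hf => ?_
        obtain ⟨S, hSA, W, hW, h1, h2⟩ := exists_obstruction f A hf
        refine ⟨⟨W.card, S, W⟩, ?_, h1, h2⟩
        have := Finset.card_le_card hSA
        simp only [B, Finset.mem_sigma, Finset.mem_range, Finset.mem_product,
          Finset.mem_powersetCard]
        exact ⟨by omega, ⟨hSA, hW.symm⟩, Finset.subset_univ _, trivial⟩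
    _ ≤ ∑ b ∈ B, prob (E b.2.1 b.2.2) := prob_exists_le _ _
    _ ≤ ∑ b ∈ B, (((2 * (b.1 + 1)).factorial * (b.1 : ℝ) ^ 2) /
          (2 ^ b.1 * ((3 * k : ℕ) : ℝ) ^ (2 * (b.1 + 1)))) := by
        refine Finset.sum_le_sum fun b hb => ?_
        simp only [B, Finset.mem_sigma, Finset.mem_range, Finset.mem_product,
          Finset.mem_powersetCard] at hb
        obtain ⟨-, ⟨-, hS⟩, -, hW⟩ := hb
        have := prob_obstruction_le b.2.1 b.2.2 (by omega)
        rw [hS, hW, Fintype.card_fin] at this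
        exact this
    _ = ∑ r ∈ Finset.range k, (A.card.choose (r + 1) : ℝ) * ((3 * k).choose r) *
          (((2 * (r + 1)).factorial * (r : ℝ) ^ 2) /
            (2 ^ r * ((3 * k : ℕ) : ℝ) ^ (2 * (r + 1)))) := by
        rw [Finset.sum_sigma]
        refine Finset.sum_congr rfl fun r _ => ?_
        dsimp only
        rw [Finset.sum_const, Finset.card_product, Finset.card_powersetCard,
          Finset.card_powersetCard, nsmul_eq_mul]
        simp
    _ ≤ ∑ r ∈ Finset.range k,
          (2 * ((r : ℝ) ^ 3 * (2 / 3) ^ r) + 2 * ((r : ℝ) ^ 2 * (2 / 3) ^ r)) / k := by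
        refine Finset.sum_le_sum fun r _ => le_trans ?_ (obstruction_term_le k r hk)
        have : (A.card.choose (r + 1) : ℝ) ≤ k.choose (r + 1) := by
          exact_mod_cast Nat.choose_le_choose _ hA
        gcongr
    _ ≤ C / k := by
        rw [← Finset.sum_div]
        gcongr
        exact (hs.sum_le_tsum _ fun r _ => by positivity).trans hC

end Cuckoo

/-! ### Cuckoo hashing in all layers of the tree -/

section CuckooTree

variable {P : Params}

/-- Union bound over the d + 1 layers. The active nodes of a layer are prefixes of the k positions,
hence at most k, and failure there involves only one coordinate of the hash family. -/
theorem exists_prob_cuckoo_fail_le : ∃ C : ℕ, ∀ (P : Params) (inp : Input P),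
    prob (fun f : HashFam P => ¬ CuckooOK f (Set.range inp.α)) ≤ C * (P.d + 1) / P.k := by
  obtain ⟨C, hC⟩ := exists_cuckoo_bound
  refine ⟨C, fun P inp => ?_⟩
  classical
  have hne : ∀ i : Fin (P.d + 1), Nonempty (Bits (i : ℕ) → Bool → Fin (3 * P.k)) := fun i =>
    ⟨fun _ _ => ⟨0, by have := P.k_pos; omega⟩⟩
  calc prob (fun f : HashFam P => ¬ CuckooOK f (Set.range inp.α))
      ≤ prob (fun f : HashFam P => ∃ i ∈ (Finset.univ : Finset (Fin (P.d + 1))),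
          ¬ ∃ g, ValidAssign f (Set.range inp.α) i g) := by
        refine prob_mono fun f hf => ?_
        simpa [CuckooOK] using hf
    _ ≤ ∑ i : Fin (P.d + 1), prob (fun f : HashFam P =>
          ¬ ∃ g, ValidAssign f (Set.range inp.α) i g) := prob_exists_le _ _
    _ ≤ ∑ _i : Fin (P.d + 1), (C / P.k : ℝ) := by
        refine Finset.sum_le_sum fun i _ => ?_
        have hi := Nat.lt_succ_iff.mp i.isLt
        let pre : Fin P.k → Bits (i : ℕ) := fun l j => inp.α l (Fin.castLE hi j)
        have hset : {x | OnPath (Set.range inp.α) i hi x} =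
            ((Finset.univ.image pre : Finset (Bits (i : ℕ))) : Set (Bits (i : ℕ))) := by
          ext x; simp [OnPath, pre]
        have := hC (Bits (i : ℕ)) P.k P.k_pos (Finset.univ.image pre)
          (Finset.card_image_le.trans (by simp))
        rw [← prob_eval (β := fun i : Fin (P.d + 1) => Bits (i : ℕ) → Bool → Fin (3 * P.k)) i] at this
        refine le_trans (le_of_eq (prob_congr fun f => ?_)) this
        simp only [ValidAssign, hset]
    _ = _ := by
        simp
        ring

end CuckooTree


/-! ### Correction words and control bits -/

section Tree

variable {n : ℕ} {P : Params}

theorem OnPath.init {d : ℕ} {A : Set (Bits d)} {i : ℕ} {hi : i + 1 ≤ d} {y : Bits (i + 1)}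
    (h : OnPath A (i + 1) hi y) : OnPath A i (Nat.le_of_succ_le hi) (Fin.init y) := by
  obtain ⟨a, ha, rfl⟩ := h
  exact ⟨a, ha, rfl⟩

theorem OnPath.exists_child {d : ℕ} {A : Set (Bits d)} {i : ℕ} {hi : i + 1 ≤ d} {x : Bits i}
    (h : OnPath A i (Nat.le_of_succ_le hi) x) :
    ∃ b : Bool, OnPath A (i + 1) hi (Fin.snoc (α := fun _ => Bool) x b) := by
  obtain ⟨a, ha, rfl⟩ := h
  refine ⟨a (Fin.castLE hi (Fin.last i)), a, ha, ?_⟩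
  funext j
  refine Fin.lastCases ?_ (fun j => ?_) j
  · simp
  · simp

theorem onPath_last {A : Set (Bits P.d)} {x : Bits P.d} : OnPath A P.d le_rfl x ↔ x ∈ A := by
  constructor
  · rintro ⟨a, ha, rfl⟩; exact ha
  · intro h; exact ⟨x, h, rfl⟩

/-- All children of the nodes of a layer, before correction. -/
def expand {i : ℕ} (G : Bits n → Bits (2 * (n + 2))) (V : Bits i → NodeVal n) :
    Bits (i + 1) → NodeVal n :=
  fun y => child (G (V (Fin.init y)).seed) (y (Fin.last i))

/-- Correction of given children. -/
def correct {N i : ℕ} (f : Bits i → Bool → Fin N) (cw : Fin N → CorrWord n)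
    (V : Bits i → NodeVal n) (ch : Bits (i + 1) → NodeVal n) : Bits (i + 1) → NodeVal n :=
  fun y => applyCW (V (Fin.init y)).u (V (Fin.init y)).q (cw (f (Fin.init y) false))
    (cw (f (Fin.init y) true)) (y (Fin.last i)) (ch y)

theorem nextLayer_eq {N i : ℕ} (G : Bits n → Bits (2 * (n + 2))) (f : Bits i → Bool → Fin N)
    (cw : Fin N → CorrWord n) (V : Bits i → NodeVal n) :
    nextLayer G f cw V = correct f cw V (expand G V) := rfl

open Classical in
/-- The correction word for the slot assigned to the active node `x`, where `s` and `t` are the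
uncorrected children at the two servers and `c` is a random seed correction. -/
noncomputable def corrAt (f : HashFam P) (A : Set (Bits P.d)) (i : ℕ) (hi : i < P.d)
    (s t : Bits (i + 1) → NodeVal n) (c : Bits n) (x : Bits i) : CorrWord n :=
  let y : Bool → Bits (i + 1) := fun b => Fin.snoc (α := fun _ => Bool) x b
  let on : Bool → Bool := fun b => decide (OnPath A (i + 1) hi (y b))
  let g : Bool → Bool := fun b => assign f A ⟨i + 1, by omega⟩ (y b)
  (if on false && on true then c
    else if on false then fun j => xor ((s (y true)).seed j) ((t (y true)).seed j)
    else fun j => xor ((s (y false)).seed j) ((t (y false)).seed j),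
   fun b => xor (xor (s (y b)).u (t (y b)).u) (on b && !(g b)),
   fun b => xor (xor (s (y b)).q (t (y b)).q) (on b && g b))

open Classical in
/-- All correction words of a layer, from the uncorrected children at the two servers. -/
noncomputable def corr (f : HashFam P) (A : Set (Bits P.d)) (i : ℕ) (hi : i < P.d)
    (s t : Bits (i + 1) → NodeVal n) (rnd : Fin (3 * P.k) → CorrWord n) :
    Fin (3 * P.k) → CorrWord n := fun m =>
  if h : ∃ x : Bits i, OnPath A i hi.le x ∧
      f ⟨i, by omega⟩ x (assign f A ⟨i, by omega⟩ x) = m then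
    corrAt f A i hi s t (rnd m).1 h.choose
  else rnd m

/-- The correction words see the seeds only through the uncorrected children. In this form children
expanded by `G` can later be replaced by random ones. -/
theorem genCW_eq (G : Bits n → Bits (2 * (n + 2))) (f : HashFam P) (A : Set (Bits P.d)) (i : ℕ)
    (hi : i < P.d) (S T : Bits i → NodeVal n) (rnd : Fin (3 * P.k) → CorrWord n) :
    genCW G f A i hi S T rnd = corr f A i hi (expand G S) (expand G T) rnd := by
  funext m
  unfold genCW corr
  simp only [corrAt, expand, Fin.init_snoc, Fin.snoc_last]

variable {f : HashFam P} {A : Set (Bits P.d)}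

/-- Without collisions, the active node chosen by `corr` for this slot can only be x. -/
theorem corr_slot (hA : ∀ i, ValidAssign f A i (assign f A i)) {i : ℕ} {hi : i < P.d}
    (s t : Bits (i + 1) → NodeVal n) (rnd : Fin (3 * P.k) → CorrWord n) {x : Bits i}
    (hx : OnPath A i hi.le x) :
    corr f A i hi s t rnd (f ⟨i, by omega⟩ x (assign f A ⟨i, by omega⟩ x)) =
      corrAt f A i hi s t (rnd (f ⟨i, by omega⟩ x (assign f A ⟨i, by omega⟩ x))).1 x := by
  have h : ∃ x' : Bits i, OnPath A i hi.le x' ∧ f ⟨i, by omega⟩ x' (assign f A ⟨i, by omega⟩ x') =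
      f ⟨i, by omega⟩ x (assign f A ⟨i, by omega⟩ x) := ⟨x, hx, rfl⟩
  have hc : h.choose = x := hA ⟨i, by omega⟩ h.choose_spec.1 hx h.choose_spec.2
  rw [corr, dif_pos h, hc]

theorem corr_of_forall_ne {i : ℕ} {hi : i < P.d}
    (s t : Bits (i + 1) → NodeVal n) (rnd : Fin (3 * P.k) → CorrWord n) {m : Fin (3 * P.k)}
    (hm : ∀ x : Bits i, OnPath A i hi.le x → f ⟨i, by omega⟩ x (assign f A ⟨i, by omega⟩ x) ≠ m) :
    corr f A i hi s t rnd m = rnd m :=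
  dif_neg fun ⟨x, hx, h⟩ => hm x hx h

/-- Only children of active nodes enter the correction words. The hybrids may therefore put
arbitrary values at all other nodes. -/
theorem corr_congr {i : ℕ} {hi : i < P.d} {s t s' t' : Bits (i + 1) → NodeVal n}
    {rnd : Fin (3 * P.k) → CorrWord n}
    (hs : ∀ y, OnPath A i hi.le (Fin.init y) → s y = s' y)
    (ht : ∀ y, OnPath A i hi.le (Fin.init y) → t y = t' y) :
    corr f A i hi s t rnd = corr f A i hi s' t' rnd := by
  funext m
  unfold corr
  split_ifs with h
  · have hx := h.choose_spec.1
    have e1 : ∀ b, s (Fin.snoc (α := fun _ => Bool) h.choose b) =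
      s' (Fin.snoc (α := fun _ => Bool) h.choose b) := fun b => hs _ (by rwa [Fin.init_snoc])
    have e2 : ∀ b, t (Fin.snoc (α := fun _ => Bool) h.choose b) =
      t' (Fin.snoc (α := fun _ => Bool) h.choose b) := fun b => ht _ (by rwa [Fin.init_snoc])
    simp only [corrAt, e1, e2]
  · rfl

/-- The two servers enter through exclusive ors only, so either may play the part of the server
whose view is simulated. -/
theorem corr_comm {i : ℕ} {hi : i < P.d} (s t : Bits (i + 1) → NodeVal n)
    (rnd : Fin (3 * P.k) → CorrWord n) : corr f A i hi s t rnd = corr f A i hi t s rnd := by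
  funext m
  simp only [corr, corrAt, Bool.xor_comm (s _).u, Bool.xor_comm (s _).q,
    Bool.xor_comm ((s _).seed _)]

theorem corrAt_u {i : ℕ} {hi : i < P.d} (s t : Bits (i + 1) → NodeVal n) (c : Bits n)
    (y : Bits (i + 1)) [Decidable (OnPath A (i + 1) hi y)] :
    (corrAt f A i hi s t c (Fin.init y)).2.1 (y (Fin.last i)) = xor (xor (s y).u (t y).u)
      (decide (OnPath A (i + 1) hi y) && !(assign f A ⟨i + 1, by omega⟩ y)) := by
  simp only [corrAt, Fin.snoc_init_self]

theorem corrAt_q {i : ℕ} {hi : i < P.d} (s t : Bits (i + 1) → NodeVal n) (c : Bits n)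
    (y : Bits (i + 1)) [Decidable (OnPath A (i + 1) hi y)] :
    (corrAt f A i hi s t c (Fin.init y)).2.2 (y (Fin.last i)) = xor (xor (s y).q (t y).q)
      (decide (OnPath A (i + 1) hi y) && assign f A ⟨i + 1, by omega⟩ y) := by
  simp only [corrAt, Fin.snoc_init_self]

/-- An active node has an active child. If y is inactive, the active child is its sibling, and the
seed correction is the one that makes the seeds at y equal. -/
theorem corrAt_seed_of_off {i : ℕ} {hi : i < P.d} (s t : Bits (i + 1) → NodeVal n) (c : Bits n)
    {y : Bits (i + 1)} (hx : OnPath A i hi.le (Fin.init y)) (hy : ¬ OnPath A (i + 1) hi y) :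
    (corrAt f A i hi s t c (Fin.init y)).1 = fun j => xor ((s y).seed j) ((t y).seed j) := by
  obtain ⟨b, hb⟩ := hx.exists_child (hi := hi)
  have hy' : Fin.snoc (α := fun _ => Bool) (Fin.init y) (y (Fin.last i)) = y := Fin.snoc_init_self y
  cases hl : y (Fin.last i) <;> rw [hl] at hy' <;> cases b
  · rw [hy'] at hb; exact absurd hb hy
  · simp only [corrAt, hy', hy]
    simp
  · simp only [corrAt, hb, hy', hy]
    simp
  · rw [hy'] at hb; exact absurd hb hy

theorem corrAt_seed_of_on {i : ℕ} {hi : i < P.d} (s t : Bits (i + 1) → NodeVal n) (c : Bits n)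
    {x : Bits i} (h : ∀ b, OnPath A (i + 1) hi (Fin.snoc (α := fun _ => Bool) x b)) :
    (corrAt f A i hi s t c x).1 = c := by
  simp [corrAt, h]

/-- The control bits of two nodes differ exactly in the one indicated by `g`. -/
def Flip (g : Bool) (v w : NodeVal n) : Prop := w.u = xor v.u (!g) ∧ w.q = xor v.q g

theorem Flip.symm {g : Bool} {v w : NodeVal n} (h : Flip g v w) : Flip g w v := by
  obtain ⟨h1, h2⟩ := h
  constructor
  · rw [h1]; cases v.u <;> cases g <;> rfl
  · rw [h2]; cases v.q <;> cases g <;> rfl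

theorem bit_flip (g u q c₀ c₁ s t : Bool) :
    xor t (xor ((xor u (!g)) && c₀) ((xor q g) && c₁)) =
      xor (xor (xor s (xor (u && c₀) (q && c₁))) (xor s t)) (if g then c₁ else c₀) := by
  revert g u q c₀ c₁ s t; decide

/-- The control bits agree except for the one indicated by `g`, so exactly one server applies that
word and the effect of the other word is common to both. -/
theorem applyCW_flip {g : Bool} {v w : NodeVal n} (h : Flip g v w) (c : Bool → CorrWord n) (b : Bool)
    (s t : NodeVal n) :
    applyCW w.u w.q (c false) (c true) b t =
      ⟨fun j => xor (xor ((applyCW v.u v.q (c false) (c true) b s).seed j) (xor (s.seed j) (t.seed j)))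
          ((c g).1 j),
        xor (xor (applyCW v.u v.q (c false) (c true) b s).u (xor s.u t.u)) ((c g).2.1 b),
        xor (xor (applyCW v.u v.q (c false) (c true) b s).q (xor s.q t.q)) ((c g).2.2 b)⟩ := by
  obtain ⟨h1, h2⟩ := h
  simp only [applyCW, h1, h2, NodeVal.mk.injEq]
  refine ⟨?_, ?_, ?_⟩
  · funext j
    rw [bit_flip _ _ _ _ _ (s.seed j)]; cases g <;> rfl
  · rw [bit_flip _ _ _ _ _ s.u]; cases g <;> rfl
  · rw [bit_flip _ _ _ _ _ s.q]; cases g <;> rfl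

theorem NodeVal.ext' {v w : NodeVal n} (h1 : ∀ j, v.seed j = w.seed j) (h2 : v.u = w.u)
    (h3 : v.q = w.q) : v = w := by
  cases v; cases w
  simp only [NodeVal.mk.injEq]
  exact ⟨funext h1, h2, h3⟩

/-- The invariant of the control bits is preserved at active nodes. -/
theorem flip_correct (hA : ∀ i, ValidAssign f A i (assign f A i)) {i : ℕ} {hi : i < P.d}
    {S T : Bits i → NodeVal n} {s t : Bits (i + 1) → NodeVal n}
    (rnd : Fin (3 * P.k) → CorrWord n) {y : Bits (i + 1)} (hy : OnPath A (i + 1) hi y)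
    (hf : Flip (assign f A ⟨i, by omega⟩ (Fin.init y)) (S (Fin.init y)) (T (Fin.init y))) :
    Flip (assign f A ⟨i + 1, by omega⟩ y)
      (correct (f ⟨i, by omega⟩) (corr f A i hi s t rnd) S s y)
      (correct (f ⟨i, by omega⟩) (corr f A i hi s t rnd) T t y) := by
  classical
  have h := applyCW_flip hf (fun b => corr f A i hi s t rnd (f ⟨i, by omega⟩ (Fin.init y) b))
    (y (Fin.last i)) (s y) (t y)
  simp only [corr_slot hA s t rnd hy.init, corrAt_u, corrAt_q, hy, decide_true, Bool.true_and] at h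
  unfold correct Flip
  rw [h]
  constructor
  · dsimp only
    generalize (applyCW (S (Fin.init y)).u (S (Fin.init y)).q _ _ _ (s y)).u = z
    cases (s y).u <;> cases (t y).u <;> simp
  · dsimp only
    generalize (applyCW (S (Fin.init y)).u (S (Fin.init y)).q _ _ _ (s y)).q = z
    cases (s y).q <;> cases (t y).q <;> simp

/-- Nodes leaving the active paths get equal values. -/
theorem eq_correct_of_off (hA : ∀ i, ValidAssign f A i (assign f A i)) {i : ℕ} {hi : i < P.d}
    {S T : Bits i → NodeVal n} {s t : Bits (i + 1) → NodeVal n}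
    (rnd : Fin (3 * P.k) → CorrWord n) {y : Bits (i + 1)} (hx : OnPath A i hi.le (Fin.init y))
    (hy : ¬ OnPath A (i + 1) hi y)
    (hf : Flip (assign f A ⟨i, by omega⟩ (Fin.init y)) (S (Fin.init y)) (T (Fin.init y))) :
    correct (f ⟨i, by omega⟩) (corr f A i hi s t rnd) S s y =
      correct (f ⟨i, by omega⟩) (corr f A i hi s t rnd) T t y := by
  classical
  have h := applyCW_flip hf (fun b => corr f A i hi s t rnd (f ⟨i, by omega⟩ (Fin.init y) b))
    (y (Fin.last i)) (s y) (t y)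
  simp only [corr_slot hA s t rnd hx, corrAt_u, corrAt_q, hy, decide_false, Bool.false_and,
    corrAt_seed_of_off s t _ hx hy] at h
  unfold correct
  rw [h]
  refine NodeVal.ext' (fun j => ?_) ?_ ?_
  · dsimp only
    generalize (applyCW (S (Fin.init y)).u (S (Fin.init y)).q _ _ _ (s y)).seed j = z
    cases (s y).seed j <;> cases (t y).seed j <;> simp
  · dsimp only
    generalize (applyCW (S (Fin.init y)).u (S (Fin.init y)).q _ _ _ (s y)).u = z
    cases (s y).u <;> cases (t y).u <;> simp
  · dsimp only
    generalize (applyCW (S (Fin.init y)).u (S (Fin.init y)).q _ _ _ (s y)).q = z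
    cases (s y).q <;> cases (t y).q <;> simp

theorem flip_root (g : Bool) (s t : Bits n) : Flip g (rootVal false s g) (rootVal true t g) := by
  constructor <;> simp [rootVal]

/-- In an honest run the control bits differ at active nodes in the assigned one, and other nodes
have equal values. -/
theorem genLayers_invariant (hA : ∀ i, ValidAssign f A i (assign f A i)) (hne : A.Nonempty)
    (G : Bits n → Bits (2 * (n + 2))) (co : BaseCoins n P) (i : ℕ) (hi : i ≤ P.d) (x : Bits i) :
    (OnPath A i hi x → Flip (assign f A ⟨i, by omega⟩ x) ((genLayers G f A co i hi).1 x)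
      ((genLayers G f A co i hi).2 x)) ∧
    (¬ OnPath A i hi x → (genLayers G f A co i hi).1 x = (genLayers G f A co i hi).2 x) := by
  induction i with
  | zero =>
    obtain ⟨a, ha⟩ := hne
    refine ⟨fun _ => ?_, fun h => absurd ⟨a, ha, Subsingleton.elim _ _⟩ h⟩
    rw [show x = Fin.elim0 from Subsingleton.elim _ _]
    exact flip_root _ _ _
  | succ i ih =>
    specialize ih (Nat.le_of_succ_le hi) (Fin.init x)
    simp only [genLayers, nextLayer_eq, genCW_eq]
    refine ⟨fun hx => flip_correct hA _ hx (ih.1 hx.init), fun hx => ?_⟩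
    by_cases hx' : OnPath A i (Nat.le_of_succ_le hi) (Fin.init x)
    · exact eq_correct_of_off hA _ hx' hx (ih.1 hx')
    · simp only [correct, expand, ih.2 hx']

theorem layer_genPub (G : Bits n → Bits (2 * (n + 2))) (co : BaseCoins n P) (b : Bool) (i : ℕ)
    (hi : i ≤ P.d) :
    layer G f b (if b then co.2.1 else co.1) (genPub G f A co) i hi =
      if b then (genLayers G f A co i hi).2 else (genLayers G f A co i hi).1 := by
  induction i with
  | zero => cases b <;> rfl
  | succ i ih =>
    simp only [layer, ih, genLayers]
    cases b <;> rfl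

theorem validAssign_assign {i : Fin (P.d + 1)} (h : ∃ g, ValidAssign f A i g) :
    ValidAssign f A i (assign f A i) := by
  rw [assign, dif_pos h]
  exact h.choose_spec

/-- Layer 0 has a single node, so every assignment is valid there and the choice is made from the
same set each time. The root bit is thus a constant that a simulator can wire in. -/
theorem assign_zero_eq (f f' : HashFam P) {A A' : Set (Bits P.d)} :
    assign f A 0 = assign f' A' 0 := by
  have h : ∀ (f : HashFam P) (A : Set (Bits P.d)) g, ValidAssign f A 0 g := fun f A g x _ y _ _ =>
    Subsingleton.elim (α := Bits 0) x y
  have e : (fun g => ValidAssign f A 0 g) = fun g => ValidAssign f' A' 0 g := by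
    funext g; exact propext ⟨fun _ => h _ _ _, fun _ => h _ _ _⟩
  unfold assign
  congr! 2

/-- If hashing fails, a single path stays active and cannot collide with itself. The invariants of
the tree therefore hold for all hash functions, which makes acceptance unconditional. -/
theorem active_valid (inp : Input P) (f : HashFam P) (i : Fin (P.d + 1)) :
    ValidAssign f (inp.active f) i (assign f (inp.active f) i) := by
  apply validAssign_assign
  unfold Input.active
  split_ifs with h
  · exact h i
  · refine ⟨fun _ => false, fun x hx y hy _ => ?_⟩
    obtain ⟨a, ha, rfl⟩ := hx
    obtain ⟨a', ha', rfl⟩ := hy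
    rw [Set.mem_singleton_iff.mp ha, Set.mem_singleton_iff.mp ha']

theorem active_nonempty (inp : Input P) (f : HashFam P) : (inp.active f).Nonempty := by
  unfold Input.active
  split_ifs
  · exact ⟨_, ⟨0, P.k_pos⟩, rfl⟩
  · exact ⟨_, rfl⟩

theorem shared_of_not_mem {inp : Input P} {f : HashFam P} {x : Bits P.d} (h : x ∉ inp.active f) :
    inp.shared f x = fun _ => 0 := by
  unfold Input.active at h
  unfold Input.shared
  split_ifs at h ⊢
  · funext j
    unfold Input.fn
    exact Finset.sum_eq_zero fun l _ => if_neg fun hl => h ⟨l, hl⟩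
  · rfl

theorem genFinal_slot (hA : ∀ i, ValidAssign f A i (assign f A i)) (G : Bits n → Bits (2 * (n + 2)))
    (E : Bits n → Fin P.B → P.𝔾) (F : Bits P.d → Fin P.B → P.𝔾) (co : BaseCoins n P)
    {x : Bits P.d} (hx : x ∈ A) :
    genFinal G E f A F co (f (Fin.last P.d) x (assign f A (Fin.last P.d) x)) = fun j =>
      let V := genLayers G f A co P.d le_rfl
      let γ := F x j - E (V.1 x).seed j + E (V.2 x).seed j
      if (if assign f A (Fin.last P.d) x then (V.2 x).q else (V.2 x).u) then -γ else γ := by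
  have h : ∃ x' : Bits P.d, x' ∈ A ∧ f (Fin.last P.d) x' (assign f A (Fin.last P.d) x') =
      f (Fin.last P.d) x (assign f A (Fin.last P.d) x) := ⟨x, hx, rfl⟩
  have hc : h.choose = x := hA (Fin.last P.d) (onPath_last.mpr h.choose_spec.1)
    (onPath_last.mpr hx) h.choose_spec.2
  simp only [genFinal]
  rw [dif_pos h]
  simp only [hc]

/-- The output shares of an honest run add up to the shared function. -/
theorem output_honest (G : Bits n → Bits (2 * (n + 2))) (B : Augmentation n P) (f : HashFam P)
    (inp : Input P) (co : BaseCoins n P) (e : Bits B.L.coin) (h : Bits B.L.chal) :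
    output G B f (honest G B f inp co e h) h = inp.shared f := by
  funext x j
  have hl0 : layer G f false co.1 (genPub G f (inp.active f) co) P.d le_rfl = _ :=
    layer_genPub G co false P.d le_rfl
  have hl1 : layer G f true co.2.1 (genPub G f (inp.active f) co) P.d le_rfl = _ :=
    layer_genPub G co true P.d le_rfl
  simp only [if_true, Bool.false_eq_true, if_false] at hl0 hl1
  have hA := active_valid inp f
  have hinv := genLayers_invariant hA (active_nonempty inp f) G co P.d le_rfl x
  simp only [output, evalShare, honest, if_true, Bool.false_eq_true, if_false, hl0, hl1]
  by_cases hx : x ∈ inp.active f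
  · have hfl : Flip (assign f (inp.active f) (Fin.last P.d) x) _ _ := hinv.1 (onPath_last.mpr hx)
    have hfin := congrFun (genFinal_slot hA G (B.E h) (inp.shared f) co hx) j
    dsimp only at hfin
    obtain ⟨h1, h2⟩ := hfl
    rw [h1, h2]
    rw [h1, h2] at hfin
    cases hgx : assign f (inp.active f) (Fin.last P.d) x <;> rw [hgx] at hfin <;>
      cases hu : ((genLayers G f (inp.active f) co P.d le_rfl).1 x).u <;>
      cases hq : ((genLayers G f (inp.active f) co P.d le_rfl).1 x).q <;>
      simp only [hu, hq, Bool.xor_false, Bool.xor_true, Bool.not_true, Bool.not_false, if_true,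
        Bool.false_eq_true, if_false] at hfin ⊢ <;>
      rw [hfin] <;> abel
  · rw [hinv.2 (mt onPath_last.mp hx), shared_of_not_mem hx]
    exact add_neg_cancel _

end Tree


/-! ### The sparsity proof: field elements and messages -/

section Protocol

/-- The field of the sparsity proof. -/
abbrev Fld (n : ℕ) (P : Params) : Type := GaloisField 2 (n + P.d + 4)

/-- A vector of field elements, read from a bit string. -/
noncomputable def unpack (m : ℕ) [NeZero m] (α : Type) [Fintype α] :
    Bits (Fintype.card (α × Fin m)) ≃ (α → GaloisField 2 m) :=
  ((Equiv.arrowCongr (Fintype.equivFin (α × Fin m)) (Equiv.refl Bool)).symm.trans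
    (Equiv.curry α (Fin m) Bool)).trans (Equiv.arrowCongr (Equiv.refl α) (ofBits m))

theorem unpack_apply {m : ℕ} [NeZero m] {α : Type} [Fintype α]
    (e : Bits (Fintype.card (α × Fin m))) (a : α) :
    unpack m α e a = ofBits m fun j => e (Fintype.equivFin (α × Fin m) (a, j)) := rfl

theorem unpack_symm_apply {m : ℕ} [NeZero m] {α : Type} [Fintype α]
    (v : α → GaloisField 2 m) (i : Fin (Fintype.card (α × Fin m))) :
    (unpack m α).symm v i = toBits m (v ((Fintype.equivFin (α × Fin m)).symm i).1)
      ((Fintype.equivFin (α × Fin m)).symm i).2 := rfl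

variable {n : ℕ} {P : Params}

/-- A node value as a field element. -/
noncomputable def nodeF (P : Params) (v : NodeVal n) : Fld n P := ofBits (n + P.d + 4) fun j =>
  if h : (j : ℕ) < n then v.seed ⟨j, h⟩ else if (j : ℕ) = n then v.u
    else if (j : ℕ) = n + 1 then v.q else false

/-- A block position as a field element. -/
noncomputable def posF (n : ℕ) (x : Bits P.d) : Fld n P := ofBits (n + P.d + 4) fun j =>
  if h : (j : ℕ) < P.d then x ⟨j, h⟩ else false

/-- The challenge as a field element that is not a block position. -/
noncomputable def chalF (h : Bits (n + P.d + 4)) : Fld n P := ofBits (n + P.d + 4) fun j =>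
  if (j : ℕ) = P.d then true else h j

/-- The n + 2 bits of a node fit into the n + d + 4 coordinates. Equality of codes therefore means
equality of leaves, where output shares cancel. -/
theorem nodeF_injective : Function.Injective (nodeF (n := n) P) := by
  intro v w h
  have h := congrFun ((ofBits _).injective h)
  refine NodeVal.ext' (fun j => ?_) ?_ ?_
  · simpa using h ⟨j, by omega⟩
  · simpa using h ⟨n, by omega⟩
  · simpa using h ⟨n + 1, by omega⟩

theorem posF_injective : Function.Injective (posF (P := P) n) := by
  intro v w h
  have h := congrFun ((ofBits _).injective h)
  funext j
  simpa using h ⟨j, by omega⟩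

/-- Coordinate `P.d` is set in every challenge and clear in every position. Hence no denominator of
the sparsity proof vanishes. -/
theorem chalF_ne_posF (h : Bits (n + P.d + 4)) (x : Bits P.d) : chalF h ≠ posF n x := by
  intro he
  have := congrFun ((ofBits _).injective he) ⟨P.d, by omega⟩
  simp at this

theorem chalF_add_posF_ne (h : Bits (n + P.d + 4)) (x : Bits P.d) :
    chalF h + posF n x ≠ 0 := by
  rw [Ne, CharTwo.add_eq_zero]
  exact chalF_ne_posF h x

/-- The lengths of the messages. -/
noncomputable abbrev lens (n : ℕ) (P : Params) : Lens where
  -- For each l: pads for position, difference and quotient at 0, 1 and 6, and the servers' shares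
  -- of the two masks at 2 to 5. The index `none` pads the share of the inner product of the masks.
  coin := Fintype.card (Option (Fin 7 × Fin P.k) × Fin (n + P.d + 4))
  chal := n + P.d + 4
  rho := Fintype.card (Option (Fin P.k) × Fin (n + P.d + 4))
  ext1 := Fintype.card (Option (Fin 4 × Fin P.k) × Fin (n + P.d + 4))
  ext2 := Fintype.card (Fin P.k × Fin (n + P.d + 4))
  rounds := 2
  msg := Fintype.card ((Fin P.k × Bool) × Fin (n + P.d + 4))

/-- The first extra message: shares of positions and differences of node values, two masks, and a
share of the inner product of the masks. -/
noncomputable def share1 (lam del : Fin P.k → Fld n P) (e : Option (Fin 7 × Fin P.k) → Fld n P)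
    (b : Bool) : Option (Fin 4 × Fin P.k) → Fld n P
  | none => e none + if b then ∑ l, (e (some (2, l)) + e (some (3, l))) *
      (e (some (4, l)) + e (some (5, l))) else 0
  | some (i, l) => ![e (some (0, l)) + (if b then lam l else 0),
      e (some (1, l)) + (if b then del l else 0),
      if b then e (some (3, l)) else e (some (2, l)),
      if b then e (some (5, l)) else e (some (4, l))] i

/-- The second extra message: shares of the quotients. -/
noncomputable def share2 (lam del : Fin P.k → Fld n P) (h : Fld n P)
    (e : Option (Fin 7 × Fin P.k) → Fld n P) (b : Bool) (l : Fin P.k) : Fld n P :=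
  e (some (6, l)) + if b then del l * (h + lam l)⁻¹ else 0

/-- The first message of a server: masked shares. -/
noncomputable def opening (ρ : Option (Fin P.k) → Fld n P) (x : Option (Fin 4 × Fin P.k) → Fld n P)
    (y : Fin P.k → Fld n P) : Fin P.k × Bool → Fld n P := fun t =>
  if t.2 then x (some (0, t.1)) + x (some (3, t.1)) else ρ (some t.1) * y t.1 + x (some (2, t.1))

/-- The second message of a server: its share of the check value. -/
noncomputable def check (b : Bool) (h : Fld n P) (ρ : Option (Fin P.k) → Fld n P)
    (x : Option (Fin 4 × Fin P.k) → Fld n P) (y : Fin P.k → Fld n P)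
    (o : Fin P.k × Bool → Fld n P) (s : Fld n P) : Fld n P :=
  (∑ l, (ρ (some l) * (h * y l + x (some (1, l))) +
    (o (l, false) * x (some (3, l)) + o (l, true) * x (some (2, l))) +
    if b then o (l, false) * o (l, true) else 0)) + x none + ρ none * (s + ∑ l, y l)

/-- The sum over all leaves of the node values, divided by the distance of the challenge to the
position. -/
noncomputable def leafSum (h : Fld n P) (V : Bits P.d → NodeVal n) : Fld n P :=
  ∑ x, nodeF P (V x) * (h + posF n x)⁻¹

/-- Multiplication of shared values with dealt masks a, b. The openings are u = ρy + a and v = λ +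
b, and in characteristic two ρyλ = uv + ub + va + ab. The terms ub + va are linear in the shares,
one server adds uv, and the client supplied shares of Σ ab. A wrong supply leaves the last bracket
non-zero, but that bracket does not involve ρ. -/
theorem check_add_check (h : Fld n P) (ρ : Option (Fin P.k) → Fld n P)
    (x : Bool → Option (Fin 4 × Fin P.k) → Fld n P) (y : Bool → Fin P.k → Fld n P)
    (s : Bool → Fld n P) :
    check false h ρ (x false) (y false)
        (fun t => opening ρ (x false) (y false) t + opening ρ (x true) (y true) t) (s false) +
      check true h ρ (x true) (y true)
        (fun t => opening ρ (x true) (y true) t + opening ρ (x false) (y false) t) (s true) =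
    (∑ l, ρ (some l) * ((y false l + y true l) * (h + (x false (some (0, l)) + x true (some (0, l)))) +
      (x false (some (1, l)) + x true (some (1, l))))) +
    ρ none * ((s false + s true) + ∑ l, (y false l + y true l)) +
    (x false none + x true none + ∑ l, (x false (some (2, l)) + x true (some (2, l))) *
      (x false (some (3, l)) + x true (some (3, l)))) := by
  have key : ∀ l, (ρ (some l) * (h * y false l + x false (some (1, l))) +
      ((opening ρ (x false) (y false) (l, false) + opening ρ (x true) (y true) (l, false)) *
        x false (some (3, l)) +
      (opening ρ (x false) (y false) (l, true) + opening ρ (x true) (y true) (l, true)) *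
        x false (some (2, l)))) +
      (ρ (some l) * (h * y true l + x true (some (1, l))) +
      ((opening ρ (x true) (y true) (l, false) + opening ρ (x false) (y false) (l, false)) *
        x true (some (3, l)) +
      (opening ρ (x true) (y true) (l, true) + opening ρ (x false) (y false) (l, true)) *
        x true (some (2, l))) +
      (opening ρ (x true) (y true) (l, false) + opening ρ (x false) (y false) (l, false)) *
      (opening ρ (x true) (y true) (l, true) + opening ρ (x false) (y false) (l, true))) =
      ρ (some l) * ((y false l + y true l) * (h + (x false (some (0, l)) + x true (some (0, l)))) +
      (x false (some (1, l)) + x true (some (1, l)))) +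
      (x false (some (2, l)) + x true (some (2, l))) *
      (x false (some (3, l)) + x true (some (3, l))) := by
    intro l
    have h2 : (2 : Fld n P) = 0 := CharTwo.two_eq_zero
    simp only [opening, Bool.false_eq_true, if_false, if_true]
    -- The two sides agree only modulo 2; the coefficient of `h2` collects the terms that occur
    -- twice.
    linear_combination ((x false (some (3, l)) + x true (some (3, l))) *
      (ρ (some l) * y false l + ρ (some l) * y true l +
        x false (some (2, l)) + x true (some (2, l))) +
      (x false (some (2, l)) + x true (some (2, l))) * (x false (some (0, l)) + x true (some (0, l)))) * h2
  have sum_key : ∀ A B C D : Fin P.k → Fld n P, (∀ l, A l + B l = C l + D l) →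
      ∑ l, A l + ∑ l, B l = ∑ l, C l + ∑ l, D l := fun A B C D h => by
    rw [← Finset.sum_add_distrib, ← Finset.sum_add_distrib]
    exact Finset.sum_congr rfl fun l _ => h l
  have hs := sum_key _ _ _ _ key
  have hy : ∑ l, (y false l + y true l) = ∑ l, y false l + ∑ l, y true l := Finset.sum_add_distrib
  simp only [check, Bool.false_eq_true, if_false, if_true, add_zero, hy]
  linear_combination hs

/-- The value of server `b` at the leaf `α l` that the client uses in the proof. -/
noncomputable def leafVal (G : Bits n → Bits (2 * (n + 2))) (f : HashFam P) (inp : Input P)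
    (co : BaseCoins n P) (b : Bool) (l : Fin P.k) : NodeVal n :=
  open Classical in
  let V := genLayers G f (inp.active f) co P.d le_rfl
  if inp.α l ∈ inp.active f then (if b then V.2 else V.1) (inp.α l)
  else ⟨fun _ => false, false, false⟩

/-- The difference of the values of the two servers at the leaf `α l`. -/
noncomputable def leafDiff (G : Bits n → Bits (2 * (n + 2))) (f : HashFam P) (inp : Input P)
    (co : BaseCoins n P) (l : Fin P.k) : Fld n P :=
  nodeF P (leafVal G f inp co false l) + nodeF P (leafVal G f inp co true l)

/-- The messages that server `b` sends in the two exchanges, when it has received `recv`. -/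
noncomputable def serverOpening (M : Msgs n P (lens n P)) (ρ : Bits (lens n P).rho) (b : Bool) :
    Fin P.k × Bool → Fld n P :=
  opening (unpack _ _ ρ) (unpack _ _ (M.ext1 b)) (unpack _ _ (M.ext2 b))

noncomputable def serverCheck (G : Bits n → Bits (2 * (n + 2))) (f : HashFam P)
    (M : Msgs n P (lens n P)) (h : Bits (lens n P).chal) (ρ : Bits (lens n P).rho) (b : Bool)
    (recv : Fin (lens n P).rounds → Bits (lens n P).msg) : Fld n P :=
  check b (chalF h) (unpack _ _ ρ) (unpack _ _ (M.ext1 b)) (unpack _ _ (M.ext2 b))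
    (fun t => serverOpening M ρ b t + unpack _ _ (recv (0 : Fin 2)) t)
    (leafSum (chalF h) (layer G f b (M.seed b) M.pub P.d le_rfl))

/-- Circuits for the messages and the decisions of the proof. -/
structure ProofCircuits (n : ℕ) (P : Params) (G : Bits n → Bits (2 * (n + 2))) : Type where
  client1 : Circuit (ClientIx n P (lens n P).coin 0) (Bool × Fin (lens n P).ext1)
  client2 : Circuit (ClientIx n P (lens n P).coin (lens n P).chal) (Bool × Fin (lens n P).ext2)
  msg0 : Bool → Circuit (ViewIx n P (lens n P)) (Fin (lens n P).msg)
  msg1 : Bool → Circuit (ViewIx n P (lens n P)) (Fin (lens n P).msg)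
  accept : Bool → Circuit (ViewIx n P (lens n P)) Unit
  client1_eval : ∀ f inp co e b, (fun j => client1.eval (clientIn G f inp co e Fin.elim0) (b, j)) =
    (unpack _ _).symm (share1 (fun l => posF n (inp.α l)) (leafDiff G f inp co) (unpack _ _ e) b)
  client2_eval : ∀ f inp co e h b, (fun j => client2.eval (clientIn G f inp co e h) (b, j)) =
    (unpack _ _).symm (share2 (fun l => posF n (inp.α l)) (leafDiff G f inp co) (chalF h)
      (unpack _ _ e) b)
  msg0_eval : ∀ f M h ρ b recv, (msg0 b).eval (view f M h ρ b recv) =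
    (unpack _ _).symm (serverOpening M ρ b)
  msg1_eval : ∀ f M h ρ b recv, (msg1 b).eval (view f M h ρ b recv) =
    (unpack _ (Fin P.k × Bool)).symm fun _ => serverCheck G f M h ρ b recv
  accept_eval : ∀ f M h ρ b recv, (accept b).eval (view f M h ρ b recv) () = true ↔
    recv (1 : Fin 2) = (unpack _ (Fin P.k × Bool)).symm fun _ => serverCheck G f M h ρ b recv

/-- The augmentation of the scheme by the sparsity proof. -/
noncomputable abbrev ProofCircuits.augmentation {G : Bits n → Bits (2 * (n + 2))}
    (Q : ProofCircuits n P G) (G' : Bits n → Fin P.B → P.𝔾) : Augmentation n P where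
  L := lens n P
  E := fun _ => G'
  overhead := 0
  client1 := Q.client1
  client2 := Q.client2
  msg := fun b r => if (r : ℕ) = 0 then Q.msg0 b else Q.msg1 b
  accept := Q.accept

variable {G : Bits n → Bits (2 * (n + 2))} (Q : ProofCircuits n P G) (G' : Bits n → Fin P.B → P.𝔾)

/-- The check value of server `b` after both servers sent their openings. -/
noncomputable def checkValue (G : Bits n → Bits (2 * (n + 2))) (f : HashFam P)
    (M : Msgs n P (lens n P)) (h : Bits (lens n P).chal) (ρ : Bits (lens n P).rho) (b : Bool) :
    Fld n P :=
  check b (chalF h) (unpack _ _ ρ) (unpack _ _ (M.ext1 b)) (unpack _ _ (M.ext2 b))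
    (fun t => serverOpening M ρ b t + serverOpening M ρ (!b) t)
    (leafSum (chalF h) (layer G f b (M.seed b) M.pub P.d le_rfl))

theorem transcript_one (f : HashFam P) (M : Msgs n P (lens n P)) (h : Bits (lens n P).chal)
    (ρ : Bits (lens n P).rho) (b : Bool) :
    transcript (Q.augmentation G') f M h ρ 1 b (0 : Fin 2) =
      (unpack _ _).symm (serverOpening M ρ b) := by
  rw [← Q.msg0_eval f M h ρ b (transcript (Q.augmentation G') f M h ρ 0 (!b))]
  rfl

theorem transcript_two (f : HashFam P) (M : Msgs n P (lens n P)) (h : Bits (lens n P).chal)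
    (ρ : Bits (lens n P).rho) (b : Bool) (r : Fin 2) :
    transcript (Q.augmentation G') f M h ρ 2 b r =
      if r = 0 then (unpack _ _).symm (serverOpening M ρ b)
      else (unpack _ (Fin P.k × Bool)).symm fun _ => checkValue G f M h ρ b := by
  match r with
  | 0 => exact transcript_one Q G' f M h ρ b
  | 1 =>
    have h1 := Q.msg1_eval f M h ρ b (transcript (Q.augmentation G') f M h ρ 1 (!b))
    have h2 : serverCheck G f M h ρ b (transcript (Q.augmentation G') f M h ρ 1 (!b)) =
        checkValue G f M h ρ b := by
      unfold serverCheck checkValue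
      have := transcript_one Q G' f M h ρ (!b)
      simp only [this, Equiv.apply_symm_apply]
    rw [h2] at h1
    exact h1

/-- A server accepts if the check value it received equals its own; in characteristic two this says
that the shares of the check value add up to zero. After the openings are exchanged both servers
work with the same opened values. -/
theorem accepts_iff (f : HashFam P) (M : Msgs n P (lens n P)) (h : Bits (lens n P).chal)
    (ρ : Bits (lens n P).rho) :
    Accepts (Q.augmentation G') f M h ρ ↔
      checkValue G f M h ρ false + checkValue G f M h ρ true = 0 := by
  have hb : ∀ b, ((Q.augmentation G').accept b).eval (finalView (Q.augmentation G') f M h ρ b) () =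
      true ↔ checkValue G f M h ρ (!b) = checkValue G f M h ρ b := by
    intro b
    refine (Q.accept_eval f M h ρ b (transcript (Q.augmentation G') f M h ρ 2 (!b))).trans ?_
    have h0 := transcript_two Q G' f M h ρ (!b) 0
    have h1 := transcript_two Q G' f M h ρ (!b) 1
    rw [if_pos rfl] at h0
    rw [if_neg (by decide)] at h1
    have h2 : serverCheck G f M h ρ b (transcript (Q.augmentation G') f M h ρ 2 (!b)) =
        checkValue G f M h ρ b := by
      unfold serverCheck checkValue
      simp only [h0, Equiv.apply_symm_apply]
    rw [h2, h1]
    refine (unpack _ (Fin P.k × Bool)).symm.injective.eq_iff.trans ?_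
    constructor
    · intro he; exact congrFun he (⟨0, P.k_pos⟩, false)
    · intro he; rw [he]
  unfold Accepts
  rw [CharTwo.add_eq_zero]
  constructor
  · intro hh; exact (hb true).mp (hh true)
  · intro he b
    rw [hb b]
    cases b
    · exact he.symm
    · exact he

theorem checkValue_add (f : HashFam P) (M : Msgs n P (lens n P)) (h : Bits (lens n P).chal)
    (ρ : Bits (lens n P).rho) :
    checkValue G f M h ρ false + checkValue G f M h ρ true =
    (∑ l, unpack _ _ ρ (some l) *
      ((unpack _ _ (M.ext2 false) l + unpack _ _ (M.ext2 true) l) *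
        (chalF h + (unpack _ _ (M.ext1 false) (some (0, l)) + unpack _ _ (M.ext1 true) (some (0, l)))) +
      (unpack _ _ (M.ext1 false) (some (1, l)) + unpack _ _ (M.ext1 true) (some (1, l))))) +
    unpack _ _ ρ none * ((leafSum (chalF h) (layer G f false (M.seed false) M.pub P.d le_rfl) +
        leafSum (chalF h) (layer G f true (M.seed true) M.pub P.d le_rfl)) +
      ∑ l, (unpack _ _ (M.ext2 false) l + unpack _ _ (M.ext2 true) l)) +
    (unpack _ _ (M.ext1 false) none + unpack _ _ (M.ext1 true) none +
      ∑ l, (unpack _ _ (M.ext1 false) (some (2, l)) + unpack _ _ (M.ext1 true) (some (2, l))) *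
      (unpack _ _ (M.ext1 false) (some (3, l)) + unpack _ _ (M.ext1 true) (some (3, l)))) :=
  check_add_check (chalF h) (unpack _ _ ρ) (fun b => unpack _ _ (M.ext1 b))
    (fun b => unpack _ _ (M.ext2 b))
    (fun b => leafSum (chalF h) (layer G f b (M.seed b) M.pub P.d le_rfl))

/-! ### Completeness -/

theorem leafSum_add (h : Fld n P) (V W : Bits P.d → NodeVal n) :
    leafSum h V + leafSum h W = ∑ x, (nodeF P (V x) + nodeF P (W x)) * (h + posF n x)⁻¹ := by
  simp only [leafSum, ← Finset.sum_add_distrib, add_mul]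

/-- Leaves off the active set carry equal values and drop out. A position made inactive by a hashing
failure also contributes zero on the right, because the client's input is blank there. -/
theorem leafSum_genLayers (f : HashFam P) (inp : Input P) (co : BaseCoins n P) (h : Fld n P) :
    leafSum h (genLayers G f (inp.active f) co P.d le_rfl).1 +
      leafSum h (genLayers G f (inp.active f) co P.d le_rfl).2 =
    ∑ l, leafDiff G f inp co l * (h + posF n (inp.α l))⁻¹ := by
  classical
  rw [leafSum_add]
  have hinv := genLayers_invariant (active_valid inp f) (active_nonempty inp f) G co P.d le_rfl
  have hoff : ∀ x, x ∉ inp.active f → nodeF P ((genLayers G f (inp.active f) co P.d le_rfl).1 x) +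
      nodeF P ((genLayers G f (inp.active f) co P.d le_rfl).2 x) = 0 := by
    intro x hx
    rw [(hinv x).2 (mt onPath_last.mp hx), CharTwo.add_self_eq_zero]
  have hdiff : ∀ l, leafDiff G f inp co l =
      nodeF P ((genLayers G f (inp.active f) co P.d le_rfl).1 (inp.α l)) +
      nodeF P ((genLayers G f (inp.active f) co P.d le_rfl).2 (inp.α l)) := by
    intro l
    by_cases hl : inp.α l ∈ inp.active f
    · simp [leafDiff, leafVal, hl]
    · rw [hoff _ hl]
      simp [leafDiff, leafVal, hl, CharTwo.add_self_eq_zero]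
  have hsub : inp.active f ⊆ Set.range inp.α := by
    unfold Input.active
    split_ifs
    · exact le_rfl
    · rintro _ rfl; exact ⟨_, rfl⟩
  simp only [hdiff]
  rw [← Finset.sum_image (s := Finset.univ) (g := inp.α) (f := fun x =>
    (nodeF P ((genLayers G f (inp.active f) co P.d le_rfl).1 x) +
      nodeF P ((genLayers G f (inp.active f) co P.d le_rfl).2 x)) * (h + posF n x)⁻¹)
      inp.α_inj.injOn]
  refine (Finset.sum_subset (Finset.subset_univ _) fun x _ hx => ?_).symm
  rw [hoff x, zero_mul]
  intro hxa
  obtain ⟨l, rfl⟩ := hsub hxa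
  exact hx (by simp)

/-- The three brackets of `checkValue_add` vanish separately: quotients times denominators, the sum
over the leaves, and the inner product of the masks. -/
theorem complete_augmentation : Complete G (Q.augmentation G') := by
  rintro inp ⟨f, co, e, h, ρ⟩
  dsimp only
  set M : Msgs n P (lens n P) := honest G (Q.augmentation G') f inp co e h with hM
  refine (accepts_iff Q G' f M h ρ).mpr ?_
  have h1 : ∀ b, M.ext1 b = (unpack _ _).symm (share1 (fun l => posF n (inp.α l))
      (leafDiff G f inp co) (unpack _ _ e) b) := fun b => Q.client1_eval f inp co e b
  have h2 : ∀ b, M.ext2 b = (unpack _ _).symm (share2 (fun l => posF n (inp.α l))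
      (leafDiff G f inp co) (chalF h) (unpack _ _ e) b) := fun b => Q.client2_eval f inp co e h b
  have h3 : layer G f false (M.seed false) M.pub P.d le_rfl = _ := layer_genPub G co false P.d le_rfl
  have h4 : layer G f true (M.seed true) M.pub P.d le_rfl = _ := layer_genPub G co true P.d le_rfl
  rw [checkValue_add]
  simp only [h1, h2, h3, h4, Equiv.apply_symm_apply, share1, share2, if_true, Bool.false_eq_true,
    if_false, add_zero, leafSum_genLayers, Matrix.cons_val]
  have two : ∀ a b : Fld n P, a + (a + b) = b := fun a b => by
    rw [← add_assoc, CharTwo.add_self_eq_zero, zero_add]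
  simp only [two]
  rw [CharTwo.add_self_eq_zero, CharTwo.add_self_eq_zero, mul_zero, add_zero, add_zero]
  refine Finset.sum_eq_zero fun l _ => ?_
  rw [inv_mul_cancel_right₀ (chalF_add_posF_ne h _), CharTwo.add_self_eq_zero, mul_zero]

end Protocol


/-! ### Correctness and soundness -/

section Soundness

open Polynomial in
/-- If `∑ Δ x / (h - p x) = ∑ δ l / (h - q l)` for many `h`, then `Δ` vanishes at the positions that
are not among the `q l`. -/
theorem exists_locator_polynomial {K ι κ : Type} [Field K] [Fintype ι] [DecidableEq ι] [Fintype κ]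
    [DecidableEq κ] {p : ι → K} (hp : Function.Injective p) (Δ : ι → K) (q δ : κ → K) :
    ∃ R : K[X], R.natDegree ≤ Fintype.card ι + Fintype.card κ ∧
      (R = 0 → ∀ x, Δ x ≠ 0 → ∃ l, p x = q l) ∧
      ∀ (h : K) (y : κ → K), (∀ x, h ≠ p x) → (∀ l, y l * (h - q l) = δ l) →
        ∑ x, Δ x * (h - p x)⁻¹ = ∑ l, y l → R.eval h = 0 := by
  -- The difference of the two sides multiplied by ∏(X − p x)·∏(X − q l). Factors are removed by
  -- index, so the `q l` may repeat.
  refine ⟨(∑ x, C (Δ x) * (∏ z ∈ Finset.univ.erase x, (X - C (p z))) * ∏ l, (X - C (q l))) -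
    ∑ l, C (δ l) * (∏ l' ∈ Finset.univ.erase l, (X - C (q l'))) * ∏ x, (X - C (p x)), ?_, ?_, ?_⟩
  · have hprod : ∀ {η : Type} (s : Finset η) (u : η → K),
        (∏ z ∈ s, (X - C (u z))).natDegree ≤ s.card := fun s u => by
      refine (natDegree_prod_le _ _).trans ?_
      simp
    refine (natDegree_sub_le _ _).trans (max_le ?_ ?_)
    · refine natDegree_sum_le_of_forall_le _ _ fun x _ => ?_
      refine natDegree_mul_le.trans (add_le_add ((natDegree_C_mul_le _ _).trans ?_) (hprod _ _))
      exact (hprod _ _).trans ((Finset.card_erase_le).trans le_rfl)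
    · refine natDegree_sum_le_of_forall_le _ _ fun l _ => ?_
      rw [add_comm (Fintype.card ι)]
      refine natDegree_mul_le.trans (add_le_add ((natDegree_C_mul_le _ _).trans ?_) (hprod _ _))
      exact (hprod _ _).trans ((Finset.card_erase_le).trans le_rfl)
  · intro hR x hx
    -- At X = p x only the x-th term of the first sum lacks the factor X − p x. What survives is Δ x
    -- times a product that can vanish only if some `q l` equals p x.
    have h := congrArg (eval (p x)) hR
    simp only [eval_sub, eval_finsetSum, eval_mul, eval_C, eval_prod, eval_X, eval_zero] at h
    have hz : ∏ z, (p x - p z) = 0 := Finset.prod_eq_zero (Finset.mem_univ x) (sub_self _)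
    rw [Finset.sum_eq_single x, hz] at h
    · simp only [mul_zero, Finset.sum_const_zero, sub_zero, mul_eq_zero, hx, false_or] at h
      rcases h with h | h
      · obtain ⟨z, hz, hzz⟩ := Finset.prod_eq_zero_iff.mp h
        exact absurd (hp (sub_eq_zero.mp hzz)).symm (Finset.ne_of_mem_erase hz)
      · obtain ⟨l, -, hl⟩ := Finset.prod_eq_zero_iff.mp h
        exact ⟨l, sub_eq_zero.mp hl⟩
    · intro z _ hzx
      rw [Finset.prod_eq_zero (Finset.mem_erase.mpr ⟨hzx.symm, Finset.mem_univ x⟩) (sub_self _)]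
      simp
    · simp
  · intro h y hh hy hsum
    simp only [eval_sub, eval_finsetSum, eval_mul, eval_C, eval_prod, eval_X]
    have h1 : ∀ x, Δ x * ∏ z ∈ Finset.univ.erase x, (h - p z) =
        Δ x * (h - p x)⁻¹ * ∏ z, (h - p z) := fun x => by
      rw [← Finset.mul_prod_erase _ _ (Finset.mem_univ x), ← mul_assoc, mul_assoc (Δ x),
        inv_mul_cancel₀ (sub_ne_zero.mpr (hh x)), mul_one]
    have h2 : ∀ l, δ l * ∏ l' ∈ Finset.univ.erase l, (h - q l') = y l * ∏ l', (h - q l') := fun l => by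
      rw [← Finset.mul_prod_erase _ _ (Finset.mem_univ l), ← mul_assoc, hy]
    simp only [h1, h2, ← Finset.sum_mul, hsum]
    ring

/-- An `Input` needs exactly k distinct positions, so a smaller support is filled up with positions
carrying zero blocks; there is room because k ≤ 2^d. -/
theorem isBlockSparse_of_support {P : Params} {F : Bits P.d → Fin P.B → P.𝔾}
    (T : Finset (Bits P.d)) (hT : T.card ≤ P.k) (h : ∀ x, x ∉ T → F x = fun _ => 0) :
    IsBlockSparse P F := by
  classical
  obtain ⟨T', hTT', hc⟩ := Finset.exists_superset_card_eq hT (by simpa using P.k_le)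
  let e := (T'.equivFinOfCardEq hc).symm
  refine ⟨⟨fun l => e l, fun a b hab => e.injective (Subtype.ext hab), fun l => F (e l)⟩, ?_⟩
  funext x j
  simp only [Input.fn]
  by_cases hx : x ∈ T'
  · rw [Finset.sum_eq_single (e.symm ⟨x, hx⟩)]
    · simp
    · intro l _ hl
      rw [if_neg]
      rintro rfl
      exact hl (by simp)
    · simp
  · rw [h x fun hxT => hx (hTT' hxT), Finset.sum_eq_zero]
    intro l _
    rw [if_neg]
    rintro rfl
    exact hx (e l).2

variable {n : ℕ} {P : Params}

open Polynomial in
-- The factor 2 arises because `chalF` overwrites one bit, so each field element comes from at most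
-- two challenges.
theorem prob_chalF_root_le (R : (Fld n P)[X]) (hR : R ≠ 0) :
    prob (fun h : Bits (n + P.d + 4) => R.eval (chalF h) = 0) ≤
      2 * R.natDegree / 2 ^ (n + P.d + 4) := by
  classical
  unfold prob
  have hc : Fintype.card (Bits (n + P.d + 4)) = 2 ^ (n + P.d + 4) := by simp
  rw [hc]
  push_cast
  gcongr
  have : (Finset.univ.filter fun h : Bits (n + P.d + 4) => R.eval (chalF h) = 0).card ≤
      (R.roots.toFinset ×ˢ (Finset.univ : Finset Bool)).card := by
    refine Finset.card_le_card_of_injOn (fun h => (chalF h, h ⟨P.d, by omega⟩)) ?_ ?_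
    · intro h hh
      simpa [hR] using hh
    · intro h _ h' _ he
      simp only [Prod.mk.injEq] at he
      have e1 := congrFun ((ofBits _).injective he.1)
      funext j
      by_cases hj : (j : ℕ) = P.d
      · rw [show j = ⟨P.d, by omega⟩ from Fin.ext hj]; exact he.2
      · simpa [hj] using e1 j
  rw [Finset.card_product, Finset.card_univ, Fintype.card_bool] at this
  have h2 := (Multiset.toFinset_card_le R.roots).trans (R.card_roots')
  refine le_trans (Nat.cast_le.mpr this) ?_
  push_cast
  have : (R.roots.toFinset.card : ℝ) ≤ R.natDegree := by exact_mod_cast h2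
  linarith

/-- With all other coordinates fixed, at most one value of the coordinate a solves the equation. -/
theorem prob_linear_form_le {m : ℕ} [NeZero m] {α : Type} [Fintype α] (c : α → GaloisField 2 m)
    (e : GaloisField 2 m) (a : α) (ha : c a ≠ 0) :
    prob (fun ρ : Bits (Fintype.card (α × Fin m)) => ∑ i, unpack m α ρ i * c i + e = 0) ≤
      1 / 2 ^ m := by
  classical
  let _ : Fintype (GaloisField 2 m) := Fintype.ofFinite _
  have hc : Fintype.card (GaloisField 2 m) = 2 ^ m := by
    rw [Fintype.card_eq_nat_card, GaloisField.card 2 m (NeZero.ne m)]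
  rw [prob_equiv (unpack m α) (fun ρ => ∑ i, ρ i * c i + e = 0)]
  rw [← prob_equiv ((Equiv.funSplitAt a (GaloisField 2 m)).trans (Equiv.prodComm _ _)).symm]
  refine prob_prod_le (by positivity) fun r => ?_
  have hc' : (Fintype.card (GaloisField 2 m) : ℝ) = 2 ^ m := by rw [hc]; norm_num
  unfold prob
  rw [hc']
  gcongr
  refine Nat.cast_le_one.mpr (Finset.card_le_one.mpr fun z hz z' hz' => ?_)
  simp only [Finset.mem_filter, Finset.mem_univ, true_and] at hz hz'
  have key : ∀ z : GaloisField 2 m,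
      ∑ i, ((Equiv.funSplitAt a (GaloisField 2 m)).trans (Equiv.prodComm _ _)).symm (r, z) i * c i =
      z * c a + ∑ i ∈ Finset.univ.erase a, (if h : i = a then 0 else r ⟨i, h⟩) * c i := by
    intro z
    rw [← Finset.add_sum_erase _ _ (Finset.mem_univ a)]
    congr 1
    · simp [Equiv.funSplitAt]
    · refine Finset.sum_congr rfl fun i hi => ?_
      have hia := Finset.ne_of_mem_erase hi
      simp [Equiv.funSplitAt, hia]
  rw [key] at hz hz'
  have : z * c a = z' * c a := by linear_combination hz - hz'
  exact mul_right_cancel₀ ha this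

variable {G : Bits n → Bits (2 * (n + 2))} (Q : ProofCircuits n P G) (G' : Bits n → Fin P.B → P.𝔾)

instance : Nonempty (BaseCoins n P) :=
  ⟨(fun _ => false, fun _ => false, fun _ _ => (fun _ => false, fun _ => false, fun _ => false),
    fun _ _ => 0)⟩

instance : Nonempty (HashFam P) := ⟨fun _ _ _ => ⟨0, by have := P.k_pos; omega⟩⟩

theorem correct_augmentation {γ : ℝ}
    (hγ : ∀ inp : Input P, prob (fun f : HashFam P => ¬ CuckooOK f (Set.range inp.α)) ≤ γ) :
    Correct G (Q.augmentation G') γ := by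
  intro inp
  have h1 : prob (fun ω : RunCoins (Q.augmentation G') => CuckooOK ω.1 (Set.range inp.α)) =
      prob (fun f : HashFam P => CuckooOK f (Set.range inp.α)) :=
    prob_fst (Ω' := BaseCoins n P × Bits (lens n P).coin × Bits (lens n P).chal × Bits (lens n P).rho)
      (fun f : HashFam P => CuckooOK f (Set.range inp.α))
  have h2 := prob_not (fun f : HashFam P => CuckooOK f (Set.range inp.α))
  have h3 := hγ inp
  refine le_trans (b := prob (fun ω : RunCoins (Q.augmentation G') =>
    CuckooOK ω.1 (Set.range inp.α))) (by rw [h1]; linarith) (prob_mono fun ω hω => ?_)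
  rw [output_honest]
  unfold Input.shared
  rw [if_pos hω]

/-- A cheating client needs one of two accidents: the challenge is a root of a non-zero polynomial
fixed before it, or the random combination of the checks vanishes although some check fails. -/
theorem sound_augmentation : Sound G (Q.augmentation G') (1 / 2 ^ n) := by
  classical
  intro f seed pub ext1 final ext2
  set V : Bool → Bits P.d → NodeVal n := fun b => layer G f b (seed b) pub P.d le_rfl with hV
  set Δ : Bits P.d → Fld n P := fun x => nodeF P (V false x) + nodeF P (V true x) with hΔ
  -- Equal leaves use the same generator output and the same last correction words with opposite
  -- signs. The choice of `final` after the challenge therefore gains nothing here.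
  have hout : ∀ h x, Δ x = 0 → output G (Q.augmentation G') f
      ⟨seed, pub, ext1, final h, ext2 h⟩ h x = fun _ => 0 := by
    intro h x hx
    have hVx : V false x = V true x := nodeF_injective (CharTwo.add_eq_zero.mp hx)
    simp only [hV] at hVx
    funext j
    simp only [output, evalShare, hVx, Bool.false_eq_true, if_false, if_true]
    exact add_neg_cancel _
  set x1 : Bool → Option (Fin 4 × Fin P.k) → Fld n P := fun b => unpack _ _ (ext1 b)
  -- `R` depends only on the seeds, the inner correction words and `ext1`, all sent before the
  -- challenge.
  obtain ⟨R, hdeg, hR0, hR⟩ := exists_locator_polynomial (posF_injective (n := n) (P := P)) Δ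
    (fun l => x1 false (some (0, l)) + x1 true (some (0, l)))
    (fun l => x1 false (some (1, l)) + x1 true (some (1, l)))
  by_cases hRz : R = 0
  · rw [prob_eq_zero]
    · positivity
    · rintro ⟨h, ρ⟩ ⟨-, hns⟩
      refine hns (isBlockSparse_of_support (Finset.univ.filter fun x => Δ x ≠ 0) ?_ ?_)
      · have : Nonempty (Fin P.k) := ⟨⟨0, P.k_pos⟩⟩
        -- Distinct leaves have distinct codes, so they are matched with distinct indices l; hence
        -- at most k leaves differ.
        choose! l hl using hR0 hRz
        calc _ ≤ (Finset.univ : Finset (Fin P.k)).card := by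
              refine Finset.card_le_card_of_injOn l (fun _ _ => Finset.mem_univ _) ?_
              intro x hx y hy hxy
              have hx' : Δ x ≠ 0 := by simpa using hx
              have hy' : Δ y ≠ 0 := by simpa using hy
              refine posF_injective (n := n) ?_
              rw [hl x hx', hl y hy', hxy]
          _ = _ := by simp
      · intro x hx
        exact hout h x (by simpa using hx)
  · have hk : (P.k : ℝ) ≤ 2 ^ P.d := by exact_mod_cast P.k_le
    have hdeg' : (R.natDegree : ℝ) ≤ 2 ^ P.d + P.k := by
      have : R.natDegree ≤ 2 ^ P.d + P.k := by simpa using hdeg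
      exact_mod_cast this
    have hfst : prob (fun ω : Bits (n + P.d + 4) × Bits (lens n P).rho => R.eval (chalF ω.1) = 0) ≤
        2 * R.natDegree / 2 ^ (n + P.d + 4) := by
      rw [prob_fst (fun h : Bits (n + P.d + 4) => R.eval (chalF h) = 0)]
      exact prob_chalF_root_le R hRz
    -- Off the roots of `R` one of the k + 1 checks is violated, so acceptance is an affine equation
    -- in ρ with a non-zero coefficient. Its constant term, the error in the inner product, was
    -- fixed before ρ.
    have hsnd : prob (fun ω : Bits (n + P.d + 4) × Bits (lens n P).rho => R.eval (chalF ω.1) ≠ 0 ∧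
        Accepts (Q.augmentation G') f ⟨seed, pub, ext1, final ω.1, ext2 ω.1⟩ ω.1 ω.2) ≤
        1 / 2 ^ (n + P.d + 4) := by
      refine prob_prod_le (by positivity) fun h => ?_
      by_cases hh : R.eval (chalF h) = 0
      · rw [prob_eq_zero]
        · positivity
        · simp [hh]
      set y : Bool → Fin P.k → Fld n P := fun b => unpack _ _ (ext2 h b)
      let c : Option (Fin P.k) → Fld n P := fun a => match a with
        | some l => (y false l + y true l) *
            (chalF h + (x1 false (some (0, l)) + x1 true (some (0, l)))) +
            (x1 false (some (1, l)) + x1 true (some (1, l)))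
        | none => (leafSum (chalF h) (V false) + leafSum (chalF h) (V true)) +
            ∑ l, (y false l + y true l)
      have hc : ∃ a, c a ≠ 0 := by
        by_contra hcon
        push Not at hcon
        refine hh (hR (chalF h) (fun l => y false l + y true l) (fun x => chalF_ne_posF h x) ?_ ?_)
        · intro l
          have := hcon (some l)
          rw [CharTwo.sub_eq_add]
          exact CharTwo.add_eq_zero.mp this
        · have := hcon none
          simp only [CharTwo.sub_eq_add]
          rw [← CharTwo.add_eq_zero.mp this, leafSum_add]
      obtain ⟨a, ha⟩ := hc
      refine le_trans (prob_mono fun ρ hρ => ?_) (prob_linear_form_le c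
        (x1 false none + x1 true none + ∑ l, (x1 false (some (2, l)) + x1 true (some (2, l))) *
          (x1 false (some (3, l)) + x1 true (some (3, l)))) a ha)
      have h1 := (accepts_iff Q G' f _ h ρ).mp hρ.2
      rw [checkValue_add] at h1
      rw [Fintype.sum_option, add_comm (unpack _ _ ρ none * c none)]
      exact h1
    calc prob (fun ω : Bits (n + P.d + 4) × Bits (lens n P).rho =>
          Accepts (Q.augmentation G') f ⟨seed, pub, ext1, final ω.1, ext2 ω.1⟩ ω.1 ω.2 ∧
          ¬ IsBlockSparse P (output G (Q.augmentation G') f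
            ⟨seed, pub, ext1, final ω.1, ext2 ω.1⟩ ω.1))
        ≤ prob (fun ω : Bits (n + P.d + 4) × Bits (lens n P).rho => R.eval (chalF ω.1) = 0 ∨
          (R.eval (chalF ω.1) ≠ 0 ∧ Accepts (Q.augmentation G') f
            ⟨seed, pub, ext1, final ω.1, ext2 ω.1⟩ ω.1 ω.2)) :=
          prob_mono fun ω hω => by
            by_cases hh : R.eval (chalF ω.1) = 0
            · exact Or.inl hh
            · exact Or.inr ⟨hh, hω.1⟩
      _ ≤ 2 * R.natDegree / 2 ^ (n + P.d + 4) + 1 / 2 ^ (n + P.d + 4) :=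
          (prob_or_le _ _).trans (add_le_add hfst hsnd)
      _ ≤ 1 / 2 ^ n := by
          -- As the degree is at most 2^d + k ≤ 2·2^d, the numerator is at most 4·2^d + 1 ≤ 16·2^d.
          -- This is what the 4 in the field size pays for.
          rw [← add_div, div_le_div_iff₀ (by positivity) (by positivity), pow_add, pow_add]
          have h1 : (1 : ℝ) ≤ 2 ^ P.d := one_le_pow₀ (by norm_num)
          have h2 : (0 : ℝ) < 2 ^ n := by positivity
          nlinarith [mul_le_mul_of_nonneg_right (show 2 * (R.natDegree : ℝ) + 1 ≤ 2 ^ P.d * 2 ^ 4 by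
            linarith) h2.le]

end Soundness


/-! ### Gate counts of the tree evaluation -/

section TreeCost

variable {Ω : Type} {S : Set (Ω → Bool)} {n : ℕ} {P : Params}

/-- Table lookup. -/
theorem Cost.lookup {N T : ℕ} (hN : N ≤ 2 ^ T) {slot : Ω → Fin N}
    (hs : ∀ t : Fin T, Cost S {fun ω => (slot ω : ℕ).testBit t} 0) {val : Fin N → Ω → Bool}
    (hv : ∀ a, Cost S {val a} 0) : Cost S {fun ω => val (slot ω) ω} (N * (3 * T + 6)) := by
  -- The bitwise test whether the slot equals the constant a. The lookup is the disjunction over a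
  -- of this test and `val a`.
  have h1 := fun a : Fin N => Cost.all (S := S) (s := 1) (Finset.univ : Finset (Fin T))
    (φ := fun t ω => if (a : ℕ).testBit t then (slot ω : ℕ).testBit t
      else !(slot ω : ℕ).testBit t) fun t _ => by
      cases (a : ℕ).testBit t
      · simpa using (hs t).not
      · simpa using (hs t).le (Nat.zero_le 1)
  have key := Cost.any (Finset.univ : Finset (Fin N)) fun a _ => (h1 a).and (hv a)
  rw [Finset.card_univ, Finset.card_univ, Fintype.card_fin, Fintype.card_fin] at key
  refine key.mono le_rfl ?_ (by ring_nf; omega)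
  simp only [Set.singleton_subset_iff, Set.mem_singleton_iff]
  funext ω
  have heq : ∀ a : Fin N, (∀ t : Fin T, (if (a : ℕ).testBit t then (slot ω : ℕ).testBit t
      else !(slot ω : ℕ).testBit t) = true) ↔ slot ω = a := by
    intro a
    constructor
    · intro h
      refine Fin.ext (Nat.eq_of_testBit_eq fun t => ?_)
      by_cases ht : t < T
      · have := h ⟨t, ht⟩
        simp only at this
        split_ifs at this with h1
        · rw [h1, this]
        · simp only [Bool.not_eq_true] at h1
          simp only [Bool.not_eq_eq_eq_not, Bool.not_true] at this
          rw [h1, this]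
      · have hT : 2 ^ T ≤ 2 ^ t := Nat.pow_le_pow_right (by norm_num) (by omega)
        rw [Nat.testBit_lt_two_pow (lt_of_lt_of_le (slot ω).isLt (hN.trans hT)),
          Nat.testBit_lt_two_pow (lt_of_lt_of_le a.isLt (hN.trans hT))]
    · rintro rfl t
      cases h : (slot ω : ℕ).testBit t <;> simp
  simp only [Finset.mem_univ, true_and, true_implies, heq, Bool.and_eq_true, decide_eq_true_eq,
    exists_eq_left']
  simp

/-- The bits of a node value. -/
def NodeVal.bit (v : NodeVal n) : Fin n ⊕ Bool → Bool
  | .inl j => v.seed j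
  | .inr false => v.u
  | .inr true => v.q

/-- The bits of a correction word that concern the child `b`. -/
def cwBit (w : CorrWord n) (b : Bool) : Fin n ⊕ Bool → Bool
  | .inl j => w.1 j
  | .inr false => w.2.1 b
  | .inr true => w.2.2 b

theorem applyCW_bit (u q : Bool) (w₀ w₁ : CorrWord n) (b : Bool) (v : NodeVal n) (z : Fin n ⊕ Bool) :
    (applyCW u q w₀ w₁ b v).bit z = xor (v.bit z) (xor (u && cwBit w₀ b z) (q && cwBit w₁ b z)) := by
  rcases z with j | _ | _ <;> rfl

/-- The bits of all node values of a layer. -/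
def famN {i : ℕ} (V : Ω → Bits i → NodeVal n) : Set (Ω → Bool) :=
  fam fun ω (t : Bits i × (Fin n ⊕ Bool)) => (V ω t.1).bit t.2

theorem mem_famN {i : ℕ} (V : Ω → Bits i → NodeVal n) (x : Bits i) (z : Fin n ⊕ Bool) :
    (fun ω => (V ω x).bit z) ∈ famN V := ⟨(x, z), rfl⟩

theorem Cost.nodes {i : ℕ} {V : Ω → Bits i → NodeVal n} {s : ℕ}
    (h : ∀ x, Cost S (fam fun ω => (V ω x).bit) s) : Cost S (famN V) (2 ^ i * s) := by
  have := Cost.iUnion h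
  rw [Fintype.card_fun, Fintype.card_bool, Fintype.card_fin] at this
  refine this.mono le_rfl ?_ le_rfl
  rintro _ ⟨⟨x, z⟩, rfl⟩
  exact Set.mem_iUnion.mpr ⟨x, mem_fam _ z⟩

/-- The children of the nodes of a layer. -/
theorem Cost.expandNode {i s : ℕ} {G : Bits n → Bits (2 * (n + 2))}
    (C : Circuit (Fin n) (Fin (2 * (n + 2)))) (hC : ∀ x, C.eval x = G x)
    {V : Ω → Bits i → NodeVal n} (h : Cost S (famN V) s) (y : Bits (i + 1)) :
    Cost S (fam fun ω => (expand G (V ω) y).bit) (s + C.size) := by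
  have hseed : Cost S (fam fun ω => (V ω (Fin.init y)).seed) s := by
    refine h.mono le_rfl ?_ le_rfl
    rintro _ ⟨j, rfl⟩
    exact mem_famN V (Fin.init y) (.inl j)
  refine (hseed.circuit C).mono le_rfl ?_ le_rfl
  rintro _ ⟨z, rfl⟩
  simp only [hC]
  rcases z with j | _ | _
  · exact mem_fam (fun ω => G (V ω (Fin.init y)).seed) _
  · exact mem_fam (fun ω => G (V ω (Fin.init y)).seed) _
  · exact mem_fam (fun ω => G (V ω (Fin.init y)).seed) _

/-- The correction of a node. -/
theorem Cost.correctNode {i N s t : ℕ} {f : Ω → Bits i → Bool → Fin N} {cw : Ω → Fin N → CorrWord n}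
    {V : Ω → Bits i → NodeVal n} {ch : Ω → Bits (i + 1) → NodeVal n} {y : Bits (i + 1)}
    (hV : famN V ⊆ S) (hch : Cost S (fam fun ω => (ch ω y).bit) s)
    (hcw : ∀ c z, Cost S {fun ω => cwBit (cw ω (f ω (Fin.init y) c)) (y (Fin.last i)) z} t) :
    Cost S (fam fun ω => (correct (f ω) (cw ω) (V ω) (ch ω) y).bit)
      (s + (n + 2) * (2 * t + 20)) := by
  have h2 : Cost (S ∪ fam fun ω => (ch ω y).bit)
      (fam fun ω => (correct (f ω) (cw ω) (V ω) (ch ω) y).bit) ((n + 2) * (2 * t + 20)) := by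
    have := Cost.pi (S := S ∪ fam fun ω => (ch ω y).bit) (s := 2 * t + 20)
      (X := fun ω => (correct (f ω) (cw ω) (V ω) (ch ω) y).bit) fun z => by
        simp only [correct, applyCW_bit]
        have e1 : Cost (S ∪ fam fun ω => (ch ω y).bit) {fun ω => (ch ω y).bit z} 0 :=
          .of_mem (Or.inr (mem_fam _ z))
        have e2 : ∀ z', Cost (S ∪ fam fun ω => (ch ω y).bit)
            {fun ω => (V ω (Fin.init y)).bit z'} 0 := fun z' =>
          .of_mem (Or.inl (hV (mem_famN V _ z')))
        have e3 := fun c => (hcw c z).mono (S' := S ∪ fam fun ω => (ch ω y).bit)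
          Set.subset_union_left le_rfl le_rfl
        exact (e1.xor (((e2 (.inr false)).and (e3 false)).xor ((e2 (.inr true)).and (e3 true)))).le
          (by omega)
    rwa [Fintype.card_sum, Fintype.card_fin, Fintype.card_bool] at this
  exact hch.then h2

theorem clog_le (P : Params) : Nat.clog 2 (3 * P.k) ≤ P.d + 2 := by
  refine Nat.clog_le_of_le_pow ?_
  have := P.k_le
  rw [pow_add]; omega

/-- The environment of a server: hash functions, messages of the client, random strings, and
received messages. -/
abbrev ServerEnv (n : ℕ) (P : Params) : Type :=
  HashFam P × Msgs n P (lens n P) × Bits (lens n P).chal × Bits (lens n P).rho ×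
    (Fin (lens n P).rounds → Bits (lens n P).msg)

/-- The view of server `b`. -/
noncomputable def serverBits (b : Bool) (ω : ServerEnv n P) : ViewIx n P (lens n P) → Bool :=
  view ω.1 ω.2.1 ω.2.2.1 ω.2.2.2.1 b ω.2.2.2.2

/-- A node costs one evaluation of `G` and two lookups among 3k words for each of its n + 2 bits.
Lookups are needed because the slots are input bits of the server's circuit. -/
theorem cost_layer (b : Bool) {G : Bits n → Bits (2 * (n + 2))}
    (C : Circuit (Fin n) (Fin (2 * (n + 2)))) (hC : ∀ x, C.eval x = G x) (i : ℕ) (hi : i ≤ P.d) :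
    Cost (fam (serverBits (n := n) (P := P) b))
      (famN fun ω => layer G ω.1 b (ω.2.1.seed b) ω.2.1.pub i hi)
      ((n + 2) + i * (2 ^ P.d * (C.size + (n + 2) * (2 * (3 * P.k * (3 * (P.d + 2) + 6)) + 20)))) := by
  induction i with
  | zero =>
    have := Cost.nodes (S := fam (serverBits (n := n) (P := P) b)) (s := n + 2)
      (V := fun ω => layer G ω.1 b (ω.2.1.seed b) ω.2.1.pub 0 hi) fun x => by
        have := Cost.pi (S := fam (serverBits (n := n) (P := P) b)) (s := 1)
          (X := fun ω => (layer G ω.1 b (ω.2.1.seed b) ω.2.1.pub 0 hi x).bit) fun z => by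
            have hg : Cost (fam (serverBits (n := n) (P := P) b)) {fun ω => ω.2.1.pub.2} 0 :=
              .of_mem (mem_fam (serverBits b) .rootBit)
            rcases z with j | _ | _
            · exact .of_mem (mem_fam (serverBits b) (.seed j))
            · cases b
              · exact .const false
              · exact hg.not
            · cases b
              · exact .const false
              · exact hg.le (by norm_num)
        rwa [Fintype.card_sum, Fintype.card_fin, Fintype.card_bool, mul_one] at this
    simpa using this
  | succ i ih =>
    specialize ih (Nat.le_of_succ_le hi)
    have h2 := Cost.nodes (S := fam (serverBits (n := n) (P := P) b) ∪
        famN fun ω => layer G ω.1 b (ω.2.1.seed b) ω.2.1.pub i (Nat.le_of_succ_le hi))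
      (V := fun ω => layer G ω.1 b (ω.2.1.seed b) ω.2.1.pub (i + 1) hi)
      (s := C.size + (n + 2) * (2 * (3 * P.k * (3 * (P.d + 2) + 6)) + 20)) fun y => by
        simp only [layer, nextLayer_eq]
        refine (Cost.correctNode (s := 0 + C.size) (t := 3 * P.k * (3 * (P.d + 2) + 6))
          Set.subset_union_right ((Cost.of_subset Set.subset_union_right).expandNode C hC y)
          fun c z => ?_).le (by rw [zero_add])
        have hT : 3 * P.k ≤ 2 ^ Nat.clog 2 (3 * P.k) := Nat.le_pow_clog (by norm_num) _
        refine (Cost.lookup hT (slot := fun ω : ServerEnv n P => ω.1 ⟨i, by omega⟩ (Fin.init y) c)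
          (val := fun a ω => cwBit (ω.2.1.pub.1 ⟨i, hi⟩ a) (y (Fin.last i)) z)
          (fun t => .of_mem (Or.inl (mem_fam (serverBits b) (.hash ⟨i, by omega⟩ (Fin.init y) c t))))
          fun a => ?_).le ?_
        · rcases z with j | _ | _
          · exact .of_mem (Or.inl (mem_fam (serverBits b) (.seedCorr ⟨i, hi⟩ a j)))
          · exact .of_mem (Or.inl (mem_fam (serverBits b) (.bitCorrU ⟨i, hi⟩ a (y (Fin.last i)))))
          · exact .of_mem (Or.inl (mem_fam (serverBits b) (.bitCorrQ ⟨i, hi⟩ a (y (Fin.last i)))))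
        · have := clog_le P
          gcongr
    refine (ih.then h2).le ?_
    have : 2 ^ (i + 1) ≤ 2 ^ P.d := Nat.pow_le_pow_right (by norm_num) hi
    generalize C.size + (n + 2) * (2 * (3 * P.k * (3 * (P.d + 2) + 6)) + 20) = w
    have hw := Nat.mul_le_mul_right w this
    rw [add_mul i 1]
    omega

end TreeCost


/-! ### Gate counts of the sparsity proof -/

section ProofCost

variable {Ω : Type} {S : Set (Ω → Bool)} {n : ℕ} {P : Params}

theorem Cost.unpack {m : ℕ} [NeZero m] {α : Type} [Fintype α]
    {e : Ω → Bits (Fintype.card (α × Fin m))} (h : ∀ i, (fun ω => e ω i) ∈ S) (a : α) :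
    Cost S (famF fun ω => unpack m α (e ω) a) 0 := by
  refine .of_subset ?_
  rintro _ ⟨j, rfl⟩
  simp only [unpack_apply, toBits_ofBits]
  exact h _

theorem Cost.pack {m : ℕ} [NeZero m] {α : Type} [Fintype α] {v : Ω → α → GaloisField 2 m} {s : α → ℕ}
    (h : ∀ a, Cost S (famF fun ω => v ω a) (s a)) :
    Cost S (fam fun ω => (VDPF.unpack m α).symm (v ω)) (∑ a, s a) := by
  refine (Cost.biUnion Finset.univ fun a _ => h a).mono le_rfl ?_ le_rfl
  rintro _ ⟨i, rfl⟩
  simp only [unpack_symm_apply, Set.mem_iUnion]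
  exact ⟨_, Finset.mem_univ _, mem_fam _ _⟩

theorem Cost.pack_const {m : ℕ} [NeZero m] {α : Type} [Fintype α] {v : Ω → GaloisField 2 m} {s : ℕ}
    (h : Cost S (famF v) s) : Cost S (fam fun ω => (VDPF.unpack m α).symm fun _ => v ω) s := by
  refine h.mono le_rfl ?_ le_rfl
  rintro _ ⟨i, rfl⟩
  simp only [unpack_symm_apply]
  exact mem_fam (fun ω => toBits m (v ω)) _

theorem Cost.toUnit {φ : Ω → Bool} {s : ℕ} (h : Cost S {φ} s) :
    Cost S (fam fun ω (_ : Unit) => φ ω) s :=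
  h.mono le_rfl (by rintro _ ⟨_, rfl⟩; rfl) le_rfl

theorem Cost.nodeF {v : Ω → NodeVal n} (h : fam (fun ω => (v ω).bit) ⊆ S) :
    Cost S (famF fun ω => nodeF P (v ω)) 0 := by
  have hb := fun z => h (mem_fam (fun ω => (v ω).bit) z)
  refine (Cost.const_false (S := S) (s := 0)).then (.of_subset (s := 0) ?_)
  rintro _ ⟨j, rfl⟩
  simp only [VDPF.nodeF, toBits_ofBits]
  split_ifs with h1 h2 h3
  · exact Or.inl (hb (.inl ⟨j, h1⟩))
  · exact Or.inl (hb (.inr false))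
  · exact Or.inl (hb (.inr true))
  · exact Or.inr rfl

theorem Cost.posF {x : Ω → Bits P.d} (h : fam x ⊆ S) : Cost S (famF fun ω => posF n (x ω)) 0 := by
  refine (Cost.const_false (S := S) (s := 0)).then (.of_subset (s := 0) ?_)
  rintro _ ⟨j, rfl⟩
  simp only [VDPF.posF, toBits_ofBits]
  split_ifs with h1
  · exact Or.inl (h (mem_fam x _))
  · exact Or.inr rfl

/-- The overwritten coordinate is the constant `true`, which needs a gate, unlike `false`. -/
theorem Cost.chalF {h : Ω → Bits (n + P.d + 4)} (hS : fam h ⊆ S) :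
    Cost S (famF fun ω => (chalF (h ω) : Fld n P)) (n + P.d + 4) := by
  have := Cost.pi (S := S) (s := 1) (X := fun ω => toBits _ (VDPF.chalF (h ω) : Fld n P)) fun j => by
    simp only [VDPF.chalF, toBits_ofBits]
    split_ifs
    · exact .const true
    · exact .of_mem (hS (mem_fam h j))
  rwa [Fintype.card_fin, mul_one] at this

theorem le_pow_three (n d : ℕ) : n + d + 4 ≤ (n + d + 4) ^ 3 := Nat.le_self_pow (by norm_num) _

theorem pow_three_le (n d : ℕ) : (n + d + 4) ^ 3 ≤ (n + d + 4) ^ 4 :=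
  Nat.pow_le_pow_right (by omega) (by norm_num)

theorem cost_serverOpening (b : Bool) (t : Fin P.k × Bool) :
    Cost (fam (serverBits (n := n) (P := P) b)) (famF fun ω => serverOpening ω.2.1 ω.2.2.2.1 b t)
      (29 * (n + P.d + 4) ^ 3) := by
  have hx := fun a => Cost.unpack (S := fam (serverBits (n := n) (P := P) b))
    (e := fun ω => ω.2.1.ext1 b) (fun i => mem_fam (serverBits b) (.ext1 i)) a
  have hy := fun a => Cost.unpack (S := fam (serverBits (n := n) (P := P) b))
    (e := fun ω => ω.2.1.ext2 b) (fun i => mem_fam (serverBits b) (.ext2 i)) a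
  have hr := fun a => Cost.unpack (S := fam (serverBits (n := n) (P := P) b))
    (e := fun ω => ω.2.2.2.1) (fun i => mem_fam (serverBits b) (.rho i)) a
  have := le_pow_three n P.d
  obtain ⟨l, c⟩ := t
  cases c
  · exact (((hr (some l)).mul (hy l)).add (hx (some (2, l)))).le (by omega)
  · exact ((hx (some (0, l))).add (hx (some (3, l)))).le (by omega)

/-- A bound for the number of gates for the check value of a server. -/
def checkCost (n : ℕ) (P : Params) (g : ℕ) : ℕ :=
  (n + 2) + P.d * (2 ^ P.d * (g + (n + 2) * (2 * (3 * P.k * (3 * (P.d + 2) + 6)) + 20))) +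
    2 ^ P.d * (120 * (n + P.d + 4) ^ 4) + P.k * (500 * (n + P.d + 4) ^ 3) + 60 * (n + P.d + 4) ^ 3

theorem cost_leafSum (b : Bool) {G : Bits n → Bits (2 * (n + 2))}
    (C : Circuit (Fin n) (Fin (2 * (n + 2)))) (hC : ∀ x, C.eval x = G x) :
    Cost (fam (serverBits (n := n) (P := P) b))
      (famF fun ω => leafSum (chalF ω.2.2.1)
        (layer G ω.1 b (ω.2.1.seed b) ω.2.1.pub P.d le_rfl))
      ((n + 2) + P.d * (2 ^ P.d * (C.size + (n + 2) * (2 * (3 * P.k * (3 * (P.d + 2) + 6)) + 20))) +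
        2 ^ P.d * (120 * (n + P.d + 4) ^ 4)) := by
  refine (cost_layer b C hC P.d le_rfl).then ?_
  have h1 := le_pow_three n P.d
  have h2 := pow_three_le n P.d
  have := Cost.sum (Finset.univ : Finset (Bits P.d)) (s := 110 * (n + P.d + 4) ^ 4)
    (X := fun x (ω : ServerEnv n P) => nodeF P (layer G ω.1 b (ω.2.1.seed b) ω.2.1.pub P.d le_rfl x) *
      (chalF ω.2.2.1 + posF n x)⁻¹)
    (S := fam (serverBits (n := n) (P := P) b) ∪
      famN fun ω => layer G ω.1 b (ω.2.1.seed b) ω.2.1.pub P.d le_rfl) fun x _ => by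
      have e1 : Cost (fam (serverBits (n := n) (P := P) b) ∪
          famN fun ω => layer G ω.1 b (ω.2.1.seed b) ω.2.1.pub P.d le_rfl)
          (famF fun ω => nodeF P (layer G ω.1 b (ω.2.1.seed b) ω.2.1.pub P.d le_rfl x)) 0 := by
        refine Cost.nodeF ?_
        rintro _ ⟨z, rfl⟩
        exact Or.inr (mem_famN (fun ω : ServerEnv n P =>
          layer G ω.1 b (ω.2.1.seed b) ω.2.1.pub P.d le_rfl) x z)
      have e2 : Cost (fam (serverBits (n := n) (P := P) b) ∪
          famN fun ω => layer G ω.1 b (ω.2.1.seed b) ω.2.1.pub P.d le_rfl)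
          (famF fun ω => (chalF ω.2.2.1 : Fld n P)) (n + P.d + 4) := by
        refine Cost.chalF ?_
        rintro _ ⟨j, rfl⟩
        exact Or.inl (mem_fam (serverBits b) (.chal j))
      exact (e1.mul ((e2.add (Cost.constF (posF n x))).inv (by omega))).le (by omega)
  rw [Finset.card_univ, Fintype.card_fun, Fintype.card_bool, Fintype.card_fin] at this
  refine this.le ?_
  gcongr
  omega

theorem cost_serverCheck (b : Bool) {G : Bits n → Bits (2 * (n + 2))}
    (C : Circuit (Fin n) (Fin (2 * (n + 2)))) (hC : ∀ x, C.eval x = G x) :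
    Cost (fam (serverBits (n := n) (P := P) b))
      (famF fun ω => serverCheck G ω.1 ω.2.1 ω.2.2.1 ω.2.2.2.1 b ω.2.2.2.2)
      (checkCost n P C.size) := by
  have hx := fun a => Cost.unpack (S := fam (serverBits (n := n) (P := P) b))
    (e := fun ω => ω.2.1.ext1 b) (fun i => mem_fam (serverBits b) (.ext1 i)) a
  have hy := fun a => Cost.unpack (S := fam (serverBits (n := n) (P := P) b))
    (e := fun ω => ω.2.1.ext2 b) (fun i => mem_fam (serverBits b) (.ext2 i)) a
  have hr := fun a => Cost.unpack (S := fam (serverBits (n := n) (P := P) b))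
    (e := fun ω => ω.2.2.2.1) (fun i => mem_fam (serverBits b) (.rho i)) a
  have hc := fun a => Cost.unpack (S := fam (serverBits (n := n) (P := P) b))
    (α := Fin P.k × Bool)
    (e := fun ω => ω.2.2.2.2 (0 : Fin 2)) (fun i => mem_fam (serverBits b) (.recv (0 : Fin 2) i)) a
  have hh : Cost (fam (serverBits (n := n) (P := P) b))
      (famF fun ω => (chalF ω.2.2.1 : Fld n P)) (n + P.d + 4) := by
    refine Cost.chalF ?_
    rintro _ ⟨j, rfl⟩
    exact mem_fam (serverBits b) (.chal j)
  have ho := fun t => (cost_serverOpening (n := n) (P := P) b t).add (hc t)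
  have h1 := le_pow_three n P.d
  have hb : ∀ l, Cost (fam (serverBits (n := n) (P := P) b)) (famF fun ω => if b then
      (serverOpening ω.2.1 ω.2.2.2.1 b (l, false) + unpack _ _ (ω.2.2.2.2 (0 : Fin 2)) (l, false)) *
      (serverOpening ω.2.1 ω.2.2.2.1 b (l, true) + unpack _ _ (ω.2.2.2.2 (0 : Fin 2)) (l, true))
      else 0) (100 * (n + P.d + 4) ^ 3) := by
    intro l
    cases b
    · exact (Cost.constF 0).le (by omega)
    · exact ((ho (l, false)).mul (ho (l, true))).le (by omega)
  have hsum := Cost.sum (Finset.univ : Finset (Fin P.k)) (s := 350 * (n + P.d + 4) ^ 3)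
    fun l _ => (((((hr (some l)).mul ((hh.mul (hy l)).add (hx (some (1, l)))))).add
      (((ho (l, false)).mul (hx (some (3, l)))).add ((ho (l, true)).mul (hx (some (2, l)))))).add
      (hb l)).le (by omega)
  have hys := Cost.sum (Finset.univ : Finset (Fin P.k)) fun l _ => hy l
  have := (hsum.add (hx none)).add ((hr none).mul ((cost_leafSum b C hC).add hys))
  refine this.le ?_
  rw [Finset.card_univ, Fintype.card_fin]
  have h3 : P.k * (350 * (n + P.d + 4) ^ 3 + (n + P.d + 4) * 8) + P.k * (0 + (n + P.d + 4) * 8) ≤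
      P.k * (500 * (n + P.d + 4) ^ 3) := by
    rw [← mul_add]
    gcongr
    omega
  unfold checkCost
  omega

/-- The environment of the client. -/
abbrev ClientEnv (n : ℕ) (P : Params) (r : ℕ) : Type :=
  HashFam P × Input P × BaseCoins n P × Bits (lens n P).coin × Bits r

/-- The input bits of the client. -/
noncomputable def clientBits (G : Bits n → Bits (2 * (n + 2))) {r : ℕ} (ω : ClientEnv n P r) :
    ClientIx n P (lens n P).coin r → Bool := clientIn G ω.1 ω.2.1 ω.2.2.1 ω.2.2.2.1 ω.2.2.2.2

variable (G : Bits n → Bits (2 * (n + 2))) {r : ℕ}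

theorem cost_client_pos (l : Fin P.k) : Cost (fam (clientBits (P := P) (r := r) G))
    (famF fun ω => posF n (ω.2.1.α l)) 0 := by
  refine Cost.posF ?_
  rintro _ ⟨j, rfl⟩
  exact mem_fam (clientBits G) (.path l j)

theorem cost_client_diff (l : Fin P.k) : Cost (fam (clientBits (P := P) (r := r) G))
    (famF fun ω => leafDiff G ω.1 ω.2.1 ω.2.2.1 l) ((n + P.d + 4) * 8) := by
  have : ∀ b, Cost (fam (clientBits (P := P) (r := r) G))
      (famF fun ω => nodeF P (leafVal G ω.1 ω.2.1 ω.2.2.1 b l)) 0 := by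
    intro b
    refine Cost.nodeF ?_
    rintro _ ⟨z, rfl⟩
    rcases z with j | _ | _
    · exact mem_fam (clientBits G) (.leafSeed b l j)
    · exact mem_fam (clientBits G) (.leafU b l)
    · exact mem_fam (clientBits G) (.leafQ b l)
  exact ((this false).add (this true)).le (by omega)

theorem cost_share1 (b : Bool) : Cost (fam (clientBits (P := P) (r := 0) G))
    (fam fun ω => (unpack _ _).symm (share1 (fun l => posF n (ω.2.1.α l))
      (leafDiff G ω.1 ω.2.1 ω.2.2.1) (unpack _ _ ω.2.2.2.1) b))
    (P.k * (200 * (n + P.d + 4) ^ 3)) := by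
  have he := fun a => Cost.unpack (S := fam (clientBits (P := P) (r := 0) G))
    (e := fun ω => ω.2.2.2.1) (fun i => mem_fam (clientBits G) (.coin i)) a
  have h1 := le_pow_three n P.d
  have hk := P.k_pos
  let s : Option (Fin 4 × Fin P.k) → ℕ := fun a =>
    if a = none then P.k * (60 * (n + P.d + 4) ^ 3) + (n + P.d + 4) * 9 else 16 * (n + P.d + 4) ^ 3
  refine (Cost.pack (s := s) fun a => ?_).le ?_
  · rcases a with _ | ⟨i, l⟩
    · simp only [share1, s, if_true]
      cases b
      · exact ((he none).add (Cost.constF 0)).le (by omega)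
      · have := Cost.sum (Finset.univ : Finset (Fin P.k)) (s := 50 * (n + P.d + 4) ^ 3)
          fun l _ => (((he (some (2, l))).add (he (some (3, l)))).mul
            ((he (some (4, l))).add (he (some (5, l))))).le (by omega)
        refine ((he none).add this).le ?_
        rw [Finset.card_univ, Fintype.card_fin]
        have : P.k * (50 * (n + P.d + 4) ^ 3 + (n + P.d + 4) * 8) ≤
            P.k * (60 * (n + P.d + 4) ^ 3) := by gcongr; omega
        omega
    · simp only [s, reduceCtorEq, if_false]
      fin_cases i
      · cases b
        · exact ((he (some (0, l))).add (Cost.constF 0)).le (by omega)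
        · exact ((he (some (0, l))).add (cost_client_pos G l)).le (by omega)
      · cases b
        · exact ((he (some (1, l))).add (Cost.constF 0)).le (by omega)
        · exact ((he (some (1, l))).add (cost_client_diff G l)).le (by omega)
      · cases b
        · exact (he (some (2, l))).le (by omega)
        · exact (he (some (3, l))).le (by omega)
      · cases b
        · exact (he (some (4, l))).le (by omega)
        · exact (he (some (5, l))).le (by omega)
  · rw [Fintype.sum_option]
    simp only [s, if_true, reduceCtorEq, if_false, Finset.sum_const, Finset.card_univ,
      Fintype.card_prod, Fintype.card_fin, smul_eq_mul]
    have : (n + P.d + 4) * 9 ≤ P.k * (9 * (n + P.d + 4) ^ 3) := by nlinarith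
    nlinarith

theorem cost_share2 (b : Bool) : Cost (fam (clientBits (P := P) (r := n + P.d + 4) G))
    (fam fun ω => (unpack _ _).symm (share2 (fun l => posF n (ω.2.1.α l))
      (leafDiff G ω.1 ω.2.1 ω.2.2.1) (chalF ω.2.2.2.2) (unpack _ _ ω.2.2.2.1) b))
    (P.k * (130 * (n + P.d + 4) ^ 4)) := by
  have he := fun a => Cost.unpack (S := fam (clientBits (P := P) (r := n + P.d + 4) G))
    (e := fun ω => ω.2.2.2.1) (fun i => mem_fam (clientBits G) (.coin i)) a
  have hh : Cost (fam (clientBits (P := P) (r := n + P.d + 4) G))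
      (famF fun ω => (chalF ω.2.2.2.2 : Fld n P)) (n + P.d + 4) := by
    refine Cost.chalF ?_
    rintro _ ⟨j, rfl⟩
    exact mem_fam (clientBits G) (.chal j)
  have h1 := le_pow_three n P.d
  have h2 := pow_three_le n P.d
  refine (Cost.pack (s := fun _ => 130 * (n + P.d + 4) ^ 4) fun l => ?_).le ?_
  · cases b
    · exact ((he (some (6, l))).add (Cost.constF 0)).le (by omega)
    · exact ((he (some (6, l))).add ((cost_client_diff G l).mul
        ((hh.add (cost_client_pos G l)).inv (by omega)))).le (by omega)
  · simp

variable {G}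

/-- The circuits of the proof exist, with the expected sizes. -/
theorem exists_proofCircuits (C : Circuit (Fin n) (Fin (2 * (n + 2)))) (hC : ∀ x, C.eval x = G x) :
    ∃ Q : ProofCircuits n P G, Q.client1.size ≤ P.k * (400 * (n + P.d + 4) ^ 3) ∧
      Q.client2.size ≤ P.k * (260 * (n + P.d + 4) ^ 4) ∧
      ∀ b, (Q.msg0 b).size ≤ P.k * (58 * (n + P.d + 4) ^ 3) ∧
        (Q.msg1 b).size ≤ checkCost n P C.size ∧
        (Q.accept b).size ≤ checkCost n P C.size + P.k * (22 * (n + P.d + 4)) + 1 := by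
  have hc1 : Cost (fam (clientBits (P := P) (r := 0) G)) (fam fun ω (t : Bool × Fin (lens n P).ext1) =>
      (unpack (n + P.d + 4) (Option (Fin 4 × Fin P.k))).symm (share1 (fun l => posF n (ω.2.1.α l))
        (leafDiff G ω.1 ω.2.1 ω.2.2.1) (unpack _ _ ω.2.2.2.1) t.1) t.2)
      (P.k * (400 * (n + P.d + 4) ^ 3)) := by
    refine (Cost.iUnion fun b => cost_share1 (P := P) G b).mono le_rfl ?_ ?_
    · rintro _ ⟨⟨b, j⟩, rfl⟩
      exact Set.mem_iUnion.mpr ⟨b, mem_fam (fun ω : ClientEnv n P 0 => (unpack (n + P.d + 4)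
        (Option (Fin 4 × Fin P.k))).symm (share1 (fun l => posF n (ω.2.1.α l))
        (leafDiff G ω.1 ω.2.1 ω.2.2.1) (unpack _ _ ω.2.2.2.1) b)) j⟩
    · rw [Fintype.card_bool]; exact le_of_eq (by ring)
  have hc2 : Cost (fam (clientBits (P := P) (r := n + P.d + 4) G))
      (fam fun ω (t : Bool × Fin (lens n P).ext2) =>
      (unpack (n + P.d + 4) (Fin P.k)).symm (share2 (fun l => posF n (ω.2.1.α l))
        (leafDiff G ω.1 ω.2.1 ω.2.2.1) (chalF ω.2.2.2.2) (unpack _ _ ω.2.2.2.1) t.1) t.2)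
      (P.k * (260 * (n + P.d + 4) ^ 4)) := by
    refine (Cost.iUnion fun b => cost_share2 (P := P) G b).mono le_rfl ?_ ?_
    · rintro _ ⟨⟨b, j⟩, rfl⟩
      exact Set.mem_iUnion.mpr ⟨b, mem_fam (fun ω : ClientEnv n P (n + P.d + 4) =>
        (unpack (n + P.d + 4) (Fin P.k)).symm (share2 (fun l => posF n (ω.2.1.α l))
        (leafDiff G ω.1 ω.2.1 ω.2.2.1) (chalF ω.2.2.2.2) (unpack _ _ ω.2.2.2.1) b)) j⟩
    · rw [Fintype.card_bool]; exact le_of_eq (by ring)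
  have hm0 := fun b => Cost.pack (cost_serverOpening (n := n) (P := P) b)
  have hm1 := fun b => (cost_serverCheck (P := P) b C hC).pack_const (α := Fin P.k × Bool)
  -- The decision recomputes the check value and compares it, bit by bit, with the second received
  -- message.
  have hac := fun b => (hm1 b).then (Cost.all (s := 9)
    (S := fam (serverBits (n := n) (P := P) b) ∪ fam fun ω => (unpack _ (Fin P.k × Bool)).symm
      fun _ => serverCheck G ω.1 ω.2.1 ω.2.2.1 ω.2.2.2.1 b ω.2.2.2.2)
    (Finset.univ : Finset (Fin (lens n P).msg))
    (φ := fun j ω => !(xor (ω.2.2.2.2 (1 : Fin 2) j) ((unpack (n + P.d + 4) (Fin P.k × Bool)).symm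
      (fun _ => serverCheck G ω.1 ω.2.1 ω.2.2.1 ω.2.2.2.1 b ω.2.2.2.2) j))) fun j _ => by
      have e1 : Cost (fam (serverBits (n := n) (P := P) b) ∪
          fam fun ω => (unpack _ (Fin P.k × Bool)).symm
          fun _ => serverCheck G ω.1 ω.2.1 ω.2.2.1 ω.2.2.2.1 b ω.2.2.2.2)
          {fun ω => ω.2.2.2.2 (1 : Fin 2) j} 0 :=
        .of_mem (Or.inl (mem_fam (serverBits b) (.recv (1 : Fin 2) j)))
      have e2 := Cost.of_mem (s := 0) (S := fam (serverBits (n := n) (P := P) b) ∪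
          fam fun ω => (unpack _ (Fin P.k × Bool)).symm
          fun _ => serverCheck G ω.1 ω.2.1 ω.2.2.1 ω.2.2.2.1 b ω.2.2.2.2)
          (Or.inr (mem_fam (fun ω : ServerEnv n P => (unpack (n + P.d + 4) (Fin P.k × Bool)).symm
          fun _ => serverCheck G ω.1 ω.2.1 ω.2.2.1 ω.2.2.2.1 b ω.2.2.2.2) j))
      exact (e1.xor e2).not)
  obtain ⟨c1, hc1s, hc1e⟩ := hc1.exists_circuit
  obtain ⟨c2, hc2s, hc2e⟩ := hc2.exists_circuit
  choose m0 hm0s hm0e using fun b => (hm0 b).exists_circuit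
  choose m1 hm1s hm1e using fun b => (hm1 b).exists_circuit
  choose ac hacs hace using fun b => (hac b).toUnit.exists_circuit
  refine ⟨⟨c1, c2, m0, m1, ac, ?_, ?_, ?_, ?_, ?_⟩, hc1s, hc2s, fun b => ⟨?_, hm1s b, ?_⟩⟩
  · intro f inp co e b
    funext j
    exact congrFun (hc1e (f, inp, co, e, Fin.elim0)) (b, j)
  · intro f inp co e h b
    funext j
    exact congrFun (hc2e (f, inp, co, e, h)) (b, j)
  · intro f M h ρ b recv
    exact hm0e b (f, M, h, ρ, recv)
  · intro f M h ρ b recv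
    exact hm1e b (f, M, h, ρ, recv)
  · intro f M h ρ b recv
    have := congrFun (hace b (f, M, h, ρ, recv)) ()
    rw [show (ac b).eval (view f M h ρ b recv) () = _ from this]
    simp only [decide_eq_true_eq, Finset.mem_univ, true_implies]
    rw [funext_iff]
    refine forall_congr' fun j => ?_
    cases recv (1 : Fin 2) j <;> simp
  · refine (hm0s b).trans ?_
    simp only [Finset.sum_const, Finset.card_univ, Fintype.card_prod, Fintype.card_fin,
      Fintype.card_bool, smul_eq_mul]
    exact le_of_eq (by ring)
  · refine (hacs b).trans ?_
    simp only [Finset.card_univ, Fintype.card_fin, Fintype.card_prod, Fintype.card_bool]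
    exact le_of_eq (by ring)

end ProofCost


/-! ### Cost of the augmented scheme -/

section Costs

variable {n : ℕ} {P : Params} {G : Bits n → Bits (2 * (n + 2))} (Q : ProofCircuits n P G)
  (G' : Bits n → Fin P.B → P.𝔾)

theorem overheadBound_augmentation : OverheadBound G' (Q.augmentation G') := by
  intro C' hC'
  have h : Cost (fam fun ω : Bits (n + P.d + 4) × Bits n => Sum.elim ω.1 ω.2)
      (fam fun ω => C'.eval ω.2) (0 + C'.size) := by
    refine Cost.circuit C' (.of_subset ?_)
    rintro _ ⟨j, rfl⟩
    exact mem_fam (fun ω : Bits (n + P.d + 4) × Bits n => Sum.elim ω.1 ω.2) (.inr j)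
  obtain ⟨C, hs, he⟩ := h.exists_circuit
  exact ⟨C, hs.trans (by simp), fun h s => (he (h, s)).trans (hC' s)⟩

theorem extraComm_augmentation (hn : 1 ≤ n) :
    extraComm (Q.augmentation G') ≤ 144 * (P.k * P.d * n) := by
  have hk := P.k_pos
  have hd := P.d_pos
  simp only [extraComm, Fintype.card_prod, Fintype.card_option, Fintype.card_fin, Fintype.card_bool]
  -- In field elements the extra communication is 2(4k+1) + 2k + 2 + (k+1) + 8k = 19k + 5 ≤ 24k, and
  -- 24·6 = 144.
  have h1 : n + P.d + 4 ≤ 6 * (P.d * n) := by nlinarith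
  have h2 := Nat.mul_le_mul_left P.k h1
  have h3 : n + P.d + 4 ≤ P.k * (n + P.d + 4) := Nat.le_mul_of_pos_left _ hk
  ring_nf at h2 h3 ⊢
  omega

/-- Since the base is at least 2, constant factors can be absorbed into the exponent. -/
theorem pow_le_pow_mul {N a b c e : ℕ} (hN : 2 ≤ N) (ha : a ≤ 2 ^ e) (hb : b ≤ N ^ c) :
    a * b ≤ N ^ (e + c) := by
  rw [pow_add]
  exact Nat.mul_le_mul (ha.trans (Nat.pow_le_pow_left hN e)) hb

theorem add_four_pow_le {d : ℕ} (hn : 1 ≤ n) (hd : 1 ≤ d) :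
    (n + d + 4) ^ 4 ≤ 81 * (d + n) ^ 4 := by
  calc (n + d + 4) ^ 4 ≤ (3 * (d + n)) ^ 4 := Nat.pow_le_pow_left (by omega) 4
    _ = _ := by ring

theorem extraClientWork_augmentation (hn : 1 ≤ n)
    (h1 : Q.client1.size ≤ P.k * (400 * (n + P.d + 4) ^ 3))
    (h2 : Q.client2.size ≤ P.k * (260 * (n + P.d + 4) ^ 4)) :
    extraClientWork (Q.augmentation G') ≤ P.k * (P.d + n) ^ 20 := by
  have hd := P.d_pos
  have h3 := pow_three_le n P.d
  have h4 := add_four_pow_le hn hd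
  -- The constant to be absorbed is (400 + 260)·81 = 53460 < 2^16.
  have h5 : 65536 * (P.d + n) ^ 4 ≤ (P.d + n) ^ 20 :=
    pow_le_pow_mul (e := 16) (c := 4) (by omega) (by norm_num) le_rfl
  have h6 := Nat.mul_le_mul_left P.k
    (show 400 * (n + P.d + 4) ^ 3 + 260 * (n + P.d + 4) ^ 4 ≤ (P.d + n) ^ 20 by omega)
  rw [mul_add] at h6
  simp only [extraClientWork, mul_zero, add_zero]
  omega

theorem checkCost_le (g : ℕ) : checkCost n P g ≤
    P.k * 2 ^ P.d * ((n + P.d + 4) ^ 4 * (g + 704)) := by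
  have hk := P.k_pos
  have hp : 1 ≤ 2 ^ P.d := Nat.one_le_two_pow
  unfold checkCost
  set m := n + P.d + 4 with hm
  have hm3 : m ≤ m ^ 3 := le_pow_three n P.d
  have hm4 : m ^ 3 ≤ m ^ 4 := pow_three_le n P.d
  set D := 2 ^ P.d with hD
  have a1 : n + 2 ≤ P.k * D * m ^ 4 := by
    have : 1 * 1 ≤ P.k * D := Nat.mul_le_mul hk hp
    nlinarith
  have a2 : P.d * (D * (g + (n + 2) * (2 * (3 * P.k * (3 * (P.d + 2) + 6)) + 20))) ≤
      P.k * D * (m ^ 4 * g + 23 * m ^ 4) := by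
    have b1 : 2 * (3 * P.k * (3 * (P.d + 2) + 6)) + 20 ≤ P.k * (23 * m) := by nlinarith
    have b2 : P.d * (n + 2) ≤ m * m := Nat.mul_le_mul (by omega) (by omega)
    have b3 : P.d * g ≤ P.k * (m ^ 4 * g) := by
      calc P.d * g ≤ m ^ 4 * g := Nat.mul_le_mul_right _ (by omega)
        _ ≤ _ := Nat.le_mul_of_pos_left _ hk
    have b4 : P.d * (n + 2) * (2 * (3 * P.k * (3 * (P.d + 2) + 6)) + 20) ≤ P.k * (23 * m ^ 4) := by
      calc _ ≤ m * m * (P.k * (23 * m)) := Nat.mul_le_mul b2 b1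
        _ = P.k * (23 * m ^ 3) := by ring
        _ ≤ _ := by gcongr
    calc P.d * (D * (g + (n + 2) * (2 * (3 * P.k * (3 * (P.d + 2) + 6)) + 20)))
        = D * (P.d * g + P.d * (n + 2) * (2 * (3 * P.k * (3 * (P.d + 2) + 6)) + 20)) := by ring
      _ ≤ D * (P.k * (m ^ 4 * g) + P.k * (23 * m ^ 4)) := by gcongr
      _ = _ := by ring
  have a3 : D * (120 * m ^ 4) ≤ P.k * D * (120 * m ^ 4) :=
    Nat.mul_le_mul_right _ (Nat.le_mul_of_pos_left _ hk)
  have a4 : P.k * (500 * m ^ 3) ≤ P.k * D * (500 * m ^ 4) :=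
    Nat.mul_le_mul (Nat.le_mul_of_pos_right _ hp) (by omega)
  have a5 : 60 * m ^ 3 ≤ P.k * D * (60 * m ^ 4) :=
    (show 60 * m ^ 3 ≤ 60 * m ^ 4 by omega).trans
      (Nat.le_mul_of_pos_left _ (Nat.mul_pos hk hp))
  -- The constants add up to 1 + 23 + 120 + 500 + 60 = 704.
  calc _ ≤ P.k * D * m ^ 4 + P.k * D * (m ^ 4 * g + 23 * m ^ 4) + P.k * D * (120 * m ^ 4) +
        P.k * D * (500 * m ^ 4) + P.k * D * (60 * m ^ 4) := by gcongr
    _ = _ := by ring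

theorem extraServerWork_augmentation (hn : 1 ≤ n) {g c : ℕ} (hg : g ≤ n ^ c + c) (b : Bool)
    (h0 : (Q.msg0 b).size ≤ P.k * (58 * (n + P.d + 4) ^ 3))
    (h1 : (Q.msg1 b).size ≤ checkCost n P g)
    (h2 : (Q.accept b).size ≤ checkCost n P g + P.k * (22 * (n + P.d + 4)) + 1) :
    extraServerWork (Q.augmentation G') b ≤ P.k * 2 ^ P.d * (P.d + n) ^ (c + 22) := by
  have hd := P.d_pos
  have hk := P.k_pos
  have hp : 1 ≤ 2 ^ P.d := Nat.one_le_two_pow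
  have hc := checkCost_le (n := n) (P := P) g
  have hkp : P.k ≤ P.k * 2 ^ P.d := Nat.le_mul_of_pos_right _ hp
  -- The check value is computed twice, for the message and for the decision: 58 + 2·704 + 22 + 1 =
  -- 1489.
  have key : (Q.msg0 b).size + (Q.msg1 b).size + (Q.accept b).size ≤
      P.k * 2 ^ P.d * ((n + P.d + 4) ^ 4 * (2 * g + 1489)) := by
    set m := n + P.d + 4 with hm
    have hm3 : m ≤ m ^ 3 := le_pow_three n P.d
    have hm4 : m ^ 3 ≤ m ^ 4 := pow_three_le n P.d
    have e1 : P.k * (58 * m ^ 3) ≤ P.k * 2 ^ P.d * (58 * m ^ 4) := Nat.mul_le_mul hkp (by omega)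
    have e2 : P.k * (22 * m) ≤ P.k * 2 ^ P.d * (22 * m ^ 4) := Nat.mul_le_mul hkp (by omega)
    have e3 : 1 ≤ P.k * 2 ^ P.d * m ^ 4 :=
      Nat.mul_pos (Nat.mul_pos hk hp) (by omega)
    calc _ ≤ P.k * 2 ^ P.d * (58 * m ^ 4) + P.k * 2 ^ P.d * (m ^ 4 * (g + 704)) +
          (P.k * 2 ^ P.d * (m ^ 4 * (g + 704)) + P.k * 2 ^ P.d * (22 * m ^ 4) +
            P.k * 2 ^ P.d * m ^ 4) := by omega
      _ = _ := by ring
  have hsum : extraServerWork (Q.augmentation G') b =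
      (Q.msg0 b).size + (Q.msg1 b).size + (Q.accept b).size := by
    have : (∑ r : Fin 2, ((Q.augmentation G').msg b r).size) = (Q.msg0 b).size + (Q.msg1 b).size := by
      rw [Fin.sum_univ_two]; rfl
    simp only [extraServerWork, mul_zero, add_zero]
    rw [← this]
  rw [hsum]
  refine key.trans (Nat.mul_le_mul_left _ ?_)
  have hN : 2 ≤ P.d + n := by omega
  have e1 : n ^ c ≤ (P.d + n) ^ c := Nat.pow_le_pow_left (by omega) c
  have e2 : c ≤ (P.d + n) ^ c := Nat.lt_two_pow_self.le.trans (Nat.pow_le_pow_left hN c)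
  have e3 : 1 ≤ (P.d + n) ^ c := Nat.one_le_pow _ _ (by omega)
  have e4 : 2 * g + 1489 ≤ 2048 * (P.d + n) ^ c := by omega
  have e5 : 2048 * (P.d + n) ^ c ≤ (P.d + n) ^ (11 + c) := pow_le_pow_mul hN (by norm_num) le_rfl
  have e6 : (n + P.d + 4) ^ 4 ≤ (P.d + n) ^ (7 + 4) :=
    (add_four_pow_le hn hd).trans (pow_le_pow_mul hN (by norm_num) le_rfl)
  calc _ ≤ (P.d + n) ^ (7 + 4) * (P.d + n) ^ (11 + c) := Nat.mul_le_mul e6 (e4.trans e5)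
    _ = _ := by rw [← pow_add]; congr 1; ring

end Costs


/-! ### Hybrid arguments over many samples -/

section MultiSample

variable {Ω Ω' : Type} [Fintype Ω] [Fintype Ω']

theorem prob_injective_of_card {f : Ω → Ω'} (hf : Function.Injective f)
    (hc : Fintype.card Ω = Fintype.card Ω') (p : Ω' → Prop) :
    prob (fun ω => p (f ω)) = prob p :=
  prob_equiv (Equiv.ofBijective f ((Fintype.bijective_iff_injective_and_card f).mpr ⟨hf, hc⟩)) p

variable {I Ω₀ Ω₁ β : Type} [Fintype I] [DecidableEq I] [Fintype Ω₀] [Fintype Ω₁]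
  [Nonempty Ω₀] [Nonempty Ω₁]

/-- Resampling one coordinate does not change the law: exchanging the old coordinate with the fresh
sample is injective. -/
theorem prob_update_fst (j : I) (p : (I → Ω₀) × Ω → Prop) :
    prob (fun ω : ((I → Ω₀) × Ω) × Ω₀ => p (Function.update ω.1.1 j ω.2, ω.1.2)) = prob p := by
  rw [← prob_fst (Ω' := Ω₀) p]
  refine prob_injective (Ω := ((I → Ω₀) × Ω) × Ω₀)
    (f := fun ω => ((Function.update ω.1.1 j ω.2, ω.1.2), ω.1.1 j)) ?_ (fun ω => p ω.1)
  rintro ⟨⟨u, v⟩, a⟩ ⟨⟨u', v'⟩, a'⟩ h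
  simp only [Prod.mk.injEq] at h ⊢
  obtain ⟨⟨h1, h2⟩, h3⟩ := h
  refine ⟨⟨?_, h2⟩, ?_⟩
  · have := congrArg (fun w => Function.update w j (u j)) h1
    simp only [Function.update_idem, Function.update_eq_self] at this
    rw [this, h3, Function.update_eq_self]
  · simpa using congrFun h1 j

/-- If a test cannot distinguish one sample, with the others fixed, it cannot distinguish many. -/
theorem abs_prob_samples_sub_le (X : Ω₀ → β) (Y : Ω₁ → β) (p : (I → β) → Prop) {ε : ℝ} (hε : 0 ≤ ε)
    (h : ∀ (j : I) (v : I → β), |prob (fun a => p (Function.update v j (X a))) -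
      prob (fun a => p (Function.update v j (Y a)))| ≤ ε) :
    |prob (fun u : I → Ω₀ => p fun i => X (u i)) - prob (fun u : I → Ω₁ => p fun i => Y (u i))| ≤
      Fintype.card I * ε := by
  classical
  -- Hybrids in which the samples in `s` come from `Y` and the rest from `X`; both full families of
  -- coins are kept throughout.
  let m : Finset I → (I → Ω₀) × (I → Ω₁) → I → β := fun s ω i =>
    if i ∈ s then Y (ω.2 i) else X (ω.1 i)
  have key : ∀ s : Finset I, |prob (fun ω => p (m ∅ ω)) - prob (fun ω => p (m s ω))| ≤
      s.card * ε := by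
    intro s
    induction s using Finset.induction with
    | empty => simp
    | insert j s hj ih =>
      -- Neighbouring hybrids differ in sample j alone. Resampling it as an extra coordinate, with
      -- the rest as common randomness, reduces the step to `h`.
      have h1 : prob (fun ω => p (m s ω)) =
          prob (fun ω : ((I → Ω₀) × (I → Ω₁)) × Ω₀ => p (Function.update (m s ω.1) j (X ω.2))) := by
        rw [← prob_update_fst j]
        refine prob_congr fun ω => ?_
        have : m s (Function.update ω.1.1 j ω.2, ω.1.2) = Function.update (m s ω.1) j (X ω.2) := by
          funext i
          by_cases hi : i = j
          · subst hi; simp [m, hj]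
          · simp [m, hi]
        rw [this]
      have h2 : prob (fun ω => p (m (insert j s) ω)) =
          prob (fun ω : ((I → Ω₀) × (I → Ω₁)) × Ω₁ => p (Function.update (m s ω.1) j (Y ω.2))) := by
        rw [← prob_equiv (Equiv.prodComm (I → Ω₁) (I → Ω₀)),
          ← prob_update_fst j,
          ← prob_equiv ((Equiv.prodComm (I → Ω₁) (I → Ω₀)).prodCongr (Equiv.refl Ω₁))]
        refine prob_congr fun ω => ?_
        have : m (insert j s) (ω.1.2, Function.update ω.1.1 j ω.2) =
            Function.update (m s (ω.1.2, ω.1.1)) j (Y ω.2) := by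
          funext i
          by_cases hi : i = j
          · subst hi; simp [m]
          · simp [m, hi]
        exact iff_of_eq (congrArg p this)
      have h3 : |prob (fun ω => p (m s ω)) - prob (fun ω => p (m (insert j s) ω))| ≤ ε := by
        rw [h1, h2]
        exact abs_prob_prod_sub_le hε fun a => h j (m s a)
      rw [Finset.card_insert_of_notMem hj, Nat.cast_add, Nat.cast_one, add_mul, one_mul]
      exact (abs_sub_le _ _ _).trans (add_le_add ih h3)
  have h0 := key Finset.univ
  have m0 : ∀ ω, m ∅ ω = fun i => X (ω.1 i) := fun ω => by simp [m]
  have m1 : ∀ ω, m Finset.univ ω = fun i => Y (ω.2 i) := fun ω => by simp [m]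
  simp only [m0, m1] at h0
  have e1 := prob_fst (Ω' := I → Ω₁) fun u : I → Ω₀ => p fun i => X (u i)
  have e2 := prob_snd (Ω := I → Ω₀) fun u : I → Ω₁ => p fun i => Y (u i)
  rwa [e1, e2] at h0

end MultiSample

/-! ### The keys of one server, generated layer by layer -/

section KeyRun

variable {n : ℕ} {P : Params}

/-- The correction words of all layers, random or not. -/
abbrev KeyCoins (n : ℕ) (P : Params) : Type := (Fin P.d → Fin (3 * P.k) → CorrWord n) × Final P

/-- The values of a layer given by all the expansions of the seeds of the previous layer. -/
def childrenOf {i : ℕ} (w : Bits i → Bits (2 * (n + 2))) : Bits (i + 1) → NodeVal n :=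
  fun y => child (w (Fin.init y)) (y (Fin.last i))

theorem layer_congr (G : Bits n → Bits (2 * (n + 2))) (f : HashFam P) (b : Bool) (s : Bits n)
    {cw cw' : Fin P.d → Fin (3 * P.k) → CorrWord n} (g : Bool) {i : ℕ} (hi : i ≤ P.d)
    (h : ∀ j : Fin P.d, (j : ℕ) < i → cw j = cw' j) :
    layer G f b s (cw, g) i hi = layer G f b s (cw', g) i hi := by
  induction i with
  | zero => rfl
  | succ i ih =>
    simp only [layer]
    rw [ih (Nat.le_of_succ_le hi) fun j hj => h j (by omega), h ⟨i, hi⟩ (Nat.lt_succ_self i)]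

variable (G : Bits n → Bits (2 * (n + 2))) (E : Bits n → Fin P.B → P.𝔾) (f : HashFam P)
  (A : Set (Bits P.d)) (F : Bits P.d → Fin P.B → P.𝔾) (b : Bool) (s : Bits n)

/-- The values of the server whose view is considered. -/
noncomputable def ownLayer (cw : Fin P.d → Fin (3 * P.k) → CorrWord n) (i : ℕ) (hi : i ≤ P.d) :
    Bits i → NodeVal n := layer G f b s (cw, assign f A 0 Fin.elim0) i hi

/-- The values of the other server at active nodes. -/
noncomputable def otherNode (i : ℕ) (hi : i ≤ P.d) (S : Bits i → NodeVal n) (t : Bits i → Bits n) :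
    Bits i → NodeVal n := fun x =>
  ⟨t x, xor (S x).u (!(assign f A ⟨i, by omega⟩ x)), xor (S x).q (assign f A ⟨i, by omega⟩ x)⟩

/-- The correction words of layer `i`, where the other server has the uncorrected children `ch`. -/
noncomputable def newCW (i : ℕ) (hi : i < P.d) (ch : Bits (i + 1) → NodeVal n)
    (cw : Fin P.d → Fin (3 * P.k) → CorrWord n) : Fin (3 * P.k) → CorrWord n :=
  corr f A i hi (expand G (ownLayer G f A b s cw i hi.le)) ch (cw ⟨i, hi⟩)

noncomputable def stepCW (i : ℕ) (hi : i < P.d) (ch : Bits (i + 1) → NodeVal n)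
    (cw : Fin P.d → Fin (3 * P.k) → CorrWord n) : Fin P.d → Fin (3 * P.k) → CorrWord n :=
  Function.update cw ⟨i, hi⟩ (newCW G f A b s i hi ch cw)

/-- The seeds of the other server in layer `i + 1`. -/
noncomputable def stepSeeds (i : ℕ) (hi : i < P.d) (ch : Bits (i + 1) → NodeVal n)
    (cw : Fin P.d → Fin (3 * P.k) → CorrWord n) : Bits (i + 1) → Bits n := fun y =>
  (correct (f ⟨i, by omega⟩) (newCW G f A b s i hi ch cw)
    -- The blank seeds are placeholders: `correct` reads only the control bits of the parent, and
    -- these follow from the own ones.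
    (otherNode f A i hi.le (ownLayer G f A b s cw i hi.le) fun _ _ => false) ch y).seed

/-- The final correction word of the slot of the active leaf `x`, where `y` is the expanded leaf of
the other server. -/
noncomputable def finalWord (cw : Fin P.d → Fin (3 * P.k) → CorrWord n) (x : Bits P.d)
    (y : Fin P.B → P.𝔾) : Fin P.B → P.𝔾 :=
  let S := ownLayer G f A b s cw P.d le_rfl
  let T := otherNode f A P.d le_rfl S fun _ _ => false
  -- The node of the server that negates its share, in either case; its control bit determines the
  -- sign.
  let V := if b then S else T
  let sgn : Bool := if assign f A (Fin.last P.d) x then (V x).q else (V x).u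
  fun j =>
    let γ := F x j - ((if b then y j else E (S x).seed j) - (if b then E (S x).seed j else y j))
    if sgn then -γ else γ

open Classical in
/-- The final correction words, where `y` are the expanded leaves of the other server. -/
noncomputable def finalWords (y : Bits P.d → Fin P.B → P.𝔾) (co : KeyCoins n P) : Final P := fun m =>
  if h : ∃ x : Bits P.d, x ∈ A ∧ f (Fin.last P.d) x (assign f A (Fin.last P.d) x) = m then
    finalWord G E f A F b s co.1 h.choose (y h.choose)
  else co.2 m

/-- The generation of the keys from layer `i` on, where the other server has the seeds `t` in that
layer. -/
noncomputable def run : (r i : ℕ) → i + r = P.d → (Bits i → Bits n) → KeyCoins n P → KeyCoins n P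
  | 0, _, h, t, co => (co.1, finalWords G E f A F b s (fun x => E (t fun j => x (Fin.cast h j))) co)
  | r + 1, i, h, t, co =>
    run r (i + 1) (by omega)
      (stepSeeds G f A b s i (by omega) (childrenOf fun x => G (t x)) co.1)
      (stepCW G f A b s i (by omega) (childrenOf fun x => G (t x)) co.1, co.2)

variable {G E f A F b s}

theorem newCW_congr {i : ℕ} {hi : i < P.d} {ch ch' : Bits (i + 1) → NodeVal n}
    (h : ∀ y, OnPath A i hi.le (Fin.init y) → ch y = ch' y)
    (cw : Fin P.d → Fin (3 * P.k) → CorrWord n) :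
    newCW G f A b s i hi ch cw = newCW G f A b s i hi ch' cw :=
  corr_congr (fun _ _ => rfl) h

theorem finalWords_congr {y y' : Bits P.d → Fin P.B → P.𝔾} (h : ∀ x ∈ A, y x = y' x)
    (co : KeyCoins n P) : finalWords G E f A F b s y co = finalWords G E f A F b s y' co := by
  funext m
  unfold finalWords
  split_ifs with h1
  · rw [h _ h1.choose_spec.1]
  · rfl

/-- The keys depend only on the seeds at active nodes. -/
theorem run_congr (r i : ℕ) (h : i + r = P.d) {t t' : Bits i → Bits n}
    (ht : ∀ x, OnPath A i (by omega) x → t x = t' x) (co : KeyCoins n P) :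
    run G E f A F b s r i h t co = run G E f A F b s r i h t' co := by
  induction r generalizing i co with
  | zero =>
    have h' : i = P.d := h
    subst h'
    simp only [run]
    rw [finalWords_congr (y' := fun x => E (t' fun j => x (Fin.cast h j))) fun x hx =>
      congrArg E (ht _ (onPath_last.mpr hx))]
  | succ r ih =>
    have hch : ∀ y : Bits (i + 1), OnPath A i (by omega) (Fin.init y) →
        childrenOf (fun x => G (t x)) y = childrenOf (fun x => G (t' x)) y := fun y hy => by
      simp only [childrenOf, ht _ hy]
    have hcw := newCW_congr (G := G) (f := f) (b := b) (s := s) (hi := by omega) hch co.1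
    simp only [run, stepCW, hcw]
    refine ih _ _ (fun y hy => ?_) _
    simp only [stepSeeds, correct, hcw, hch y hy.init]

end KeyRun


/-! ### Agreement of the layer-by-layer generation with `Gen` -/

section KeyRun

variable {n : ℕ} {P : Params} {G : Bits n → Bits (2 * (n + 2))} {E : Bits n → Fin P.B → P.𝔾}
  {f : HashFam P} {A : Set (Bits P.d)} {F : Bits P.d → Fin P.B → P.𝔾} {b : Bool} {s : Bits n}

theorem Flip.otherNode {i : ℕ} {hi : i ≤ P.d} {S T : Bits i → NodeVal n} {x : Bits i}
    (h : Flip (assign f A ⟨i, by omega⟩ x) (S x) (T x)) (t : Bits i → Bits n) :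
    (otherNode f A i hi S t x).u = (T x).u ∧ (VDPF.otherNode f A i hi S t x).q = (T x).q :=
  ⟨h.1.symm, h.2.symm⟩

/-- The layers of one server in `Gen`. -/
noncomputable def genSide (G : Bits n → Bits (2 * (n + 2))) (f : HashFam P) (A : Set (Bits P.d))
    (co : BaseCoins n P) (b : Bool) (i : ℕ) (hi : i ≤ P.d) : Bits i → NodeVal n :=
  if b then (genLayers G f A co i hi).2 else (genLayers G f A co i hi).1

theorem genSide_succ (co : BaseCoins n P) (b : Bool) (i : ℕ) (hi : i + 1 ≤ P.d) :
    genSide G f A co b (i + 1) hi = nextLayer G (f ⟨i, by omega⟩) ((genPub G f A co).1 ⟨i, hi⟩)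
      (genSide G f A co b i (Nat.le_of_succ_le hi)) := by
  cases b <;> rfl

theorem genPub_eq_corr (co : BaseCoins n P) (b : Bool) (i : ℕ) (hi : i < P.d) :
    (genPub G f A co).1 ⟨i, hi⟩ = corr f A i hi (expand G (genSide G f A co b i hi.le))
      (expand G (genSide G f A co (!b) i hi.le)) (co.2.2.1 ⟨i, hi⟩) := by
  cases b
  · exact genCW_eq ..
  · rw [corr_comm]; exact genCW_eq ..

/-- The random correction words, with those of the layers before `i` replaced by the real ones. -/
noncomputable def mixCW (G : Bits n → Bits (2 * (n + 2))) (f : HashFam P) (A : Set (Bits P.d))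
    (co : BaseCoins n P) (i : ℕ) : Fin P.d → Fin (3 * P.k) → CorrWord n := fun j =>
  if (j : ℕ) < i then (genPub G f A co).1 j else co.2.2.1 j

/-- At active nodes the other server's control bits are the own ones with one bit flipped, so its
seeds are all the state that has to be carried along. `mixCW` describes the coins after the words of
the first i layers have been made real. -/
theorem run_genLayers (hA : ∀ i, ValidAssign f A i (assign f A i)) (hne : A.Nonempty)
    (co : BaseCoins n P) (hs : s = if b then co.2.1 else co.1) (r i : ℕ) (h : i + r = P.d)
    {t : Bits i → Bits n}
    (ht : ∀ x, OnPath A i (by omega) x → t x = (genSide G f A co (!b) i (by omega) x).seed) :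
    run G E f A F b s r i h t (mixCW G f A co i, co.2.2.2) =
      ((genPub G f A co).1, genFinal G E f A F co) := by
  have hown : ∀ i hi, ownLayer G f A b s (mixCW G f A co i) i hi = genSide G f A co b i hi := by
    intro i hi
    have := layer_congr (cw := mixCW G f A co i) (cw' := (genPub G f A co).1) G f b s
      (assign f A 0 Fin.elim0) hi fun j hj => if_pos hj
    rw [ownLayer, this, hs]
    exact layer_genPub G co b i hi
  have hflip : ∀ i (hi : i ≤ P.d) x, OnPath A i hi x → Flip (assign f A ⟨i, by omega⟩ x)
      (genSide G f A co b i hi x) (genSide G f A co (!b) i hi x) := by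
    intro i hi x hx
    have := (genLayers_invariant hA hne G co i hi x).1 hx
    cases b
    · exact this
    · exact this.symm
  induction r generalizing i with
  | zero =>
    have h' : i = P.d := h
    subst h'
    simp only [run]
    have e1 : mixCW G f A co P.d = (genPub G f A co).1 := funext fun j => if_pos j.isLt
    rw [Prod.mk.injEq]
    refine ⟨e1, ?_⟩
    funext m
    unfold finalWords genFinal
    dsimp only
    by_cases h1 : ∃ x : Bits P.d, x ∈ A ∧ f (Fin.last P.d) x (assign f A (Fin.last P.d) x) = m
    · rw [dif_pos h1, dif_pos h1]
      have hx := onPath_last.mpr h1.choose_spec.1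
      generalize h1.choose = x at hx
      obtain ⟨e2, e3⟩ := (hflip P.d le_rfl x hx).otherNode (hi := le_rfl) (fun _ _ => false)
      have e4 : E (t fun j => x (Fin.cast h j)) = E (genSide G f A co (!b) P.d le_rfl x).seed :=
        congrArg E (ht x hx)
      funext j
      simp only [finalWord, hown, e4]
      cases b
      · simp only [Bool.false_eq_true, if_false, e2, e3]
        simp only [genSide, Bool.not_false, if_true, Bool.false_eq_true, if_false, sub_sub_eq_add_sub]
        simp only [sub_add_eq_add_sub]
      · simp only [if_true]
        simp only [genSide, Bool.not_true, if_true, Bool.false_eq_true, if_false, sub_sub_eq_add_sub]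
        simp only [sub_add_eq_add_sub]
    · rw [dif_neg h1, dif_neg h1]
  | succ r ih =>
    have hi : i < P.d := by omega
    have hch : ∀ y : Bits (i + 1), OnPath A i hi.le (Fin.init y) →
        childrenOf (fun x => G (t x)) y = expand G (genSide G f A co (!b) i hi.le) y := fun y hy => by
      simp only [childrenOf, expand, ht _ hy]
    have hcw : newCW G f A b s i hi (childrenOf fun x => G (t x)) (mixCW G f A co i) =
        (genPub G f A co).1 ⟨i, hi⟩ := by
      rw [newCW_congr hch, newCW, hown, genPub_eq_corr co b]
      congr 1
      exact if_neg (lt_irrefl i)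
    have hstep : stepCW G f A b s i hi (childrenOf fun x => G (t x)) (mixCW G f A co i) =
        mixCW G f A co (i + 1) := by
      funext j
      rw [stepCW, hcw]
      by_cases hj : j = ⟨i, hi⟩
      · subst hj
        rw [Function.update_self]
        exact (if_pos (Nat.lt_succ_self i)).symm
      · have hj' : (j : ℕ) ≠ i := fun he => hj (Fin.ext he)
        rw [Function.update_of_ne hj]
        unfold mixCW
        by_cases hji : (j : ℕ) < i
        · rw [if_pos hji, if_pos (by omega)]
        · rw [if_neg hji, if_neg (by omega)]
    simp only [run, hstep]
    refine ih (i + 1) (by omega) (fun y hy => ?_) hflip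
    obtain ⟨e2, e3⟩ := (hflip i hi.le _ hy.init).otherNode (hi := hi.le) (fun _ _ => false)
    rw [genSide_succ, nextLayer_eq, stepSeeds, hcw, hown]
    simp only [correct, e2, e3, hch y hy.init]

theorem run_zero (hA : ∀ i, ValidAssign f A i (assign f A i)) (hne : A.Nonempty)
    (co : BaseCoins n P) :
    run G E f A F b (if b then co.2.1 else co.1) P.d 0 (Nat.zero_add _)
      (fun _ => if b then co.1 else co.2.1) co.2.2 =
      ((genPub G f A co).1, genFinal G E f A F co) := by
  rw [← run_genLayers (F := F) (E := E) hA hne co rfl P.d 0 (Nat.zero_add _)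
    (t := fun _ => if b then co.1 else co.2.1)]
  · have : mixCW G f A co 0 = co.2.2.1 := funext fun j => if_neg (Nat.not_lt_zero _)
    rw [this]
  · intro x _
    cases b <;> rfl

/-! ### The correction words hide the values of the other server -/

/-- Children given by their bits. -/
def nodesOf {i : ℕ} (W : Bits i → Bits n × Bool × Bool) : Bits i → NodeVal n :=
  fun y => ⟨(W y).1, (W y).2.1, (W y).2.2⟩

open Classical in
/-- The exchange of the random values of a layer with the correction words and the seeds of the next
layer. -/
noncomputable def swapLayer (G : Bits n → Bits (2 * (n + 2))) (f : HashFam P) (A : Set (Bits P.d))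
    (b : Bool) (s : Bits n) (i : ℕ) (hi : i < P.d)
    (ω : KeyCoins n P × (Bits (i + 1) → Bits n × Bool × Bool)) :
    KeyCoins n P × (Bits (i + 1) → Bits n × Bool × Bool) :=
  ((stepCW G f A b s i hi (nodesOf ω.2) ω.1.1, ω.1.2), fun y =>
    let x : Bits i := Fin.init y
    let w := ω.1.1 ⟨i, hi⟩ (f ⟨i, by omega⟩ x (assign f A ⟨i, by omega⟩ x))
    if OnPath A i hi.le x then
      (if OnPath A (i + 1) hi y then stepSeeds G f A b s i hi (nodesOf ω.2) ω.1.1 y else w.1,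
        w.2.1 (y (Fin.last i)), w.2.2 (y (Fin.last i)))
    else ω.2 y)

/-- The swap loses no information. The published words and the own layer, which depends on earlier
words only, give back the other server's control bits and the seeds of inactive children. The seeds
of active children are recovered by undoing the correction of the new seeds. The overwritten random
words are returned in the second component. Hence uniform children make the correction words and the
next seeds jointly uniform. -/
theorem swapLayer_injective (hA : ∀ i, ValidAssign f A i (assign f A i)) (i : ℕ) (hi : i < P.d) :
    Function.Injective (swapLayer G f A b s i hi) := by
  classical
  rintro ⟨⟨r, fw⟩, W⟩ ⟨⟨r', fw'⟩, W'⟩ h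
  simp only [swapLayer, Prod.mk.injEq] at h
  obtain ⟨⟨hcw, rfl⟩, hW⟩ := h
  have hr : ∀ j, j ≠ ⟨i, hi⟩ → r j = r' j := fun j hj => by
    have := congrFun hcw j
    rwa [stepCW, stepCW, Function.update_of_ne hj, Function.update_of_ne hj] at this
  have hown : ownLayer G f A b s r i hi.le = ownLayer G f A b s r' i hi.le :=
    layer_congr _ _ _ _ _ _ fun j hj => hr j fun he => by
      rw [he] at hj; exact lt_irrefl i hj
  have hnew : newCW G f A b s i hi (nodesOf W) r = newCW G f A b s i hi (nodesOf W') r' := by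
    have := congrFun hcw ⟨i, hi⟩
    rwa [stepCW, stepCW, Function.update_self, Function.update_self] at this
  have hWW : ∀ y, W y = W' y := by
    intro y
    have hy := congrFun hW y
    by_cases hx : OnPath A i hi.le (Fin.init y)
    · simp only [hx, if_true, Prod.mk.injEq] at hy
      have hc := congrFun hnew (f ⟨i, by omega⟩ (Fin.init y) (assign f A ⟨i, by omega⟩ (Fin.init y)))
      rw [newCW, newCW, hown, corr_slot hA _ _ _ hx, corr_slot hA _ _ _ hx] at hc
      have hu := congrFun (congrArg (fun w => w.2.1) hc) (y (Fin.last i))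
      have hq := congrFun (congrArg (fun w => w.2.2) hc) (y (Fin.last i))
      simp only [corrAt_u, corrAt_q, nodesOf, Bool.xor_left_inj, Bool.xor_right_inj] at hu hq
      refine Prod.ext ?_ (Prod.ext hu hq)
      -- At an active child the seed is recovered from the corrected seed; at an inactive child it
      -- is recovered from the seed correction, which equals the sum of both seeds.
      by_cases hy' : OnPath A (i + 1) hi y
      · simp only [hy', if_true] at hy
        have := hy.1
        rw [stepSeeds, stepSeeds, hnew, hown] at this
        funext j
        have := congrFun this j
        simpa only [correct, applyCW, nodesOf, Bool.xor_left_inj] using this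
      · have hs := congrArg (fun w => w.1) hc
        simp only [corrAt_seed_of_off _ _ _ hx hy'] at hs
        funext j
        have := congrFun hs j
        simpa only [nodesOf, Bool.xor_right_inj] using this
    · simpa only [hx, if_false] using hy
  have hW' : W = W' := funext hWW
  subst hW'
  simp only [Prod.mk.injEq, and_true]
  funext j
  by_cases hj : j = ⟨i, hi⟩
  swap
  · exact hr j hj
  subst hj
  funext m
  by_cases hm : ∃ x : Bits i, OnPath A i hi.le x ∧
      f ⟨i, by omega⟩ x (assign f A ⟨i, by omega⟩ x) = m
  · obtain ⟨x, hx, rfl⟩ := hm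
    have hy := fun c : Bool => congrFun hW (Fin.snoc (α := fun _ => Bool) x c)
    simp only [Fin.init_snoc, Fin.snoc_last, hx, if_true, Prod.mk.injEq] at hy
    refine Prod.ext ?_ (Prod.ext (funext fun c => (hy c).2.1) (funext fun c => (hy c).2.2))
    -- If both children are active, the random seed correction is itself the published one;
    -- otherwise it was stored at an inactive child.
    by_cases hon : ∀ c : Bool, OnPath A (i + 1) hi (Fin.snoc (α := fun _ => Bool) x c)
    · have hc := congrFun hnew (f ⟨i, by omega⟩ x (assign f A ⟨i, by omega⟩ x))
      rw [newCW, newCW, hown, corr_slot hA _ _ _ hx, corr_slot hA _ _ _ hx] at hc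
      have := congrArg (fun w => w.1) hc
      simpa only [corrAt_seed_of_on _ _ _ hon] using this
    · push Not at hon
      obtain ⟨c, hc⟩ := hon
      simpa only [hc, if_false] using (hy c).1
  · push Not at hm
    have hc := congrFun hnew m
    rwa [newCW, newCW, corr_of_forall_ne _ _ _ hm, corr_of_forall_ne _ _ _ hm] at hc

/-- The exchange of the random final words with the real ones. -/
noncomputable def swapFinal (G : Bits n → Bits (2 * (n + 2))) (E : Bits n → Fin P.B → P.𝔾)
    (f : HashFam P) (A : Set (Bits P.d)) (F : Bits P.d → Fin P.B → P.𝔾) (b : Bool) (s : Bits n)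
    (ω : KeyCoins n P × (Bits P.d → Fin P.B → P.𝔾)) :
    KeyCoins n P × (Bits P.d → Fin P.B → P.𝔾) :=
  open Classical in
  ((ω.1.1, finalWords G E f A F b s ω.2 ω.1), fun x =>
    if x ∈ A then ω.1.2 (f (Fin.last P.d) x (assign f A (Fin.last P.d) x)) else ω.2 x)

/-- In each coordinate the word is a constant plus or minus the value of `y`. -/
theorem finalWord_injective (cw : Fin P.d → Fin (3 * P.k) → CorrWord n) (x : Bits P.d) :
    Function.Injective (finalWord G E f A F b s cw x) := by
  intro y y' h
  funext j
  have := congrFun h j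
  simp only [finalWord] at this
  split_ifs at this <;> simpa using this

theorem finalWords_slot (hA : ∀ i, ValidAssign f A i (assign f A i))
    (y : Bits P.d → Fin P.B → P.𝔾) (co : KeyCoins n P) {x : Bits P.d} (hx : x ∈ A) :
    finalWords G E f A F b s y co (f (Fin.last P.d) x (assign f A (Fin.last P.d) x)) =
      finalWord G E f A F b s co.1 x (y x) := by
  have h : ∃ x' : Bits P.d, x' ∈ A ∧ f (Fin.last P.d) x' (assign f A (Fin.last P.d) x') =
      f (Fin.last P.d) x (assign f A (Fin.last P.d) x) := ⟨x, hx, rfl⟩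
  have hc : h.choose = x := hA (Fin.last P.d) (onPath_last.mpr h.choose_spec.1)
    (onPath_last.mpr hx) h.choose_spec.2
  rw [finalWords, dif_pos h, hc]

/-- The words in the assigned slots determine `y` at the active leaves, and the second component
keeps the random words they replaced. Uniform leaf blocks are therefore one-time pads for the last
layer. -/
theorem swapFinal_injective (hA : ∀ i, ValidAssign f A i (assign f A i)) :
    Function.Injective (swapFinal (n := n) G E f A F b s) := by
  classical
  rintro ⟨⟨r, fw⟩, y⟩ ⟨⟨r', fw'⟩, y'⟩ h
  simp only [swapFinal, Prod.mk.injEq] at h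
  obtain ⟨⟨rfl, hfw⟩, hy⟩ := h
  have hyy : y = y' := by
    funext x
    by_cases hx : x ∈ A
    · have := congrFun hfw (f (Fin.last P.d) x (assign f A (Fin.last P.d) x))
      rw [finalWords_slot hA _ _ hx, finalWords_slot hA _ _ hx] at this
      exact finalWord_injective _ _ this
    · simpa only [hx, if_false] using congrFun hy x
  subst hyy
  simp only [Prod.mk.injEq, true_and, and_true]
  funext m
  by_cases hm : ∃ x : Bits P.d, x ∈ A ∧ f (Fin.last P.d) x (assign f A (Fin.last P.d) x) = m
  · obtain ⟨x, hx, rfl⟩ := hm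
    simpa only [hx, if_true] using congrFun hy x
  · have := congrFun hfw m
    rwa [finalWords, finalWords, dif_neg hm, dif_neg hm] at this

end KeyRun


/-! ### Gate counts of the key generation -/

section KeyCost

variable {Ω : Type} {U : Set (Ω → Bool)} {n : ℕ} {P : Params}

/-- Indices of the bits of the correction words. -/
abbrev KeyIx (n : ℕ) (P : Params) : Type :=
  (Fin P.d × Fin (3 * P.k) × Bool × (Fin n ⊕ Bool)) ⊕ (Fin (3 * P.k) × Fin P.B × Fin P.bitLen)

/-- The bits of the correction words. -/
def keyBits (co : KeyCoins n P) : KeyIx n P → Bool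
  | .inl t => cwBit (co.1 t.1 t.2.1) t.2.2.1 t.2.2.2
  | .inr t => P.enc (co.2 t.1 t.2.1) t.2.2

/-- The bits of the correction words of a layer. -/
def cwFam {N : ℕ} (w : Ω → Fin N → CorrWord n) : Set (Ω → Bool) :=
  fam fun ω (t : Fin N × Bool × (Fin n ⊕ Bool)) => cwBit (w ω t.1) t.2.1 t.2.2

theorem mem_cwFam {N : ℕ} (w : Ω → Fin N → CorrWord n) (m : Fin N) (c : Bool) (z : Fin n ⊕ Bool) :
    (fun ω => cwBit (w ω m) c z) ∈ cwFam w := ⟨(m, c, z), rfl⟩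

/-- The bits of a group element. -/
def famG (X : Ω → P.𝔾) : Set (Ω → Bool) := fam fun ω (t : Fin P.bitLen) => P.enc (X ω) t

theorem Cost.constG (hU : ∀ c : Bool, (fun _ => c) ∈ U) (a : P.𝔾) :
    Cost U (famG fun _ : Ω => a) 0 :=
  .of_subset (by rintro _ ⟨t, rfl⟩; exact hU _)

/-- Subtraction is the only group operation with an assumed circuit; sums and negatives are
expressed through it. -/
theorem Cost.subG {Cs : Circuit (Bool × Fin P.bitLen) (Fin P.bitLen)}
    (hCs : ∀ a b : P.𝔾, Cs.eval (fun t => P.enc (if t.1 then b else a) t.2) = P.enc (a - b))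
    {X Y : Ω → P.𝔾} {s t : ℕ} (hX : Cost U (famG X) s) (hY : Cost U (famG Y) t) :
    Cost U (famG fun ω => X ω - Y ω) (s + t + Cs.size) := by
  have h : Cost U (fam fun ω (t : Bool × Fin P.bitLen) => P.enc (if t.1 then Y ω else X ω) t.2)
      (s + t) := by
    refine (hX.union hY).mono le_rfl ?_ le_rfl
    rintro _ ⟨⟨_ | _, t⟩, rfl⟩
    · exact Or.inl ⟨t, rfl⟩
    · exact Or.inr ⟨t, rfl⟩
  refine (h.circuit Cs).mono le_rfl ?_ le_rfl
  rintro _ ⟨t, rfl⟩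
  refine ⟨t, funext fun ω => ?_⟩
  exact congrFun (hCs (X ω) (Y ω)) t

theorem Cost.muxG {φ : Ω → Bool} {X Y : Ω → P.𝔾} {r s t : ℕ} (hφ : Cost U {φ} r)
    (hX : Cost U (famG X) s) (hY : Cost U (famG Y) t) :
    Cost U (famG fun ω => if φ ω then X ω else Y ω) (r + s + t + P.bitLen * 8) := by
  refine ((hφ.union hX).union hY).then ?_
  have := Cost.pi (S := U ∪ (({φ} ∪ famG X) ∪ famG Y)) (s := 8)
    (X := fun ω (t : Fin P.bitLen) => P.enc (if φ ω then X ω else Y ω) t) fun j => by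
      have e1 : Cost (U ∪ (({φ} ∪ famG X) ∪ famG Y)) {φ} 0 := .of_mem (Or.inr (Or.inl (Or.inl rfl)))
      have e2 : Cost (U ∪ (({φ} ∪ famG X) ∪ famG Y)) {fun ω => P.enc (X ω) j} 0 :=
        .of_mem (Or.inr (Or.inl (Or.inr ⟨j, rfl⟩)))
      have e3 : Cost (U ∪ (({φ} ∪ famG X) ∪ famG Y)) {fun ω => P.enc (Y ω) j} 0 :=
        .of_mem (Or.inr (Or.inr ⟨j, rfl⟩))
      refine ((e1.and e2).or (e1.not.and e3)).mono le_rfl ?_ (by omega)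
      simp only [Set.singleton_subset_iff, Set.mem_singleton_iff]
      funext ω
      cases φ ω <;> simp
  rwa [Fintype.card_fin] at this

variable {f : HashFam P} {A : Set (Bits P.d)}

/-- The hash functions and active leaves are fixed, so all case distinctions are settled when the
circuit is built; only a few exclusive ors per bit remain. -/
theorem Cost.corr (hU : ∀ c : Bool, (fun _ => c) ∈ U) {i : ℕ} {hi : i < P.d}
    {s t : Ω → Bits (i + 1) → NodeVal n} {rnd : Ω → Fin (3 * P.k) → CorrWord n}
    (hs : famN s ⊆ U) (ht : famN t ⊆ U) (hr : cwFam rnd ⊆ U) :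
    Cost U (cwFam fun ω => corr f A i hi (s ω) (t ω) (rnd ω)) (3 * P.k * (2 * (n + 2)) * 16) := by
  have := Cost.pi (S := U) (s := 16) (X := fun ω (z : Fin (3 * P.k) × Bool × (Fin n ⊕ Bool)) =>
      cwBit (VDPF.corr f A i hi (s ω) (t ω) (rnd ω) z.1) z.2.1 z.2.2) fun z => by
    obtain ⟨m, c, z⟩ := z
    have es := fun y z => Cost.of_mem (s := 0) (hs (mem_famN s y z))
    have et := fun y z => Cost.of_mem (s := 0) (ht (mem_famN t y z))
    have er := fun z => Cost.of_mem (s := 0) (hr (mem_cwFam rnd m c z))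
    have ec := fun c : Bool => Cost.of_mem (s := 0) (hU c)
    by_cases h : ∃ x : Bits i, OnPath A i hi.le x ∧
        f ⟨i, by omega⟩ x (assign f A ⟨i, by omega⟩ x) = m
    · simp only [VDPF.corr, dif_pos h]
      rcases z with j | _ | _
      · simp only [cwBit, corrAt]
        split_ifs
        · exact (er (.inl j)).le (by omega)
        · exact ((es _ (.inl j)).xor (et _ (.inl j))).le (by omega)
        · exact ((es _ (.inl j)).xor (et _ (.inl j))).le (by omega)
      · exact (((es _ (.inr false)).xor (et _ (.inr false))).xor (ec _)).le (by omega)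
      · exact (((es _ (.inr true)).xor (et _ (.inr true))).xor (ec _)).le (by omega)
    · simp only [VDPF.corr, dif_neg h]
      exact (er z).le (by omega)
  rw [Fintype.card_prod, Fintype.card_prod, Fintype.card_sum, Fintype.card_fin, Fintype.card_fin,
    Fintype.card_bool] at this
  exact this

variable {G : Bits n → Bits (2 * (n + 2))} {E : Bits n → Fin P.B → P.𝔾}
  {F : Bits P.d → Fin P.B → P.𝔾} {b : Bool} {s : Bits n}

theorem ownLayer_stepCW (i : ℕ) (hi : i < P.d) (ch : Bits (i + 1) → NodeVal n)
    (cw : Fin P.d → Fin (3 * P.k) → CorrWord n) :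
    ownLayer G f A b s (stepCW G f A b s i hi ch cw) (i + 1) hi =
      correct (f ⟨i, by omega⟩) (newCW G f A b s i hi ch cw) (ownLayer G f A b s cw i hi.le)
        (expand G (ownLayer G f A b s cw i hi.le)) := by
  have h : layer G f b s (stepCW G f A b s i hi ch cw, assign f A 0 Fin.elim0) i hi.le =
      layer G f b s (cw, assign f A 0 Fin.elim0) i hi.le :=
    layer_congr _ _ _ _ _ _ fun j hj => Function.update_of_ne (fun he => by
      rw [he] at hj; exact lt_irrefl i hj) _ _
  simp only [ownLayer, layer, nextLayer_eq, h]
  rw [stepCW, Function.update_self]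

/-- The bits of the state in the generation of the keys. -/
def keyState (G : Bits n → Bits (2 * (n + 2))) (f : HashFam P) (A : Set (Bits P.d)) (b : Bool)
    (s : Bits n) (i : ℕ) (hi : i ≤ P.d) (cw : Ω → Fin P.d → Fin (3 * P.k) → CorrWord n)
    (t : Ω → Bits i → Bits n) : Set (Ω → Bool) :=
  (⋃ j, cwFam fun ω => cw ω j) ∪ famN (fun ω => ownLayer G f A b s (cw ω) i hi) ∪
    fam fun ω (z : Bits i × Fin n) => t ω z.1 z.2

/-- The number of gates for one layer of the key generation, if `g` gates suffice for the
generator. -/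
def stepCost (n : ℕ) (P : Params) (g : ℕ) : ℕ :=
  2 ^ P.d * g + 3 * P.k * (2 * (n + 2)) * 16 + 2 ^ P.d * ((n + 2) * 20) + 2 ^ P.d * ((n + 2) * 8) +
    2 ^ P.d * ((n + 2) * 20)

theorem cost_step (C : Circuit (Fin n) (Fin (2 * (n + 2)))) (hC : ∀ x, C.eval x = G x)
    (hU : ∀ c : Bool, (fun _ => c) ∈ U) {i : ℕ} {hi : i < P.d}
    {cw : Ω → Fin P.d → Fin (3 * P.k) → CorrWord n} {ch : Ω → Bits (i + 1) → NodeVal n}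
    (hcw : ∀ j, (cwFam fun ω => cw ω j) ⊆ U)
    (hS : famN (fun ω => ownLayer G f A b s (cw ω) i hi.le) ⊆ U) (hch : famN ch ⊆ U) :
    Cost U (keyState G f A b s (i + 1) hi (fun ω => stepCW G f A b s i hi (ch ω) (cw ω))
      fun ω => stepSeeds G f A b s i hi (ch ω) (cw ω)) (stepCost n P C.size) := by
  have hp : 2 ^ (i + 1) ≤ 2 ^ P.d := Nat.pow_le_pow_right (by norm_num) hi
  have hp' : 2 ^ i ≤ 2 ^ P.d := Nat.pow_le_pow_right (by norm_num) hi.le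
  set S := fun ω => ownLayer G f A b s (cw ω) i hi.le with hSdef
  set S' := fun ω => expand G (S ω) with hS'def
  set w := fun ω => newCW G f A b s i hi (ch ω) (cw ω) with hw
  set T := fun ω => otherNode f A i hi.le (S ω) fun _ _ => false with hT
  have h1 : Cost U (famN S') (2 ^ P.d * C.size) :=
    (Cost.nodes fun y => ((Cost.of_subset (s := 0) hS).expandNode C hC y).le
      (zero_add _).le).le (Nat.mul_le_mul_right _ hp)
  have h2 : Cost (U ∪ famN S') (cwFam w) (3 * P.k * (2 * (n + 2)) * 16) :=
    Cost.corr (fun c => Or.inl (hU c)) Set.subset_union_right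
      (hch.trans Set.subset_union_left) ((hcw ⟨i, hi⟩).trans Set.subset_union_left)
  have h12 := h1.trans h2
  set U2 := U ∪ (famN S' ∪ cwFam w) with hU2
  have hw2 : ∀ (y : Bits (i + 1)) (c : Bool) (z : Fin n ⊕ Bool), Cost U2
      {fun ω => cwBit (w ω (f ⟨i, by omega⟩ (Fin.init y) c)) (y (Fin.last i)) z} 0 := fun y c z =>
    .of_mem (Or.inr (Or.inr (mem_cwFam w _ _ z)))
  have h3 : Cost U2 (famN fun ω => correct (f ⟨i, by omega⟩) (w ω) (S ω) (S' ω))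
      (2 ^ P.d * ((n + 2) * 20)) := by
    refine (Cost.nodes (s := (n + 2) * 20) fun y => (Cost.correctNode (s := 0) (t := 0)
      (f := fun _ => f ⟨i, by omega⟩) (hS.trans Set.subset_union_left) (.of_subset ?_)
      (hw2 y)).le (by omega)).le (Nat.mul_le_mul_right _ hp)
    rintro _ ⟨z, rfl⟩
    exact Or.inr (Or.inl (mem_famN S' y z))
  have h4 : Cost U2 (famN T) (2 ^ P.d * ((n + 2) * 8)) := by
    refine (Cost.nodes (s := (n + 2) * 8) fun x => ?_).le (Nat.mul_le_mul_right _ hp')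
    have := Cost.pi (S := U2) (s := 8) (X := fun ω => (T ω x).bit) fun z => by
      have ec := fun c : Bool => Cost.of_mem (S := U2) (s := 0) (Or.inl (hU c))
      have es := fun z => Cost.of_mem (S := U2) (s := 0) (Or.inl (hS (mem_famN S x z)))
      rcases z with j | _ | _
      · exact (ec false).le (by omega)
      · exact ((es (.inr false)).xor (ec _)).le (by omega)
      · exact ((es (.inr true)).xor (ec _)).le (by omega)
    rwa [Fintype.card_sum, Fintype.card_fin, Fintype.card_bool] at this
  have h5 : Cost (U2 ∪ famN T) (famN fun ω => correct (f ⟨i, by omega⟩) (w ω) (T ω) (ch ω))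
      (2 ^ P.d * ((n + 2) * 20)) := by
    refine (Cost.nodes (s := (n + 2) * 20) fun y => (Cost.correctNode (s := 0) (t := 0)
      (f := fun _ => f ⟨i, by omega⟩) Set.subset_union_right (.of_subset ?_)
      (fun c z => (hw2 y c z).mono Set.subset_union_left le_rfl le_rfl)).le (by omega)).le
      (Nat.mul_le_mul_right _ hp)
    rintro _ ⟨z, rfl⟩
    exact Or.inl (Or.inl (hch (mem_famN ch y z)))
  have h345 := h12.trans (h3.union (h4.then h5))
  have h0 : Cost U U 0 := .of_subset le_rfl
  refine (h0.union h345).mono le_rfl ?_ (by unfold stepCost; omega)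
  rintro φ ((hφ | hφ) | hφ)
  · obtain ⟨j, hφ⟩ := Set.mem_iUnion.mp hφ
    by_cases hj : j = ⟨i, hi⟩
    · subst hj
      simp only [stepCW, Function.update_self] at hφ
      exact Or.inr (Or.inl (Or.inr hφ))
    · simp only [stepCW, Function.update_of_ne hj] at hφ
      exact Or.inl (hcw j hφ)
  · simp only [ownLayer_stepCW] at hφ
    exact Or.inr (Or.inr (Or.inl hφ))
  · obtain ⟨⟨y, j⟩, rfl⟩ := hφ
    exact Or.inr (Or.inr (Or.inr (mem_famN _ y (.inl j))))

/-- The number of gates for the final correction words. -/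
def finalCost (P : Params) (g' c : ℕ) : ℕ := 3 * P.k * (g' + P.B * (5 * c + 16 + P.bitLen * 8))

theorem cost_final (C' : Circuit (Fin n) (Fin P.B × Fin P.bitLen))
    (hC' : ∀ x, C'.eval x = P.encBlock (E x)) (Cs : Circuit (Bool × Fin P.bitLen) (Fin P.bitLen))
    (hCs : ∀ a b : P.𝔾, Cs.eval (fun t => P.enc (if t.1 then b else a) t.2) = P.enc (a - b))
    (hU : ∀ c : Bool, (fun _ => c) ∈ U)
    {cw : Ω → Fin P.d → Fin (3 * P.k) → CorrWord n} {y : Ω → Bits P.d → Fin P.B → P.𝔾}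
    {fw : Ω → Final P} (hcw : ∀ j, (cwFam fun ω => cw ω j) ⊆ U)
    (hS : famN (fun ω => ownLayer G f A b s (cw ω) P.d le_rfl) ⊆ U)
    (hy : ∀ x j, famG (fun ω => y ω x j) ⊆ U) (hf : ∀ m j, famG (fun ω => fw ω m j) ⊆ U) :
    Cost U (fam fun ω => keyBits (cw ω, finalWords G E f A F b s (y ω) (cw ω, fw ω)))
      (finalCost P C'.size Cs.size) := by
  set S := fun ω => ownLayer G f A b s (cw ω) P.d le_rfl with hSdef
  have hword : ∀ x, Cost U (fam fun ω => P.encBlock (finalWord G E f A F b s (cw ω) x (y ω x)))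
      (C'.size + P.B * (5 * Cs.size + 16 + P.bitLen * 8)) := by
    intro x
    have h1 : Cost U (fam fun ω => C'.eval (S ω x).seed) (0 + C'.size) := by
      refine Cost.circuit C' (.of_subset ?_)
      rintro _ ⟨j, rfl⟩
      exact hS (mem_famN S x (.inl j))
    simp only [hC', zero_add] at h1
    refine h1.then ?_
    set U' := U ∪ fam fun ω => P.encBlock (E (S ω x).seed)
    have ec := fun c : Bool => Cost.of_mem (S := U') (s := 0) (Or.inl (hU c))
    have es := fun z => Cost.of_mem (S := U') (s := 0) (Or.inl (hS (mem_famN S x z)))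
    have hE : ∀ j, Cost U' (famG fun ω => E (S ω x).seed j) 0 := fun j => .of_subset (by
      rintro _ ⟨t, rfl⟩
      exact Or.inr ⟨(j, t), rfl⟩)
    have hY : ∀ j, Cost U' (famG fun ω => y ω x j) 0 := fun j =>
      .of_subset ((hy x j).trans Set.subset_union_left)
    have hsgn : Cost U' {fun ω => if assign f A (Fin.last P.d) x then
        ((if b then S ω else otherNode f A P.d le_rfl (S ω) fun _ _ => false) x).q
        else ((if b then S ω else otherNode f A P.d le_rfl (S ω) fun _ _ => false) x).u} 16 := by
      split_ifs
      · exact (es (.inr true)).le (by omega)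
      · exact ((es (.inr true)).xor (ec _)).le (by omega)
      · exact (es (.inr false)).le (by omega)
      · exact ((es (.inr false)).xor (ec _)).le (by omega)
    have hγ : ∀ j, Cost U' (famG fun ω => F x j - ((if b then y ω x j else E (S ω x).seed j) -
        (if b then E (S ω x).seed j else y ω x j))) (2 * Cs.size) := by
      intro j
      have e0 := Cost.constG (P := P) (U := U') (fun c => Or.inl (hU c)) (F x j)
      cases b
      · exact (e0.subG hCs ((hE j).subG hCs (hY j))).le (by omega)
      · exact (e0.subG hCs ((hY j).subG hCs (hE j))).le (by omega)
    have hj : ∀ j, Cost U' (famG fun ω => finalWord G E f A F b s (cw ω) x (y ω x) j)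
        (5 * Cs.size + 16 + P.bitLen * 8) := by
      intro j
      have e0 := Cost.constG (P := P) (U := U') (fun c => Or.inl (hU c)) 0
      have hn := e0.subG hCs (hγ j)
      simp only [zero_sub] at hn
      exact (hsgn.muxG hn (hγ j)).le (by omega)
    have := Cost.iUnion hj
    rw [Fintype.card_fin] at this
    refine this.mono le_rfl ?_ le_rfl
    rintro _ ⟨⟨j, t⟩, rfl⟩
    exact Set.mem_iUnion.mpr ⟨j, t, rfl⟩
  have hall : ∀ m, Cost U (fam fun ω => P.encBlock (finalWords G E f A F b s (y ω) (cw ω, fw ω) m))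
      (C'.size + P.B * (5 * Cs.size + 16 + P.bitLen * 8)) := by
    intro m
    by_cases h : ∃ x : Bits P.d, x ∈ A ∧ f (Fin.last P.d) x (assign f A (Fin.last P.d) x) = m
    · simp only [finalWords, dif_pos h]
      exact hword _
    · simp only [finalWords, dif_neg h]
      refine .of_subset ?_
      rintro _ ⟨⟨j, t⟩, rfl⟩
      exact hf m j ⟨t, rfl⟩
  have := Cost.iUnion hall
  rw [Fintype.card_fin] at this
  refine ((Cost.of_subset (s := 0) (le_refl U)).union this).mono le_rfl ?_ (by
    unfold finalCost; omega)
  rintro _ ⟨⟨i, m, c, z⟩ | ⟨m, j, t⟩, rfl⟩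
  · exact Or.inl (hcw i (mem_cwFam (fun ω => cw ω i) m c z))
  · exact Or.inr (Set.mem_iUnion.mpr ⟨m, (j, t), rfl⟩)

/-- Hash functions, active leaves, the shared function and the own seed are wired in, as non-uniform
adversaries allow. Only the random words and the other server's seeds vary. -/
theorem cost_run (C : Circuit (Fin n) (Fin (2 * (n + 2)))) (hC : ∀ x, C.eval x = G x)
    (C' : Circuit (Fin n) (Fin P.B × Fin P.bitLen))
    (hC' : ∀ x, C'.eval x = P.encBlock (E x)) (Cs : Circuit (Bool × Fin P.bitLen) (Fin P.bitLen))
    (hCs : ∀ a b : P.𝔾, Cs.eval (fun t => P.enc (if t.1 then b else a) t.2) = P.enc (a - b))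
    (r i : ℕ) (h : i + r = P.d) {U : Set (Ω → Bool)} (hU : ∀ c : Bool, (fun _ => c) ∈ U)
    {cw : Ω → Fin P.d → Fin (3 * P.k) → CorrWord n} {t : Ω → Bits i → Bits n} {fw : Ω → Final P}
    (hs : keyState G f A b s i (by omega) cw t ⊆ U) (hf : ∀ m j, famG (fun ω => fw ω m j) ⊆ U) :
    Cost U (fam fun ω => keyBits (run G E f A F b s r i h (t ω) (cw ω, fw ω)))
      (r * (2 ^ P.d * C.size + stepCost n P C.size) +
        (2 ^ P.d * C'.size + finalCost P C'.size Cs.size)) := by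
  have hsplit : ∀ {i : ℕ} {hi : i ≤ P.d} {U : Set (Ω → Bool)}
      {cw : Ω → Fin P.d → Fin (3 * P.k) → CorrWord n}
      {t : Ω → Bits i → Bits n}, keyState G f A b s i hi cw t ⊆ U →
      (∀ j, (cwFam fun ω => cw ω j) ⊆ U) ∧ famN (fun ω => ownLayer G f A b s (cw ω) i hi) ⊆ U ∧
      ∀ x j, (fun ω => t ω x j) ∈ U := fun h =>
    ⟨fun j φ hφ => h (Or.inl (Or.inl (Set.mem_iUnion.mpr ⟨j, hφ⟩))),
      fun φ hφ => h (Or.inl (Or.inr hφ)), fun x j => h (Or.inr ⟨(x, j), rfl⟩)⟩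
  induction r generalizing i U cw t with
  | zero =>
    have h' : i = P.d := h
    subst h'
    obtain ⟨h1, h2, h3⟩ := hsplit hs
    have hE : ∀ x : Bits P.d, Cost U (fam fun ω => P.encBlock (E (t ω x))) C'.size := fun x => by
      have := Cost.circuit (X := fun ω => t ω x) C'
        (.of_subset (s := 0) (by rintro _ ⟨j, rfl⟩; exact h3 x j) : Cost U _ 0)
      simpa only [hC', zero_add] using this
    have hE' := Cost.iUnion hE
    rw [Fintype.card_fun, Fintype.card_bool, Fintype.card_fin] at hE'
    rw [zero_mul, zero_add]
    refine hE'.then ?_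
    refine cost_final C' hC' Cs hCs (fun c => Or.inl (hU c)) (fun j => (h1 j).trans
      Set.subset_union_left) (h2.trans Set.subset_union_left) (fun x j => ?_)
      (fun m j => (hf m j).trans Set.subset_union_left)
    rintro _ ⟨k, rfl⟩
    exact Or.inr (Set.mem_iUnion.mpr ⟨x, (j, k), rfl⟩)
  | succ r ih =>
    obtain ⟨h1, h2, h3⟩ := hsplit hs
    have hi : i < P.d := by omega
    have hw : Cost U (famN fun ω => childrenOf fun x => G (t ω x)) (2 ^ P.d * C.size) := by
      have := Cost.iUnion fun x : Bits i => show Cost U (fam fun ω => G (t ω x)) C.size by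
        have := Cost.circuit (X := fun ω => t ω x) C
          (.of_subset (s := 0) (by rintro _ ⟨j, rfl⟩; exact h3 x j) : Cost U _ 0)
        simpa only [hC, zero_add] using this
      rw [Fintype.card_fun, Fintype.card_bool, Fintype.card_fin] at this
      refine this.mono le_rfl ?_ (Nat.mul_le_mul_right _ (Nat.pow_le_pow_right (by norm_num) hi.le))
      rintro _ ⟨⟨y, j | _ | _⟩, rfl⟩ <;>
        exact Set.mem_iUnion.mpr ⟨Fin.init y, mem_fam (fun ω => G (t ω (Fin.init y))) _⟩
    have hst := hw.trans (cost_step (f := f) (A := A) (b := b) (s := s) (hi := hi) C hC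
      (fun c => Or.inl (hU c)) (fun j => (h1 j).trans Set.subset_union_left)
      (h2.trans Set.subset_union_left) Set.subset_union_right)
    refine (hst.then (ih (i + 1) (by omega) (fun c => Or.inl (hU c))
      (fun φ hφ => Or.inr (Or.inr hφ))
      (fun m j => (hf m j).trans Set.subset_union_left))).le ?_
    rw [add_mul, one_mul]
    omega

end KeyCost


/-! ### Pseudorandomness of the correction words -/

section KeySecurity

theorem Cost.consts {Ω : Type} {S : Set (Ω → Bool)} :
    Cost S (Set.range fun (c : Bool) (_ : Ω) => c) 1 := by
  refine (Cost.const_false (S := S) (s := 0)).union (Cost.const true) |>.mono le_rfl ?_ le_rfl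
  rintro _ ⟨_ | _, rfl⟩
  · exact Or.inl rfl
  · exact Or.inr rfl

/-- A test of computed values is a test of the inputs. -/
theorem Cost.exists_test {Ω ι κ : Type} {inp : Ω → ι → Bool} {X : Ω → κ → Bool} {s : ℕ}
    (h : Cost (fam inp ∪ Set.range fun (c : Bool) (_ : Ω) => c) (fam X) s) (D : Circuit κ Unit) :
    ∃ D' : Circuit ι Unit, D'.size ≤ 1 + s + D.size ∧ ∀ ω, D'.eval (inp ω) = D.eval (X ω) :=
  ((Cost.consts.then h).circuit D).exists_circuit

variable {n : ℕ} {P : Params} {G : Bits n → Bits (2 * (n + 2))} {E : Bits n → Fin P.B → P.𝔾}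
  {f : HashFam P} {A : Set (Bits P.d)} {F : Bits P.d → Fin P.B → P.𝔾} {b : Bool} {s : Bits n}

/-- Cutting the 2(n+2) bits of each node into two children loses nothing, and both types have the
same cardinality. -/
theorem prob_childrenOf {Ω : Type} [Fintype Ω] {i : ℕ} (p : Ω × (Bits (i + 1) → NodeVal n) → Prop) :
    prob (fun ω : Ω × (Bits i → Bits (2 * (n + 2))) => p (ω.1, childrenOf ω.2)) =
      prob (fun ω : Ω × (Bits (i + 1) → Bits n × Bool × Bool) => p (ω.1, nodesOf ω.2)) := by
  let T : Ω × (Bits i → Bits (2 * (n + 2))) → Ω × (Bits (i + 1) → Bits n × Bool × Bool) :=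
    fun ω => (ω.1, fun y => ((childrenOf ω.2 y).seed, (childrenOf ω.2 y).u, (childrenOf ω.2 y).q))
  have hT : Function.Injective T := by
    rintro ⟨a, w⟩ ⟨a', w'⟩ h
    simp only [T, Prod.mk.injEq] at h ⊢
    refine ⟨h.1, ?_⟩
    funext x t
    have hy : ∀ c : Bool, child (w x) c = child (w' x) c := by
      intro c
      have := congrFun h.2 (Fin.snoc (α := fun _ => Bool) x c)
      simp only [childrenOf, Fin.init_snoc, Fin.snoc_last, Prod.mk.injEq] at this
      exact NodeVal.ext' (fun j => congrFun this.1 j) this.2.1 this.2.2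
    have key : ∀ (c : Bool) (j : ℕ) (hj : (if c then n + 2 else 0) + j < 2 * (n + 2)), j < n + 2 →
        w x ⟨(if c then n + 2 else 0) + j, hj⟩ = w' x ⟨(if c then n + 2 else 0) + j, hj⟩ := by
      intro c j hj hlt
      rcases Nat.lt_or_ge j n with h1 | h1
      · exact congrFun (congrArg NodeVal.seed (hy c)) ⟨j, h1⟩
      · obtain rfl | rfl : j = n ∨ j = n + 1 := by omega
        · exact congrArg NodeVal.u (hy c)
        · exact congrArg NodeVal.q (hy c)
    have ht := t.isLt
    rcases Nat.lt_or_ge (t : ℕ) (n + 2) with h1 | h1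
    · have := key false t (by simp) h1
      simpa using this
    · have := key true (t - (n + 2)) (by simp only [if_true]; omega) (by omega)
      have e : ∀ hj, (⟨(if true = true then n + 2 else 0) + ((t : ℕ) - (n + 2)), hj⟩ :
          Fin (2 * (n + 2))) = t := fun _ => Fin.ext (by simp only [if_true]; omega)
      rwa [e] at this
  have hc : Fintype.card (Ω × (Bits i → Bits (2 * (n + 2)))) =
      Fintype.card (Ω × (Bits (i + 1) → Bits n × Bool × Bool)) := by
    simp only [Fintype.card_prod, Fintype.card_fun, Fintype.card_bool, Fintype.card_fin]
    rw [← pow_mul, show 2 ^ n * (2 * 2) = 2 ^ (n + 2) by ring, ← pow_mul]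
    ring
  exact prob_injective_of_card hT hc fun ω => p (ω.1, nodesOf ω.2)

theorem prob_seeds {Ω I α β : Type} [Fintype Ω] [Fintype I] [DecidableEq I] [Fintype α] [Fintype β]
    [Nonempty β] (p : Ω × (I → α) → Prop) :
    prob (fun ω : Ω × (I → α × β) => p (ω.1, fun i => (ω.2 i).1)) = prob p := by
  rw [← prob_fst (Ω' := I → β) p]
  let e : Ω × (I → α × β) ≃ (Ω × (I → α)) × (I → β) :=
    ⟨fun ω => ((ω.1, fun i => (ω.2 i).1), fun i => (ω.2 i).2),
      fun ω => (ω.1.1, fun i => (ω.1.2 i, ω.2 i)), fun _ => rfl, fun _ => rfl⟩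
  exact prob_equiv e fun ω => p ω.1

/-- The number of gates for the generation of the keys. -/
def keyCost (n : ℕ) (P : Params) (g g' c : ℕ) : ℕ :=
  1 + (P.d * (2 ^ P.d * g + stepCost n P g) + (2 ^ P.d * g' + finalCost P g' c))

/-- Induction on the number of remaining layers. In layer i at most 2^d expansions are replaced by
uniform strings, one at a time. The swap of the layer then turns the words into uniform ones and
leaves uniform seeds for the next layer, without any loss. The leaf generator accounts for the extra
1 in r + 1. -/
theorem abs_prob_run_sub_le (hA : ∀ i, ValidAssign f A i (assign f A i))
    (C : Circuit (Fin n) (Fin (2 * (n + 2)))) (hC : ∀ x, C.eval x = G x)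
    (C' : Circuit (Fin n) (Fin P.B × Fin P.bitLen))
    (hC' : ∀ x, C'.eval x = P.encBlock (E x)) (Cs : Circuit (Bool × Fin P.bitLen) (Fin P.bitLen))
    (hCs : ∀ a b : P.𝔾, Cs.eval (fun t => P.enc (if t.1 then b else a) t.2) = P.enc (a - b))
    {σ : ℕ} {ε : ℝ} (hε : 0 ≤ ε)
    (hG : ∀ D : Circuit (Fin (2 * (n + 2))) Unit, D.size ≤ σ →
      |prob (fun x => D.eval (G x) () = true) - prob (fun r => D.eval r () = true)| ≤ ε)
    (hE : ∀ D : Circuit (Fin P.B × Fin P.bitLen) Unit, D.size ≤ σ →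
      |prob (fun x => D.eval (P.encBlock (E x)) () = true) -
        prob (fun y => D.eval (P.encBlock y) () = true)| ≤ ε)
    (D : Circuit (KeyIx n P) Unit) (hσ : keyCost n P C.size C'.size Cs.size + D.size ≤ σ)
    (r i : ℕ) (h : i + r = P.d) :
    |prob (fun ω : KeyCoins n P × (Bits i → Bits n) =>
        D.eval (keyBits (run G E f A F b s r i h ω.2 ω.1)) () = true) -
      prob (fun co : KeyCoins n P => D.eval (keyBits co) () = true)| ≤
      (r + 1 : ℕ) * (2 ^ P.d * ε) := by
  induction r generalizing i with
  | zero =>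
    have h' : i = P.d := h
    subst h'
    have h1 : |prob (fun ω : KeyCoins n P × (Bits P.d → Bits n) =>
        D.eval (keyBits (run G E f A F b s 0 P.d h ω.2 ω.1)) () = true) -
      prob (fun ω : KeyCoins n P × (Bits P.d → Fin P.B → P.𝔾) =>
        D.eval (keyBits (ω.1.1, finalWords G E f A F b s ω.2 ω.1)) () = true)| ≤ 2 ^ P.d * ε := by
      refine abs_prob_prod_sub_le (by positivity) fun co => ?_
      have := abs_prob_samples_sub_le (I := Bits P.d) E (fun y : Fin P.B → P.𝔾 => y)
        (fun y => D.eval (keyBits (co.1, finalWords G E f A F b s y co)) () = true) hε fun x v => by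
          have hc := cost_final (Ω := Fin P.B → P.𝔾)
            (U := fam P.encBlock ∪ Set.range fun (c : Bool) _ => c) (G := G) (f := f) (A := A)
            (F := F) (b := b) (s := s) C' hC' Cs hCs
            (fun c => Or.inr ⟨c, rfl⟩) (cw := fun _ => co.1) (fw := fun _ => co.2)
            (y := fun y => Function.update v x y)
            (by rintro j _ ⟨z, rfl⟩; exact Or.inr ⟨_, rfl⟩)
            (by rintro _ ⟨z, rfl⟩; exact Or.inr ⟨_, rfl⟩)
            (by
              rintro x' j _ ⟨t, rfl⟩
              by_cases hx : x' = x
              · subst hx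
                simp only [Function.update_self]
                exact Or.inl ⟨(j, t), rfl⟩
              · simp only [Function.update_of_ne hx]
                exact Or.inr ⟨_, rfl⟩)
            (by rintro m j _ ⟨t, rfl⟩; exact Or.inr ⟨_, rfl⟩)
          obtain ⟨D', hs, he⟩ := hc.exists_test D
          have := hE D' (hs.trans (by unfold keyCost at hσ; omega))
          simpa only [he] using this
      rw [Fintype.card_fun, Fintype.card_bool, Fintype.card_fin, Nat.cast_pow, Nat.cast_ofNat] at this
      exact this
    have h2 : prob (fun ω : KeyCoins n P × (Bits P.d → Fin P.B → P.𝔾) =>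
        D.eval (keyBits (ω.1.1, finalWords G E f A F b s ω.2 ω.1)) () = true) =
        prob (fun co : KeyCoins n P => D.eval (keyBits co) () = true) := by
      have e1 := prob_injective (swapFinal_injective (n := n) (G := G) (E := E) (F := F) (b := b)
        (s := s) hA) fun ω => D.eval (keyBits ω.1) () = true
      have e2 := prob_fst (Ω' := Bits P.d → Fin P.B → P.𝔾)
        fun co : KeyCoins n P => D.eval (keyBits co) () = true
      exact e1.trans e2
    rw [h2] at h1
    simpa using h1
  | succ r ih =>
    have hi : i < P.d := by omega
    let K : KeyCoins n P × (Bits (i + 1) → NodeVal n) → KeyCoins n P := fun ω =>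
      run G E f A F b s r (i + 1) (by omega) (stepSeeds G f A b s i hi ω.2 ω.1.1)
        (stepCW G f A b s i hi ω.2 ω.1.1, ω.1.2)
    have h1 : |prob (fun ω : KeyCoins n P × (Bits i → Bits n) =>
        D.eval (keyBits (run G E f A F b s (r + 1) i h ω.2 ω.1)) () = true) -
      prob (fun ω : KeyCoins n P × (Bits i → Bits (2 * (n + 2))) =>
        D.eval (keyBits (K (ω.1, childrenOf ω.2))) () = true)| ≤ 2 ^ P.d * ε := by
      refine abs_prob_prod_sub_le (by positivity) fun co => ?_
      -- The other expansions `v` are wired in. The rest of the key generation followed by `D` is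
      -- then a small circuit testing one output of `G`.
      have := abs_prob_samples_sub_le (I := Bits i) G (fun w : Bits (2 * (n + 2)) => w)
        (fun w => D.eval (keyBits (K (co, childrenOf w))) () = true) hε fun x v => by
          have hc1 := cost_step (Ω := Bits (2 * (n + 2)))
            (U := fam (fun w => w) ∪ Set.range fun (c : Bool) _ => c) (f := f) (A := A)
            (b := b) (s := s) (hi := hi) C hC
            (fun c => Or.inr ⟨c, rfl⟩) (cw := fun _ => co.1)
            (ch := fun w => childrenOf (Function.update v x w))
            (by rintro j _ ⟨z, rfl⟩; exact Or.inr ⟨_, rfl⟩)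
            (by rintro _ ⟨z, rfl⟩; exact Or.inr ⟨_, rfl⟩)
            (by
              rintro _ ⟨⟨y, z⟩, rfl⟩
              by_cases hx : Fin.init y = x
              · subst hx
                simp only [childrenOf, Function.update_self]
                rcases z with j | _ | _ <;> exact Or.inl ⟨_, rfl⟩
              · simp only [childrenOf, Function.update_of_ne hx]
                exact Or.inr ⟨_, rfl⟩)
          have hc2 := hc1.then (cost_run (E := E) (F := F) C hC C' hC' Cs hCs r (i + 1) (by omega)
            (fun c => Or.inl (Or.inr ⟨c, rfl⟩)) Set.subset_union_right (fw := fun _ => co.2)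
            (by rintro m j _ ⟨t, rfl⟩; exact Or.inl (Or.inr ⟨_, rfl⟩)))
          obtain ⟨D', hs, he⟩ := hc2.exists_test D
          have hle : stepCost n P C.size + r * (2 ^ P.d * C.size + stepCost n P C.size) ≤
              P.d * (2 ^ P.d * C.size + stepCost n P C.size) := by
            have := Nat.mul_le_mul_right (2 ^ P.d * C.size + stepCost n P C.size)
              (show r + 1 ≤ P.d by omega)
            rw [add_mul, one_mul] at this
            omega
          have := hG D' (hs.trans (by unfold keyCost at hσ; omega))
          have he' : ∀ w : Bits (2 * (n + 2)), D'.eval w = _ := he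
          simpa only [he'] using this
      rw [Fintype.card_fun, Fintype.card_bool, Fintype.card_fin, Nat.cast_pow, Nat.cast_ofNat] at this
      refine (show _ ≤ (2 : ℝ) ^ i * ε from this).trans ?_
      gcongr
      norm_num
    have h2 : prob (fun ω : KeyCoins n P × (Bits i → Bits (2 * (n + 2))) =>
        D.eval (keyBits (K (ω.1, childrenOf ω.2))) () = true) =
        prob (fun ω : KeyCoins n P × (Bits (i + 1) → Bits n) =>
        D.eval (keyBits (run G E f A F b s r (i + 1) (by omega) ω.2 ω.1)) () = true) := by
      have e1 := prob_seeds (β := Bool × Bool) fun ω : KeyCoins n P × (Bits (i + 1) → Bits n) =>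
        D.eval (keyBits (run G E f A F b s r (i + 1) (by omega) ω.2 ω.1)) () = true
      have e2 := prob_injective (swapLayer_injective (G := G) (b := b) (s := s) hA i hi) fun ω =>
        D.eval (keyBits (run G E f A F b s r (i + 1) (by omega) (fun y => (ω.2 y).1) ω.1)) () = true
      refine (prob_childrenOf fun ω => D.eval (keyBits (K ω)) () = true).trans
        (Eq.trans (prob_congr fun ω => ?_) (e2.trans e1))
      -- The two sides use the same seeds at active nodes only, which suffices by `run_congr`.
      have : K (ω.1, nodesOf ω.2) = run G E f A F b s r (i + 1) (by omega)
          (fun y => ((swapLayer G f A b s i hi ω).2 y).1) (swapLayer G f A b s i hi ω).1 := by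
        refine run_congr r (i + 1) (by omega) (fun y hy => ?_) _
        simp only [swapLayer, hy, hy.init, if_true]
      rw [this]
    rw [h2] at h1
    refine (abs_sub_le _ _ _).trans ((add_le_add h1 (ih (i + 1) (by omega))).trans (le_of_eq ?_))
    push_cast
    ring

/-- The correction words are indistinguishable from random ones, given the seed of one server. -/
theorem abs_prob_keys_sub_le (hA : ∀ i, ValidAssign f A i (assign f A i)) (hne : A.Nonempty)
    (C : Circuit (Fin n) (Fin (2 * (n + 2)))) (hC : ∀ x, C.eval x = G x)
    (C' : Circuit (Fin n) (Fin P.B × Fin P.bitLen))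
    (hC' : ∀ x, C'.eval x = P.encBlock (E x)) (Cs : Circuit (Bool × Fin P.bitLen) (Fin P.bitLen))
    (hCs : ∀ a b : P.𝔾, Cs.eval (fun t => P.enc (if t.1 then b else a) t.2) = P.enc (a - b))
    {σ : ℕ} {ε : ℝ} (hε : 0 ≤ ε)
    (hG : ∀ D : Circuit (Fin (2 * (n + 2))) Unit, D.size ≤ σ →
      |prob (fun x => D.eval (G x) () = true) - prob (fun r => D.eval r () = true)| ≤ ε)
    (hE : ∀ D : Circuit (Fin P.B × Fin P.bitLen) Unit, D.size ≤ σ →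
      |prob (fun x => D.eval (P.encBlock (E x)) () = true) -
        prob (fun y => D.eval (P.encBlock y) () = true)| ≤ ε)
    (D : Bits n → Circuit (KeyIx n P) Unit)
    (hσ : ∀ s, keyCost n P C.size C'.size Cs.size + (D s).size ≤ σ) (b : Bool) :
    |prob (fun co : BaseCoins n P => (D (if b then co.2.1 else co.1)).eval
        (keyBits ((genPub G f A co).1, genFinal G E f A F co)) () = true) -
      prob (fun ω : Bits n × KeyCoins n P => (D ω.1).eval (keyBits ω.2) () = true)| ≤
      (P.d + 1 : ℕ) * (2 ^ P.d * ε) := by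
  -- Regroups the coins: the own seed is common randomness, and the other root seed becomes a family
  -- over the single node of layer 0.
  let e : BaseCoins n P ≃ Bits n × (KeyCoins n P × (Bits 0 → Bits n)) :=
    ⟨fun co => (if b then co.2.1 else co.1, co.2.2, fun _ => if b then co.1 else co.2.1),
      fun ω => (if b then ω.2.2 Fin.elim0 else ω.1, if b then ω.1 else ω.2.2 Fin.elim0, ω.2.1),
      fun co => by cases b <;> rfl, fun ω => by
        have h0 : ∀ x : Bits 0, Fin.elim0 = x := fun x => Subsingleton.elim _ _
        obtain ⟨a, c, t⟩ := ω
        cases b <;> simp only [if_true, Bool.false_eq_true, if_false, Prod.mk.injEq, true_and] <;>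
          funext x <;> rw [h0 x]⟩
  have h1 : prob (fun co : BaseCoins n P => (D (if b then co.2.1 else co.1)).eval
        (keyBits ((genPub G f A co).1, genFinal G E f A F co)) () = true) =
      prob (fun ω : Bits n × (KeyCoins n P × (Bits 0 → Bits n)) => (D ω.1).eval
        (keyBits (run G E f A F b ω.1 P.d 0 (Nat.zero_add _) ω.2.2 ω.2.1)) () = true) := by
    rw [← prob_equiv e]
    refine prob_congr fun co => ?_
    rw [← run_zero (b := b) hA hne co]
    rfl
  rw [h1]
  exact abs_prob_prod_sub_le (by positivity) fun s => abs_prob_run_sub_le hA C hC C' hC' Cs hCs hε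
    hG hE (D s) (hσ s) P.d 0 (Nat.zero_add _)

end KeySecurity


/-! ### The view of a server -/

section SimView

variable {n : ℕ} {P : Params} {G : Bits n → Bits (2 * (n + 2))}

/-- The public bit of the root, which does not depend on anything else. -/
noncomputable def rootBit (P : Params) : Bool :=
  assign (fun _ _ _ => ⟨0, Nat.mul_pos three_pos P.k_pos⟩ : HashFam P) ∅ 0 Fin.elim0

/-- The messages that a server received from the client; those for the other server are blank. -/
noncomputable def simMsgs (s : Bits n) (key : KeyCoins n P)
    (x : Bits (lens n P).ext1 × Bits (lens n P).ext2 × Bits (lens n P).msg) :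
    Msgs n P (lens n P) where
  seed _ := s
  pub := (key.1, rootBit P)
  ext1 _ := x.1
  final := key.2
  ext2 _ := x.2.1

/-- The view of server `b` with given key, extra messages and opening of the other server. -/
noncomputable def simView (G : Bits n → Bits (2 * (n + 2))) (b : Bool) (f : HashFam P) (s : Bits n)
    (key : KeyCoins n P) (h : Bits (lens n P).chal) (ρ : Bits (lens n P).rho)
    (x : Bits (lens n P).ext1 × Bits (lens n P).ext2 × Bits (lens n P).msg) :
    ViewIx n P (lens n P) → Bool :=
  view f (simMsgs s key x) h ρ b fun r : Fin 2 => if r = 0 then x.2.2 else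
    (unpack _ (Fin P.k × Bool)).symm fun _ => serverCheck G f (simMsgs s key x) h ρ b fun _ => x.2.2

variable (Q : ProofCircuits n P G) (G' : Bits n → Fin P.B → P.𝔾)

/-- The extra messages of the client to server `b`, and the opening of the other server. -/
noncomputable def proofMsgs (f : HashFam P) (inp : Input P) (co : BaseCoins n P)
    (h : Bits (lens n P).chal) (ρ : Bits (lens n P).rho) (b : Bool) (e : Bits (lens n P).coin) :
    Bits (lens n P).ext1 × Bits (lens n P).ext2 × Bits (lens n P).msg :=
  let M : Msgs n P (lens n P) := honest G (Q.augmentation G') f inp co e h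
  (M.ext1 b, M.ext2 b, (unpack _ _).symm (serverOpening M ρ (!b)))

/-- Since honest clients are always accepted, the last message received by a server can be computed
from what it already knows. -/
theorem checkValue_honest (f : HashFam P) (inp : Input P) (co : BaseCoins n P)
    (e : Bits (lens n P).coin) (h : Bits (lens n P).chal) (ρ : Bits (lens n P).rho) (b : Bool) :
    checkValue G f (honest G (Q.augmentation G') f inp co e h) h ρ (!b) =
      checkValue G f (honest G (Q.augmentation G') f inp co e h) h ρ b := by
  have := (accepts_iff Q G' f _ h ρ).mp (complete_augmentation Q G' inp (f, co, e, h, ρ))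
  rw [CharTwo.add_eq_zero] at this
  cases b
  · exact this.symm
  · exact this

/-- The opening received is part of `proofMsgs`, the check value received is recomputed by
`checkValue_honest`, and the root bit is constant. So the keys and `proofMsgs` are all that depends
on the client's function. -/
theorem finalView_eq_simView (f : HashFam P) (inp : Input P) (co : BaseCoins n P)
    (e : Bits (lens n P).coin) (h : Bits (lens n P).chal) (ρ : Bits (lens n P).rho) (b : Bool) :
    finalView (Q.augmentation G') f (honest G (Q.augmentation G') f inp co e h) h ρ b =
      simView G b f (if b then co.2.1 else co.1) ((genPub G f (inp.active f) co).1,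
        genFinal G G' f (inp.active f) (inp.shared f) co) h ρ (proofMsgs Q G' f inp co h ρ b e) := by
  set M : Msgs n P (lens n P) := honest G (Q.augmentation G') f inp co e h with hM
  have hroot : M.pub.2 = rootBit P := congrFun (assign_zero_eq _ _) _
  set N := simMsgs (if b then co.2.1 else co.1) ((genPub G f (inp.active f) co).1,
      genFinal G G' f (inp.active f) (inp.shared f) co) (proofMsgs Q G' f inp co h ρ b e) with hN
  have hpub : N.pub = M.pub := Prod.ext rfl hroot.symm
  have hrecv : transcript (Q.augmentation G') f M h ρ 2 (!b) = fun r : Fin 2 => if r = 0 then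
      (proofMsgs Q G' f inp co h ρ b e).2.2 else (unpack _ (Fin P.k × Bool)).symm fun _ =>
        serverCheck G f N h ρ b fun _ => (proofMsgs Q G' f inp co h ρ b e).2.2 := by
    funext r
    refine (transcript_two Q G' f M h ρ (!b) r).trans ?_
    by_cases hr : r = (0 : Fin 2)
    · rw [if_pos hr]
      exact (if_pos hr).symm
    · rw [if_neg hr]
      refine Eq.trans ?_ (if_neg hr).symm
      congr 1
      funext _
      rw [hM, checkValue_honest]
      unfold serverCheck checkValue
      rw [hpub]
      simp only [proofMsgs, Equiv.apply_symm_apply]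
      rfl
  unfold finalView simView
  refine (congrArg (view f M h ρ b) hrecv).trans ?_
  funext z
  cases z with
  | rootBit => exact hroot
  | _ => rfl

/-- Each coin is either sent in the clear or used as a pad. The server's own messages reveal pads 0,
1 and 6 and its own mask shares. The opening of the other server then reveals that server's mask
shares, because everything added to them is already determined. The coin `none` follows last. -/
theorem proofMsgs_injective (f : HashFam P) (inp : Input P) (co : BaseCoins n P)
    (h : Bits (lens n P).chal) (ρ : Bits (lens n P).rho) (b : Bool) :
    Function.Injective (proofMsgs Q G' f inp co h ρ b) := by
  intro e e' hee
  have h1 : ∀ e c, (honest G (Q.augmentation G') f inp co e h).ext1 c =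
      (unpack _ _).symm (share1 (fun l => posF n (inp.α l))
      (leafDiff G f inp co) (unpack _ _ e) c) := fun e c => Q.client1_eval f inp co e c
  have h2 : ∀ e c, (honest G (Q.augmentation G') f inp co e h).ext2 c =
      (unpack _ _).symm (share2 (fun l => posF n (inp.α l))
      (leafDiff G f inp co) (chalF h) (unpack _ _ e) c) := fun e c => Q.client2_eval f inp co e h c
  simp only [proofMsgs, serverOpening, h1, h2, Equiv.apply_symm_apply, Prod.mk.injEq,
    EmbeddingLike.apply_eq_iff_eq] at hee
  obtain ⟨hx, hy, ho⟩ := hee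
  apply (unpack (n + P.d + 4) (Option (Fin 7 × Fin P.k))).injective
  generalize unpack (n + P.d + 4) (Option (Fin 7 × Fin P.k)) e = v at *
  generalize unpack (n + P.d + 4) (Option (Fin 7 × Fin P.k)) e' = v' at *
  have hxs := fun i l => congrFun hx (some (i, l))
  have hyl := fun l => congrFun hy l
  have hol := fun l c => congrFun ho (l, c)
  have hsome : ∀ l i, v (some (i, l)) = v' (some (i, l)) := by
    intro l
    have x0 := hxs 0 l
    have x1 := hxs 1 l
    have x2 := hxs 2 l
    have x3 := hxs 3 l
    have y0 := hyl l
    have o0 := hol l false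
    have o1 := hol l true
    cases b <;>
      simp only [share1, share2, opening, Matrix.cons_val, Bool.not_true, Bool.not_false, if_true,
        Bool.false_eq_true, if_false, add_zero, add_left_inj] at x0 x1 x2 x3 y0 o0 o1
    · have o1' : v (some (5, l)) = v' (some (5, l)) := by rw [x0] at o1; exact add_left_cancel o1
      have o0' : v (some (3, l)) = v' (some (3, l)) := by rw [y0] at o0; exact add_left_cancel o0
      intro i
      fin_cases i
      exacts [x0, x1, x2, o0', x3, o1', y0]
    · have o1' : v (some (4, l)) = v' (some (4, l)) := by rw [x0] at o1; exact add_left_cancel o1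
      have o0' : v (some (2, l)) = v' (some (2, l)) := by rw [y0] at o0; exact add_left_cancel o0
      intro i
      fin_cases i
      exacts [x0, x1, o0', x2, o1', x3, y0]
  funext a
  rcases a with _ | ⟨i, l⟩
  · have := congrFun hx none
    simp only [share1, hsome, add_left_inj] at this
    exact this
  · exact hsome l i

/-- In field elements, 7k + 1 coins face (4k + 1) + k + 2k elements seen by the server; an injective
map between types of equal size preserves uniformity. -/
theorem prob_proofMsgs (f : HashFam P) (inp : Input P) (co : BaseCoins n P)
    (h : Bits (lens n P).chal) (ρ : Bits (lens n P).rho) (b : Bool)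
    (p : Bits (lens n P).ext1 × Bits (lens n P).ext2 × Bits (lens n P).msg → Prop) :
    prob (fun e => p (proofMsgs Q G' f inp co h ρ b e)) = prob p := by
  refine prob_injective_of_card (proofMsgs_injective Q G' f inp co h ρ b) ?_ p
  simp only [Fintype.card_prod, Fintype.card_fun, Fintype.card_bool, Fintype.card_fin,
    Fintype.card_option, ← pow_add]
  congr 1
  ring

/-- The view can be computed from its parts. -/
theorem cost_simView {Ω : Type} {U : Set (Ω → Bool)} (b : Bool) {f : Ω → HashFam P} {s : Ω → Bits n}
    {key : Ω → KeyCoins n P} {h : Ω → Bits (lens n P).chal} {ρ : Ω → Bits (lens n P).rho}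
    {x : Ω → Bits (lens n P).ext1 × Bits (lens n P).ext2 × Bits (lens n P).msg}
    (hU : ∀ c : Bool, (fun _ => c) ∈ U)
    (hf : ∀ i y c (t : Fin (Nat.clog 2 (3 * P.k))), (fun ω => (f ω i y c : ℕ).testBit t) ∈ U) (hs : ∀ j, (fun ω => s ω j) ∈ U)
    (hkey : ∀ z, (fun ω => keyBits (key ω) z) ∈ U) (hh : ∀ j, (fun ω => h ω j) ∈ U)
    (hρ : ∀ j, (fun ω => ρ ω j) ∈ U) (hx1 : ∀ j, (fun ω => (x ω).1 j) ∈ U)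
    (hx2 : ∀ j, (fun ω => (x ω).2.1 j) ∈ U) (hx3 : ∀ j, (fun ω => (x ω).2.2 j) ∈ U) :
    Cost U (fam fun ω => simView G b (f ω) (s ω) (key ω) (h ω) (ρ ω) (x ω)) (Q.msg1 b).size := by
  -- The check circuit is run on a view whose received messages are all the opening. This is
  -- harmless, since it uses only the first of them.
  have h1 : (fam fun ω => view (f ω) (simMsgs (s ω) (key ω) (x ω)) (h ω) (ρ ω) b fun _ => (x ω).2.2) ⊆
      U := by
    rintro _ ⟨z, rfl⟩
    cases z with
    | hash i y c t => exact hf i y c t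
    | seed j => exact hs j
    | seedCorr i m j => exact hkey (.inl (i, m, false, .inl j))
    | bitCorrU i m c => exact hkey (.inl (i, m, c, .inr false))
    | bitCorrQ i m c => exact hkey (.inl (i, m, c, .inr true))
    | rootBit => exact hU _
    | ext1 j => exact hx1 j
    | chal j => exact hh j
    | final m j t => exact hkey (.inr (m, j, t))
    | ext2 j => exact hx2 j
    | rho j => exact hρ j
    | recv r j => exact hx3 j
  have h2 := (Cost.of_subset (s := 0) h1).circuit (Q.msg1 b)
  simp only [Q.msg1_eval, zero_add] at h2
  refine ((Cost.of_subset (s := 0) (le_refl U)).union h2).mono le_rfl ?_ (zero_add _).le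
  rintro _ ⟨z, rfl⟩
  cases z with
  | recv r j =>
    match r with
    | 0 => exact Or.inl (hx3 j)
    | 1 => exact Or.inr ⟨j, rfl⟩
  | hash i y c t => exact Or.inl (hf i y c t)
  | seed j => exact Or.inl (hs j)
  | seedCorr i m j => exact Or.inl (hkey (.inl (i, m, false, .inl j)))
  | bitCorrU i m c => exact Or.inl (hkey (.inl (i, m, c, .inr false)))
  | bitCorrQ i m c => exact Or.inl (hkey (.inl (i, m, c, .inr true)))
  | rootBit => exact Or.inl (hU _)
  | ext1 j => exact Or.inl (hx1 j)
  | chal j => exact Or.inl (hh j)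
  | final m j t => exact Or.inl (hkey (.inr (m, j, t)))
  | ext2 j => exact Or.inl (hx2 j)
  | rho j => exact Or.inl (hρ j)

/-! ### The simulator -/

/-- Indices of the coins of the simulator. -/
abbrev TapeIx (n : ℕ) (P : Params) : Type :=
  Fin n ⊕ (Fin P.d × Fin (3 * P.k) × (Fin n ⊕ Bool ⊕ Bool)) ⊕ Fin (lens n P).chal ⊕
    Fin (lens n P).rho ⊕ Fin (lens n P).ext1 ⊕ Fin (lens n P).ext2 ⊕ Fin (lens n P).msg

/-- The random values used by the simulator, except hash functions and group elements. -/
abbrev Tape (n : ℕ) (P : Params) : Type :=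
  Bits n × (Fin P.d → Fin (3 * P.k) → CorrWord n) × Bits (lens n P).chal × Bits (lens n P).rho ×
    (Bits (lens n P).ext1 × Bits (lens n P).ext2 × Bits (lens n P).msg)

/-- The random values, read from a bit string. -/
noncomputable def tapeEquiv (n : ℕ) (P : Params) : Bits (Fintype.card (TapeIx n P)) ≃ Tape n P :=
  ((Fintype.equivFin (TapeIx n P)).arrowCongr (Equiv.refl Bool)).symm.trans
  { toFun := fun v => (fun j => v (.inl j), fun i m => (fun j => v (.inr (.inl (i, m, .inl j))),
      fun c => v (.inr (.inl (i, m, .inr (.inl c)))), fun c => v (.inr (.inl (i, m, .inr (.inr c))))),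
      fun j => v (.inr (.inr (.inl j))), fun j => v (.inr (.inr (.inr (.inl j)))),
      fun j => v (.inr (.inr (.inr (.inr (.inl j))))),
      fun j => v (.inr (.inr (.inr (.inr (.inr (.inl j)))))),
      fun j => v (.inr (.inr (.inr (.inr (.inr (.inr j)))))))
    invFun := fun τ => fun
      | .inl j => τ.1 j
      | .inr (.inl (i, m, .inl j)) => (τ.2.1 i m).1 j
      | .inr (.inl (i, m, .inr (.inl c))) => (τ.2.1 i m).2.1 c
      | .inr (.inl (i, m, .inr (.inr c))) => (τ.2.1 i m).2.2 c
      | .inr (.inr (.inl j)) => τ.2.2.1 j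
      | .inr (.inr (.inr (.inl j))) => τ.2.2.2.1 j
      | .inr (.inr (.inr (.inr (.inl j)))) => τ.2.2.2.2.1 j
      | .inr (.inr (.inr (.inr (.inr (.inl j))))) => τ.2.2.2.2.2.1 j
      | .inr (.inr (.inr (.inr (.inr (.inr j))))) => τ.2.2.2.2.2.2 j
    left_inv := fun v => by
      funext z
      rcases z with j | ⟨i, m, j | c | c⟩ | j | j | j | j | j <;> rfl
    right_inv := fun τ => rfl }

theorem exists_simulator (b : Bool) :
    ∃ Sim : Circuit (SimIx P (Fintype.card (TapeIx n P))) (ViewIx n P (lens n P)),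
      Sim.size ≤ 1 + (Q.msg1 b).size ∧ ∀ ω : SimCoins P (Fintype.card (TapeIx n P)),
        Sim.eval (simIn ω) = simView G b ω.1 (tapeEquiv n P ω.2.1).1
          ((tapeEquiv n P ω.2.1).2.1, ω.2.2) (tapeEquiv n P ω.2.1).2.2.1
          (tapeEquiv n P ω.2.1).2.2.2.1 (tapeEquiv n P ω.2.1).2.2.2.2 := by
  have hc := Cost.consts.then (cost_simView
    (U := fam (simIn (P := P) (coinLen := Fintype.card (TapeIx n P))) ∪
      Set.range fun (c : Bool) _ => c) Q b (f := fun ω => ω.1)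
    (s := fun ω => (tapeEquiv n P ω.2.1).1) (key := fun ω => ((tapeEquiv n P ω.2.1).2.1, ω.2.2))
    (h := fun ω => (tapeEquiv n P ω.2.1).2.2.1) (ρ := fun ω => (tapeEquiv n P ω.2.1).2.2.2.1)
    (x := fun ω => (tapeEquiv n P ω.2.1).2.2.2.2)
    (fun c => Or.inr ⟨c, rfl⟩) (fun i y c t => Or.inl ⟨.hash i y c t, rfl⟩)
    (fun j => Or.inl ⟨.coin _, rfl⟩)
    (by
      rintro (⟨i, m, c, j | _ | _⟩ | ⟨m, j, t⟩)
      · exact Or.inl ⟨.coin _, rfl⟩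
      · exact Or.inl ⟨.coin _, rfl⟩
      · exact Or.inl ⟨.coin _, rfl⟩
      · exact Or.inl ⟨.grp m j t, rfl⟩)
    (fun j => Or.inl ⟨.coin _, rfl⟩) (fun j => Or.inl ⟨.coin _, rfl⟩)
    (fun j => Or.inl ⟨.coin _, rfl⟩) (fun j => Or.inl ⟨.coin _, rfl⟩)
    (fun j => Or.inl ⟨.coin _, rfl⟩))
  exact hc.exists_circuit

/-- The real and the simulated view cannot be distinguished. -/
theorem abs_prob_finalView_sub_le (C : Circuit (Fin n) (Fin (2 * (n + 2)))) (hC : ∀ x, C.eval x = G x)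
    (C' : Circuit (Fin n) (Fin P.B × Fin P.bitLen))
    (hC' : ∀ x, C'.eval x = P.encBlock (G' x)) (Cs : Circuit (Bool × Fin P.bitLen) (Fin P.bitLen))
    (hCs : ∀ a b : P.𝔾, Cs.eval (fun t => P.enc (if t.1 then b else a) t.2) = P.enc (a - b))
    {σ : ℕ} {ε : ℝ} (hε : 0 ≤ ε)
    (hG : ∀ D : Circuit (Fin (2 * (n + 2))) Unit, D.size ≤ σ →
      |prob (fun x => D.eval (G x) () = true) - prob (fun r => D.eval r () = true)| ≤ ε)
    (hE : ∀ D : Circuit (Fin P.B × Fin P.bitLen) Unit, D.size ≤ σ →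
      |prob (fun x => D.eval (P.encBlock (G' x)) () = true) -
        prob (fun y => D.eval (P.encBlock y) () = true)| ≤ ε)
    (b : Bool) (inp : Input P) (D : Circuit (ViewIx n P (lens n P)) Unit)
    (hσ : keyCost n P C.size C'.size Cs.size + (1 + (Q.msg1 b).size + D.size) ≤ σ)
    (Sim : Circuit (SimIx P (Fintype.card (TapeIx n P))) (ViewIx n P (lens n P)))
    (hSim : ∀ ω : SimCoins P (Fintype.card (TapeIx n P)),
        Sim.eval (simIn ω) = simView G b ω.1 (tapeEquiv n P ω.2.1).1
          ((tapeEquiv n P ω.2.1).2.1, ω.2.2) (tapeEquiv n P ω.2.1).2.2.1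
          (tapeEquiv n P ω.2.1).2.2.2.1 (tapeEquiv n P ω.2.1).2.2.2.2) :
    |prob (fun ω : RunCoins (Q.augmentation G') => D.eval (finalView (Q.augmentation G') ω.1
        (honest G (Q.augmentation G') ω.1 inp ω.2.1 ω.2.2.1 ω.2.2.2.1) ω.2.2.2.1 ω.2.2.2.2 b) ()
          = true) -
      prob (fun ω : SimCoins P (Fintype.card (TapeIx n P)) => D.eval (Sim.eval (simIn ω)) () = true)|
      ≤ (P.d + 1 : ℕ) * (2 ^ P.d * ε) := by
  let X := Bits (lens n P).ext1 × Bits (lens n P).ext2 × Bits (lens n P).msg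
  let Z := HashFam P × Bits (lens n P).chal × Bits (lens n P).rho × X
  let real : HashFam P → BaseCoins n P → Bits n × KeyCoins n P := fun f co =>
    (if b then co.2.1 else co.1, (genPub G f (inp.active f) co).1,
      genFinal G G' f (inp.active f) (inp.shared f) co)
  let test : Z → Bits n × KeyCoins n P → Prop := fun z k =>
    D.eval (simView G b z.1 k.1 k.2 z.2.1 z.2.2.1 z.2.2.2) () = true
  have h1 : prob (fun ω : RunCoins (Q.augmentation G') => D.eval (finalView (Q.augmentation G') ω.1
        (honest G (Q.augmentation G') ω.1 inp ω.2.1 ω.2.2.1 ω.2.2.2.1) ω.2.2.2.1 ω.2.2.2.2 b) ()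
          = true) = prob (fun ω : Z × BaseCoins n P => test ω.1 (real ω.1.1 ω.2)) := by
    let e1 : RunCoins (Q.augmentation G') ≃ (HashFam P × BaseCoins n P × Bits (lens n P).chal ×
        Bits (lens n P).rho) × Bits (lens n P).coin :=
      ⟨fun ω => ((ω.1, ω.2.1, ω.2.2.2.1, ω.2.2.2.2), ω.2.2.1),
        fun ω => (ω.1.1, ω.1.2.1, ω.2, ω.1.2.2.1, ω.1.2.2.2), fun _ => rfl, fun _ => rfl⟩
    let e2 : Z × BaseCoins n P ≃ (HashFam P × BaseCoins n P × Bits (lens n P).chal ×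
        Bits (lens n P).rho) × X :=
      ⟨fun ω => ((ω.1.1, ω.2, ω.1.2.1, ω.1.2.2.1), ω.1.2.2.2),
        fun ω => ((ω.1.1, ω.1.2.2.1, ω.1.2.2.2, ω.2), ω.1.2.1), fun _ => rfl, fun _ => rfl⟩
    have s1 := prob_equiv e1 fun ω => test (ω.1.1, ω.1.2.2.1, ω.1.2.2.2,
      proofMsgs Q G' ω.1.1 inp ω.1.2.1 ω.1.2.2.1 ω.1.2.2.2 b ω.2) (real ω.1.1 ω.1.2.1)
    have s2 := prob_equiv e2 fun ω => test (ω.1.1, ω.1.2.2.1, ω.1.2.2.2, ω.2) (real ω.1.1 ω.1.2.1)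
    refine (prob_congr fun ω => ?_).trans (s1.trans (Eq.trans ?_ s2.symm))
    · rw [finalView_eq_simView]
      rfl
    -- For each value of the remaining randomness, the proof messages are replaced by uniform
    -- strings with the same law.
    · rw [prob_prod, prob_prod]
      congr 1
      refine Finset.sum_congr rfl fun a _ => ?_
      exact prob_proofMsgs Q G' a.1 inp a.2.1 a.2.2.1 a.2.2.2 b
        fun x => test (a.1, a.2.2.1, a.2.2.2, x) (real a.1 a.2.1)
  have h2 : prob (fun ω : SimCoins P (Fintype.card (TapeIx n P)) => D.eval (Sim.eval (simIn ω)) () =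
      true) = prob (fun ω : Z × (Bits n × KeyCoins n P) => test ω.1 ω.2) := by
    let e3 : HashFam P × Tape n P × Final P ≃ Z × (Bits n × KeyCoins n P) :=
      ⟨fun ω => ((ω.1, ω.2.1.2.2.1, ω.2.1.2.2.2.1, ω.2.1.2.2.2.2), (ω.2.1.1, ω.2.1.2.1, ω.2.2)),
        fun ω => (ω.1.1, (ω.2.1, ω.2.2.1, ω.1.2.1, ω.1.2.2.1, ω.1.2.2.2), ω.2.2.2),
        fun _ => rfl, fun _ => rfl⟩
    have s3 := prob_equiv (((Equiv.refl (HashFam P)).prodCongr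
      ((tapeEquiv n P).prodCongr (Equiv.refl (Final P)))).trans e3) fun ω => test ω.1 ω.2
    refine Eq.trans (prob_congr fun ω => ?_) s3
    rw [hSim]
    rfl
  rw [h1, h2]
  -- Everything except the keys has the same law on both sides and is fixed, so a distinguisher of
  -- views becomes a distinguisher of keys.
  refine abs_prob_prod_sub_le (by positivity) fun z => ?_
  have hD : ∀ s : Bits n, ∃ D' : Circuit (KeyIx n P) Unit, D'.size ≤ 1 + (Q.msg1 b).size + D.size ∧
      ∀ key, D'.eval (keyBits key) = D.eval (simView G b z.1 s key z.2.1 z.2.2.1 z.2.2.2) := fun s =>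
    (cost_simView (U := fam (keyBits (n := n) (P := P)) ∪ Set.range fun (c : Bool) _ => c) Q b
      (f := fun _ => z.1) (s := fun _ => s) (key := fun key => key) (h := fun _ => z.2.1)
      (ρ := fun _ => z.2.2.1) (x := fun _ => z.2.2.2) (fun c => Or.inr ⟨c, rfl⟩)
      (fun i y c t => Or.inr ⟨_, rfl⟩) (fun j => Or.inr ⟨_, rfl⟩) (fun j => Or.inl ⟨j, rfl⟩)
      (fun j => Or.inr ⟨_, rfl⟩) (fun j => Or.inr ⟨_, rfl⟩) (fun j => Or.inr ⟨_, rfl⟩)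
      (fun j => Or.inr ⟨_, rfl⟩) (fun j => Or.inr ⟨_, rfl⟩)).exists_test D
  choose D' hs he using hD
  have := abs_prob_keys_sub_le (F := inp.shared z.1) (active_valid inp z.1) (active_nonempty inp z.1)
    C hC C' hC' Cs hCs hε hG hE D' (fun s => (Nat.add_le_add_left (hs s) _).trans hσ) b
  simp only [he] at this
  exact this

end SimView


/-! ### Polynomial bounds -/

section Asymptotics

/-- The base n + 2 is at least 2, so exponents absorb constants also at n = 0 and n = 1; this form
is convenient for sums and products. -/
theorem polyBounded_iff {f : ℕ → ℕ} : PolyBounded f ↔ ∃ c, ∀ n, f n ≤ (n + 2) ^ c := by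
  constructor
  · rintro ⟨c, h⟩
    refine ⟨c + 1, fun n => (h n).trans ?_⟩
    have h1 : n ^ c ≤ (n + 2) ^ c := Nat.pow_le_pow_left (by omega) c
    have h2 : c ≤ (n + 2) ^ c :=
      Nat.lt_two_pow_self.le.trans (Nat.pow_le_pow_left (by omega) c)
    rw [pow_succ]
    nlinarith
  · rintro ⟨c, h⟩
    refine ⟨2 * c + 3 ^ c, fun n => (h n).trans ?_⟩
    rcases Nat.lt_or_ge n 2 with hn | hn
    · have : (n + 2) ^ c ≤ 3 ^ c := Nat.pow_le_pow_left (by omega) c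
      omega
    · have h1 : (n + 2) ^ c ≤ (n ^ 2) ^ c := Nat.pow_le_pow_left (by nlinarith) c
      have h2 : n ^ (2 * c) ≤ n ^ (2 * c + 3 ^ c) := Nat.pow_le_pow_right (by omega) (Nat.le_add_right _ _)
      rw [← pow_mul] at h1
      exact (h1.trans h2).trans (Nat.le_add_right _ _)

theorem PolyBounded.mono {f g : ℕ → ℕ} (hg : PolyBounded g) (h : ∀ n, f n ≤ g n) : PolyBounded f :=
  hg.imp fun _ hc n => (h n).trans (hc n)

theorem PolyBounded.const (a : ℕ) : PolyBounded fun _ => a := ⟨a, fun _ => Nat.le_add_left _ _⟩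

theorem PolyBounded.id : PolyBounded fun n => n := ⟨1, fun n => by simp⟩

theorem PolyBounded.add {f g : ℕ → ℕ} (hf : PolyBounded f) (hg : PolyBounded g) :
    PolyBounded fun n => f n + g n := by
  rw [polyBounded_iff] at hf hg ⊢
  obtain ⟨a, ha⟩ := hf
  obtain ⟨b, hb⟩ := hg
  refine ⟨a + b + 1, fun n => (Nat.add_le_add (ha n) (hb n)).trans ?_⟩
  have h1 : (n + 2) ^ a ≤ (n + 2) ^ (a + b) := Nat.pow_le_pow_right (by omega) (by omega)
  have h2 : (n + 2) ^ b ≤ (n + 2) ^ (a + b) := Nat.pow_le_pow_right (by omega) (by omega)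
  calc _ ≤ (n + 2) ^ (a + b) * 2 := by omega
    _ ≤ _ := Nat.mul_le_mul_left _ (by omega)

theorem PolyBounded.mul {f g : ℕ → ℕ} (hf : PolyBounded f) (hg : PolyBounded g) :
    PolyBounded fun n => f n * g n := by
  rw [polyBounded_iff] at hf hg ⊢
  obtain ⟨a, ha⟩ := hf
  obtain ⟨b, hb⟩ := hg
  exact ⟨a + b, fun n => (Nat.mul_le_mul (ha n) (hb n)).trans (pow_add _ _ _).ge⟩

theorem PolyBounded.pow {f : ℕ → ℕ} (hf : PolyBounded f) (m : ℕ) : PolyBounded fun n => f n ^ m := by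
  induction m with
  | zero => simpa using PolyBounded.const 1
  | succ m ih => simpa only [pow_succ] using ih.mul hf

theorem PolyBounded.exists_le_pow {f : ℕ → ℕ} (hf : PolyBounded f) :
    ∃ a N : ℕ, ∀ n, N ≤ n → f n ≤ n ^ a := by
  obtain ⟨c, hc⟩ := hf
  refine ⟨c + 1, c + 2, fun n hn => (hc n).trans ?_⟩
  have : 1 ≤ n ^ c := Nat.one_le_pow _ _ (by omega)
  rw [pow_succ]
  nlinarith

variable {P : ℕ → Params}

theorem Admissible.d (h : Admissible P) : PolyBounded fun n => (P n).d :=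
  h.blocks.mono fun _ => Nat.lt_two_pow_self.le

theorem Admissible.k (h : Admissible P) : PolyBounded fun n => (P n).k :=
  h.blocks.mono fun n => (P n).k_le

theorem polyBounded_stepCost (h : Admissible P) {g : ℕ → ℕ} (hg : PolyBounded g) :
    PolyBounded fun n => stepCost n (P n) (g n) := by
  have hn : PolyBounded fun n => n + 2 := .add .id (.const 2)
  unfold stepCost
  exact ((((h.blocks.mul hg).add ((((PolyBounded.const 3).mul h.k).mul
    ((PolyBounded.const 2).mul hn)).mul (.const 16))).add (h.blocks.mul (hn.mul (.const 20)))).add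
    (h.blocks.mul (hn.mul (.const 8)))).add (h.blocks.mul (hn.mul (.const 20)))

theorem polyBounded_keyCost (h : Admissible P) {g g' c : ℕ → ℕ} (hg : PolyBounded g)
    (hg' : PolyBounded g') (hc : PolyBounded c) :
    PolyBounded fun n => keyCost n (P n) (g n) (g' n) (c n) := by
  have hfin : PolyBounded fun n => finalCost (P n) (g' n) (c n) := by
    unfold finalCost
    exact ((PolyBounded.const 3).mul h.k).mul (hg'.add (h.blockSize.mul
      ((((PolyBounded.const 5).mul hc).add (.const 16)).add (h.bitLen.mul (.const 8)))))
  unfold keyCost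
  exact (PolyBounded.const 1).add ((h.d.mul ((h.blocks.mul hg).add (polyBounded_stepCost h hg))).add
    ((h.blocks.mul hg').add hfin))

theorem polyBounded_fieldBits (h : Admissible P) : PolyBounded fun n => n + (P n).d + 4 :=
  (PolyBounded.id.add h.d).add (.const 4)

theorem polyBounded_checkCost (h : Admissible P) {g : ℕ → ℕ} (hg : PolyBounded g) :
    PolyBounded fun n => checkCost n (P n) (g n) :=
  ((h.k.mul h.blocks).mul (((polyBounded_fieldBits h).pow 4).mul (hg.add (.const 704)))).mono
    fun n => checkCost_le (g n)

theorem polyBounded_tape (h : Admissible P) :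
    PolyBounded fun n => Fintype.card (TapeIx n (P n)) := by
  have hm := polyBounded_fieldBits h
  simp only [Fintype.card_sum, Fintype.card_prod, Fintype.card_fin, Fintype.card_bool,
    Fintype.card_option]
  have hcw := h.d.mul (((PolyBounded.const 3).mul h.k).mul (PolyBounded.id.add (.const 4)))
  have hrho := (h.k.add (.const 1)).mul hm
  have hx1 := (((PolyBounded.const 4).mul h.k).add (.const 1)).mul hm
  have hx2 := h.k.mul hm
  have hmsg := (h.k.mul (.const 2)).mul hm
  exact PolyBounded.id.add (hcw.add (hm.add (hrho.add (hx1.add (hx2.add hmsg)))))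

/-- The hybrids lose a factor (d + 1)·2^d, which is polynomial because 2^d is. It is compensated by
asking a smaller advantage from the generators. -/
theorem zeroKnowledge_augmentation {G : ∀ n, Bits n → Bits (2 * (n + 2))} (hG : IsPRG G)
    (hP : Admissible P) {G' : ∀ n, Bits n → Fin (P n).B → (P n).𝔾} (hG' : IsBlockPRG P G')
    (C : ∀ n, Circuit (Fin n) (Fin (2 * (n + 2)))) (hC : ∀ n x, (C n).eval x = G n x)
    (hCs : PolyBounded fun n => (C n).size) (Q : ∀ n, ProofCircuits n (P n) (G n))
    (hQ : ∀ n b, ((Q n).msg1 b).size ≤ checkCost n (P n) (C n).size) :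
    ZeroKnowledge G P fun n => (Q n).augmentation (G' n) := by
  intro b
  have hmsg : PolyBounded fun n => ((Q n).msg1 b).size :=
    (polyBounded_checkCost hP hCs).mono fun n => hQ n b
  choose Sim hSs hSe using fun n => exists_simulator (Q n) b
  refine ⟨fun n => Fintype.card (TapeIx n (P n)), Sim, polyBounded_tape hP,
    ((PolyBounded.const 1).add hmsg).mono hSs, fun inp => ?_⟩
  intro a β
  obtain ⟨c', hc'⟩ := hG'.efficient
  choose C' hCs' hC' using hc'
  obtain ⟨c, hc⟩ := hP.sub
  choose D hDs hD using hc
  have hσ : PolyBounded fun n => keyCost n (P n) (C n).size (C' n).size (D n).size +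
      (1 + ((Q n).msg1 b).size + n ^ a) :=
    (polyBounded_keyCost hP hCs ⟨c', hCs'⟩ ⟨c, hDs⟩).add
      (((PolyBounded.const 1).add hmsg).add (PolyBounded.id.pow a))
  obtain ⟨a', N₁, hN₁⟩ := hσ.exists_le_pow
  obtain ⟨t, N₂, hN₂⟩ := hP.blocks.exists_le_pow
  -- Both factors d + 1 and 2^d are at most n^t, which explains the additional exponent 2t. The
  -- exponent a' allows for the distinguisher together with the whole key generation.
  obtain ⟨N₃, hN₃⟩ := hG.pseudorandom a' (β + 2 * t)
  obtain ⟨N₄, hN₄⟩ := hG'.pseudorandom a' (β + 2 * t)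
  refine ⟨N₁ + N₂ + N₃ + N₄, fun n hn h1 T hT => ?_⟩
  have hn0 : (0 : ℝ) < n := by exact_mod_cast h1
  refine (abs_prob_finalView_sub_le (Q n) (G' n) (C n) (hC n) (C' n) (hC' n) (D n) (hD n)
    (σ := n ^ a') (ε := 1 / (n : ℝ) ^ (β + 2 * t)) (by positivity)
    (hN₃ n (by omega) h1) (hN₄ n (by omega) h1) b (inp n) T ?_ (Sim n) (hSe n)).trans ?_
  · exact (by omega : _ ≤ keyCost n (P n) (C n).size (C' n).size (D n).size +
      (1 + ((Q n).msg1 b).size + n ^ a)).trans (hN₁ n (by omega))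
  · have hd : (((P n).d + 1 : ℕ) : ℝ) ≤ (n : ℝ) ^ t := by
      exact_mod_cast (Nat.lt_two_pow_self (n := (P n).d)).trans_le (hN₂ n (by omega))
    have hb : (2 : ℝ) ^ (P n).d ≤ (n : ℝ) ^ t := by exact_mod_cast hN₂ n (by omega)
    calc (((P n).d + 1 : ℕ) : ℝ) * (2 ^ (P n).d * (1 / (n : ℝ) ^ (β + 2 * t)))
        ≤ (n : ℝ) ^ t * ((n : ℝ) ^ t * (1 / (n : ℝ) ^ (β + 2 * t))) := by gcongr
      _ = 1 / (n : ℝ) ^ β := by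
        rw [pow_add, two_mul, pow_add]
        field_simp

end Asymptotics

end VDPF

/-! ### Assembly of the theorem -/

theorem mainTheorem4 :
    ∃ C : ℕ, ∀ G : ∀ n, Bits n → Bits (2 * (n + 2)), IsPRG G →
    ∃ c : ℕ, ∀ P : ℕ → Params, Admissible P →
    ∀ G' : ∀ n, Bits n → Fin (P n).B → (P n).𝔾, IsBlockPRG P G' →
    ∃ A : ∀ n, Augmentation n (P n),
      (∀ n, 1 ≤ n →
        Complete (G n) (A n) ∧
        Correct (G n) (A n) (C * ((P n).d + 1) / (P n).k) ∧
        Sound (G n) (A n) (((P n).k + 1 : ℝ) ^ C / 2 ^ n) ∧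
        OverheadBound (G' n) (A n) ∧
        extraComm (A n) ≤ C * ((P n).k * (P n).d * n) ∧
        extraClientWork (A n) ≤ (P n).k * ((P n).d + n) ^ c ∧
        ∀ b, extraServerWork (A n) b ≤ (P n).k * 2 ^ (P n).d * ((P n).d + n) ^ c) ∧
      ZeroKnowledge G P A := by
  obtain ⟨C₀, hC₀⟩ := exists_prob_cuckoo_fail_le
  -- `C₀` is the constant of cuckoo hashing and 144 that of the communication.
  refine ⟨C₀ + 144, fun G hG => ?_⟩
  obtain ⟨cG, hcG⟩ := hG.efficient
  choose C hCs hC using hcG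
  -- The exponent needed for the servers; for the client 20 would be enough.
  refine ⟨cG + 22, fun P hP G' hG' => ?_⟩
  choose Q hQ1 hQ2 hQ3 using fun n => exists_proofCircuits (P := P n) (C n) (hC n)
  refine ⟨fun n => (Q n).augmentation (G' n), fun n hn => ⟨complete_augmentation _ _, ?_, ?_,
    overheadBound_augmentation _ _, ?_, ?_, fun b => ?_⟩,
    zeroKnowledge_augmentation hG hP hG' C hC ⟨cG, hCs⟩ Q fun n b => (hQ3 n b).2.1⟩
  · refine correct_augmentation _ _ fun inp => (hC₀ (P n) inp).trans ?_
    gcongr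
    linarith
  · intro f seed pub ext1 final ext2
    -- The error 2^(-n) is already smaller than claimed, since (k + 1)^C ≥ 1.
    refine (sound_augmentation (Q n) (G' n) f seed pub ext1 final ext2).trans ?_
    gcongr
    exact one_le_pow₀ (by linarith [Nat.cast_nonneg (α := ℝ) (P n).k])
  · exact (extraComm_augmentation (Q n) (G' n) hn).trans (Nat.mul_le_mul_right _ (by omega))
  · refine (extraClientWork_augmentation (Q n) (G' n) hn (hQ1 n) (hQ2 n)).trans
      (Nat.mul_le_mul_left _ (Nat.pow_le_pow_right ?_ (by omega)))
    omega
  · exact extraServerWork_augmentation (Q n) (G' n) hn (hCs n) b (hQ3 n b).1 (hQ3 n b).2.1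
      (hQ3 n b).2.2
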